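/- A *sum* $\oplus$ on the class $LO$ of all linear orders assigns to any linear orders $A,B$ a linear order $A\oplus B$ together with order embeddings $A\hookrightarrow A\oplus B$ and $B\hookrightarrow A\oplus B$ whose images partition $A\oplus B$. It is *regular* if $A\cong A'$ and $B\cong B'$ imply $A\oplus B\cong A'\oplus B'$; *associative* if $A\oplus(B\oplus C)\cong(A\oplus B)\oplus C$ for all $A,B,C$; and *canonically regular* if for all isomorphisms $\varphi:A\to A'$ and $\psi:B\to B'$ there is an isomorphism $A\oplus B\to A'\oplus B'$ that commutes with $\varphi$, $\psi$ and the embeddings of the summands. A sum is *good* on a class $K$ closed under isomorphism if $K$ is closed under $\oplus$ and $\oplus$ is regular, associative and commutative (up to isomorphism) on $K$. The usual sum (concatenation) is denoted by $+$. Let $\mathbb Q(2)$ be $\mathbb Q$ with every point replaced by a two-point order, and let $\mathbb Q(1,2)$ be $\mathbb Q$ with every point of a dense, co-dense subset replaced by a two-point order. A class $\mathcal C$ of linear orders is *left sum-generating* if it is closed under isomorphism, if $A+B\in\mathcal C$ implies $B\in\mathcal C$, and if $\sum_{i<\beta}A_i\in\mathcal C$ for every ordinal $\beta$ and all $A_i\in\mathcal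 C$. Let $\mathcal Q$ be the smallest left sum-generating class containing $\mathbb Q$, $\mathbb Q(1,2)+\mathbb Q$ and $\mathbb Q(2)+\mathbb Q$; let $\mathcal Q_{\aleph_0}$ be the class of its members of cardinality $\aleph_0$, and for each ordinal $\alpha$ let $\mathcal Q_\alpha^{card}$ be the class of its members without non-empty final segments of cardinality less than $\aleph_\alpha$. For a linear order $L$ let $L'_\alpha$ be its longest initial segment in $\mathcal Q_\alpha^{card}$, let $L_\alpha=L'_\alpha\setminus L'_{\alpha+1}$ and $L_R=L\setminus L'_0$. For a sum $\oplus_0$, the *sifted sum generated by $\oplus_0$* is $$A\oplus B=\Big(\sum_{\alpha\in Ord^*}A_\alpha\oplus_\alpha B_\alpha\Big)+A_R+B_R,\qquad \oplus_\alpha=+\ \text{ for }\alpha>0,$$ where $Ord^*$ is the class of ordinals in reverse order (for given $A,B$ all but a set of the terms are empty), with the embeddings given piecewise by those of the $\oplus_\alpha$ and the inclusions. **Theorem.** 1. Let $a=2+\mathbb Q(2)+\mathbb Q$, $q=\mathbb Q$ and $c=1+\mathbb Q+\mathbb Q(2)+\mathbb Q$. There is a sum $\oplus_0$ that is good on $\mathcal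 Q_{\aleph_0}$ and satisfies (up to isomorphism) $x\oplus_0x=x$ for $x\in\{a,q,c\}$ and $x\oplus_0y=c$ for distinct $x,y\in\{a,q,c\}$, such that the sifted sum $\oplus$ generated by $\oplus_0$ is a regular, associative sum on $LO$ with the same values on $\{a,q,c\}$, and $\oplus$ is not canonically regular. In particular, there is a regular, associative sum on the class of all linear orders that is not canonically regular. 2. There is likewise a sum $\oplus_0$ that is good on $\mathcal Q_{\aleph_0}$, whose multiplication table on $\mathbb Q(2)+\mathbb Q$ and $\mathbb Q(1,2)+\mathbb Q$ is that of $0$ and $1$ in $\mathbb Z/2\mathbb Z$ (up to isomorphism), and whose sifted sum $\oplus$ is a regular, associative sum on $LO$ such that $[0]\mapsto\mathbb Q(2)+\mathbb Q$, $[1]\mapsto\mathbb Q(1,2)+\mathbb Q$ represents $\mathbb Z/2\mathbb Z$; that is, this map $\phi$ into the order types is injective and $\phi(g+h)=\phi(g)\oplus\phi(h)$ for all $g,h\in\mathbb Z/2\mathbb Z$. -/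

import Mathlib

universe u

open Cardinal

noncomputable section

/-! ### Linear orders, isomorphism, and concatenation -/

/-- Isomorphism `A ≅ B` of linear orders. -/
def OrdIso (A B : LinOrd.{u}) : Prop := Nonempty (A ≃o B)

/-- The usual sum `A + B`: a copy of `A` followed by a copy of `B`. -/
def concat (A B : LinOrd.{u}) : LinOrd.{u} := LinOrd.of (A ⊕ₗ B)

/-! ### Sums of linear orders and their properties -/

/-- A (global) sum on the class of linear orders: an order `A ⊕ B` for all `A`, `B`, together with
embeddings of `A` and `B`, such that every point of `A ⊕ B` comes from exactly one point of exactly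
one of the two summands. -/
structure LinSum where
  op : LinOrd.{u} → LinOrd.{u} → LinOrd.{u}
  inl : ∀ A B : LinOrd.{u}, A ↪o op A B
  inr : ∀ A B : LinOrd.{u}, B ↪o op A B
  isCompl_range : ∀ A B : LinOrd.{u}, IsCompl (Set.range (inl A B)) (Set.range (inr A B))

namespace LinSum

/-- The usual sum `+`, with its usual embeddings. -/
def std : LinSum.{u} where
  op := concat
  inl _ _ := OrderEmbedding.ofMapLEIff (fun a => toLex (Sum.inl a)) (fun _ _ => Sum.Lex.inl_le_inl_iff)
  inr _ _ := OrderEmbedding.ofMapLEIff (fun b => toLex (Sum.inr b)) (fun _ _ => Sum.Lex.inr_le_inr_iff)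
  isCompl_range A B := by
    refine ⟨Set.disjoint_left.2 ?_, codisjoint_iff_le_sup.2 ?_⟩
    · rintro _ ⟨a, rfl⟩ ⟨b, hb⟩
      have h : (Sum.inr b : A ⊕ B) = Sum.inl a := toLex.injective hb
      cases h
    · rintro x -
      obtain ⟨y, rfl⟩ := toLex.surjective x
      rcases y with a | b
      · exact Or.inl ⟨a, rfl⟩
      · exact Or.inr ⟨b, rfl⟩

/-- `⊕` is regular: isomorphic summands have isomorphic sums. -/
def IsRegular (S : LinSum.{u}) : Prop :=
  ∀ A A' B B' : LinOrd.{u}, OrdIso A A' → OrdIso B B' → OrdIso (S.op A B) (S.op A' B')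

/-- `⊕` is associative, up to isomorphism. -/
def IsAssociative (S : LinSum.{u}) : Prop :=
  ∀ A B C : LinOrd.{u}, OrdIso (S.op A (S.op B C)) (S.op (S.op A B) C)

/-- `⊕` is canonically regular: for all isomorphisms `φ : A ≅ A'` and `ψ : B ≅ B'` there is an
isomorphism `A ⊕ B ≅ A' ⊕ B'` that commutes with `φ`, `ψ` and the embeddings of the summands. -/
def IsCanonicallyRegular (S : LinSum.{u}) : Prop :=
  ∀ (A A' B B' : LinOrd.{u}) (φ : A ≃o A') (ψ : B ≃o B'),
    ∃ χ : S.op A B ≃o S.op A' B',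
      (∀ a : A, χ (S.inl A B a) = S.inl A' B' (φ a)) ∧
      (∀ b : B, χ (S.inr A B b) = S.inr A' B' (ψ b))

/-- The sum `⊕` restricts to a good sum on the class `K`: the class `K` is closed under
isomorphism and under `⊕`, and on `K` the sum is regular, associative and commutative. A sum on a
class is by definition the restriction of a global sum, so only the behaviour on `K` matters. -/
structure IsGoodOn (S : LinSum.{u}) (K : LinOrd.{u} → Prop) : Prop where
  iso_mem : ∀ A B, OrdIso A B → K A → K B
  op_mem : ∀ A B, K A → K B → K (S.op A B)
  regular : ∀ A A' B B', K A → K A' → K B → K B' → OrdIso A A' → OrdIso B B' →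
    OrdIso (S.op A B) (S.op A' B')
  assoc : ∀ A B C, K A → K B → K C → OrdIso (S.op A (S.op B C)) (S.op (S.op A B) C)
  comm : ∀ A B, K A → K B → OrdIso (S.op A B) (S.op B A)

/-- `⊕` has the multiplication table `m` on the orders `x i`, that is `x i ⊕ x j ≅ x (m i j)`. -/
def HasTable (S : LinSum.{u}) {ι : Type} (x : ι → LinOrd.{u}) (m : ι → ι → ι) : Prop :=
  ∀ i j, OrdIso (S.op (x i) (x j)) (x (m i j))

/-- The operation on order types induced by a regular sum. -/
def typeOp (S : LinSum.{u}) (hS : S.IsRegular) :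
    OrderType.{u} → OrderType.{u} → OrderType.{u} :=
  Quotient.map₂ S.op fun A A' hA B B' hB => hS A A' B B' hA hB

end LinSum

/-- The map `φ` represents the group `G` in the order types with the operation `star`. -/
def IsRepresentation (star : OrderType.{u} → OrderType.{u} → OrderType.{u}) {G : Type} [Group G]
    (φ : G → OrderType.{u}) : Prop :=
  Function.Injective φ ∧ ∀ g h : G, φ (g * h) = star (φ g) (φ h)

/-! ### Sum-generating classes -/

/-- Left sum-generating classes: closed under isomorphism, under final segments, and under sums
indexed by well-orders (the empty index included). -/
structure IsLeftSGC (C : LinOrd.{u} → Prop) : Prop where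
  iso_mem : ∀ A B, OrdIso A B → C A → C B
  right_mem : ∀ A B, C (concat A B) → C B
  lexSum_mem : ∀ (ι : Type u) [LinearOrder ι] [WellFoundedLT ι] (A : ι → LinOrd.{u}),
    (∀ i, C (A i)) → C (LinOrd.of (Σₗ i, A i))

/-- The left sum-generating class `⟨G⟩` generated by `G`, the smallest one that contains `G`. -/
def sgcGenerated (G : Set LinOrd.{u}) (L : LinOrd.{u}) : Prop :=
  ∀ C : LinOrd.{u} → Prop, IsLeftSGC C → (∀ X ∈ G, C X) → C L

/-- The `α`-th step `𝒞_α^card` of the cardinality filtration of `𝒞`: the members of `𝒞` with no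
non-empty final segment of cardinality less than `ℵ_α`. -/
def cardFiltration (C : LinOrd.{u} → Prop) (α : Ordinal.{u}) (L : LinOrd.{u}) : Prop :=
  C L ∧ ∀ F : UpperSet L, (F : Set L).Nonempty → ℵ_ α ≤ #F

/-! ### Sifted sums -/

/-- The longest initial segment of `L` in `C`, as the union of all initial segments of `L` in `C`
(for a left sum-generating class `C` this union belongs to `C`). -/
def longestInitial (C : LinOrd.{u} → Prop) (L : LinOrd.{u}) : LowerSet L :=
  sSup {I : LowerSet L | C (LinOrd.of I)}

/-- `L_α = L'_α \ L'_{α+1}`, where `L'_α` is the longest initial segment of `L` in `C α`. -/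
def layer (C : Ordinal.{u} → LinOrd.{u} → Prop) (α : Ordinal.{u}) (L : LinOrd.{u}) : LinOrd.{u} :=
  LinOrd.of ↥((longestInitial (C α) L : Set L) \ longestInitial (C (α + 1)) L)

/-- `L_R`, the final segment of `L` that remains after the longest initial segment in `C 0`. -/
def remainder (C : Ordinal.{u} → LinOrd.{u} → Prop) (L : LinOrd.{u}) : LinOrd.{u} :=
  LinOrd.of ↥((longestInitial (C 0) L : Set L)ᶜ)

/-- The order `(∑_{α ∈ Ord*} A_α ⊕_α B_α) + A_R + B_R`. As an iterated disjoint union over all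
ordinals of the universe `u` it formally lives one universe higher. -/
abbrev SiftedOrder (C : Ordinal.{u} → LinOrd.{u} → Prop) (S : Ordinal.{u} → LinSum.{u})
    (A B : LinOrd.{u}) : Type (u + 1) :=
  (Σₗ α : (Ordinal.{u})ᵒᵈ, (S (OrderDual.ofDual α)).op
      (layer C (OrderDual.ofDual α) A) (layer C (OrderDual.ofDual α) B)) ⊕ₗ
    (remainder C A ⊕ₗ remainder C B)

/-- `T` is the sifted sum generated by the scheme `(C α, S α)`, for `α` an ordinal: the order
`T.op A B` is `(∑_{α ∈ Ord*} A_α ⊕_α B_α) + A_R + B_R`, and its embeddings of `A` and `B` are given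
on the pieces `A_α`, `B_α` by those of `⊕_α` and on `A_R`, `B_R` by the inclusions. -/
def IsSiftedSum (C : Ordinal.{u} → LinOrd.{u} → Prop) (S : Ordinal.{u} → LinSum.{u})
    (T : LinSum.{u}) : Prop :=
  ∀ A B : LinOrd.{u}, ∃ e : T.op A B ≃o SiftedOrder C S A B,
    (∀ (α : Ordinal.{u}) (a : layer C α A), e (T.inl A B a.1) =
      toLex (Sum.inl (toLex ⟨OrderDual.toDual α, (S α).inl (layer C α A) (layer C α B) a⟩))) ∧
    (∀ (α : Ordinal.{u}) (b : layer C α B), e (T.inr A B b.1) =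
      toLex (Sum.inl (toLex ⟨OrderDual.toDual α, (S α).inr (layer C α A) (layer C α B) b⟩))) ∧
    (∀ a : remainder C A, e (T.inl A B a.1) = toLex (Sum.inr (toLex (Sum.inl a)))) ∧
    (∀ b : remainder C B, e (T.inr A B b.1) = toLex (Sum.inr (toLex (Sum.inr b))))

/-! ### The concrete orders and the class `𝒬` -/

/-- The finite order `n`. -/
def finOrd (n : ℕ) : LinOrd.{u} := LinOrd.of (ULift.{u} (Fin n))

/-- The order `ℚ`. -/
def rat : LinOrd.{u} := LinOrd.of (ULift.{u} ℚ)

/-- The order `ℚ(2)`: every point of `ℚ` is replaced by two points. -/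
def rat2 : LinOrd.{u} := LinOrd.of (ULift.{u} (Σₗ _ : ℚ, Fin 2))

/-- The order `ℚ(1, 2)`: the rationals are split into two dense sets (those with odd denominator
and those with even denominator); the points of the first one are kept, and those of the second one
are replaced by two points. -/
def rat12 : LinOrd.{u} := LinOrd.of (ULift.{u} (Σₗ q : ℚ, Fin (if Even q.den then 2 else 1)))

/-- The class `𝒬 = ⟨ℚ, ℚ(1, 2) + ℚ, ℚ(2) + ℚ⟩`. -/
def classQ : LinOrd.{u} → Prop :=
  sgcGenerated {rat, concat rat12 rat, concat rat2 rat}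

/-- The class of the members of `𝒬` of cardinality `ℵ₀`. -/
def countableQ (L : LinOrd.{u}) : Prop := classQ L ∧ #L = ℵ₀

/-- The sifting scheme `(⊕_α)` with `⊕_0 = S₀` and `⊕_α = +` for `α > 0`. -/
def schemeFrom (S₀ : LinSum.{u}) (α : Ordinal.{u}) : LinSum.{u} :=
  open Classical in if α = 0 then S₀ else LinSum.std

/-- The sifted sum generated by `(𝒬_α^card, ⊕_α)`, where `⊕_0 = S₀` and `⊕_α = +` for `α > 0`. -/
def IsSiftedFrom (S₀ S : LinSum.{u}) : Prop :=
  IsSiftedSum (cardFiltration classQ) (schemeFrom S₀) S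

/-- The orders `2 + ℚ(2) + ℚ`, `ℚ` and `1 + ℚ + ℚ(2) + ℚ`. -/
def tripleE : Fin 3 → LinOrd.{u} :=
  ![concat (finOrd 2) (concat rat2 rat), rat,
    concat (finOrd 1) (concat rat (concat rat2 rat))]

/-- The table on `tripleE`: each of the orders is idempotent, and the sum of two different ones is
the third order of the list. -/
def tableE (i j : Fin 3) : Fin 3 := if i = j then i else 2

/-- The orders `ℚ(2) + ℚ` and `ℚ(1, 2) + ℚ`, attached to the elements `0` and `1` of `ℤ/2ℤ`. -/
def pairZ2 : ZMod 2 → LinOrd.{u} :=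
  fun g => if g = 0 then concat rat2 rat else concat rat12 rat

end

/-! ### Lexicographic sums and isomorphism -/

section Lex

variable {ι κ Z α β : Type*} [LinearOrder ι] [LinearOrder κ] [LinearOrder Z]
  [LinearOrder α] [LinearOrder β] {A : ι → Type*} [∀ i, LinearOrder (A i)]
  {B : κ → Type*} [∀ k, LinearOrder (B k)]

/-! Sifting. Inside the longest initial segment of L in 𝒬, sort the points by the number of points
above them there; those with exactly ℵ_α such points form L_α (`mem_layerSet`). An induction over
the generated class (`classQ.tailSplit`) shows for every infinite κ that fewer than κ points have a
tail of size below κ, and that the other points form an order in 𝒬. Hence every layer is in 𝒬, L_α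
has at most ℵ_α points, and the indices of non-empty layers are reversely well-ordered. It follows
that the layers of a sifted sum are the sums of the layers (`IsSiftedSum.layer_op`,
`IsSiftedSum.remainder_op`), so regularity and associativity may be checked layer by layer. For α >
0 and on remainders they are those of concatenation; on the countable layer 0 they are the goodness
of ⊕₀. Countable members of 𝒬 are their own layer 0, so the table of ⊕₀ survives.

Construction of ⊕₀. A non-empty countable member of 𝒬 has the form ∑_n (R n + ℚ)
(`classQ.exists_ratSum`), and ℚ absorbs every countable order R: it splits into copies of ℚ and of
R. Replacing R n by ℚ(2) + ℚ for all n > 0 therefore produces an order, the target of x, that splits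
into x and y for every y in the class (`IsTarget.splits`). Outside the prescribed table, the product
of two types is the target of one of them, chosen by a fixed linear order of the targets; this
operation is commutative and associative (`exists_extended_table`). Targets have jumps arbitrarily
far up, and the entries of the tables do not because they end in ℚ, so the two definitions do not
interfere. It remains to split the table entries themselves; for ℤ/2ℤ the essential case is that
ℚ(2) splits into two copies of ℚ(1,2), by Skolem's theorem on dense colourings.

Failure of canonical regularity. Automorphisms of ℚ are transitive, so in a canonically regular sum
each point of a has the whole copy of ℚ on one side. Since a ⊕ ℚ ≅ c, the least point of c comes
from a and has no successor, so ℚ must sit exactly between the first two points of a. Then the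
second point of a is a place where jumps begin abruptly after a jump-free stretch, and c has no such
point (`not_isFirstJumpLimit_tripleE_two`). -/

theorem sigmaLex_mk_lt {i j : ι} (h : i < j) (a : A i) (b : A j) :
    (toLex ⟨i, a⟩ : Σₗ i, A i) < toLex ⟨j, b⟩ :=
  Sigma.Lex.left _ _ h

theorem sigmaLex_mk_lt_iff {i : ι} {a b : A i} :
    (toLex ⟨i, a⟩ : Σₗ i, A i) < toLex ⟨i, b⟩ ↔ a < b := by
  rw [Sigma.Lex.lt_def]
  constructor
  · rintro (h | ⟨_, h⟩)
    · exact absurd h (lt_irrefl i)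
    · exact h
  · exact fun h => Or.inr ⟨rfl, h⟩

theorem sigmaLex_mk_le_iff {i : ι} {a b : A i} :
    (toLex ⟨i, a⟩ : Σₗ i, A i) ≤ toLex ⟨i, b⟩ ↔ a ≤ b := by
  rw [← not_lt, sigmaLex_mk_lt_iff, not_lt]

theorem sigmaLex_fst_mono : Monotone (fun x : Σₗ i, A i => (ofLex x).1) := by
  intro x y h
  rcases Sigma.Lex.le_def.1 h with h | ⟨h, -⟩
  · exact h.le
  · exact h.le

theorem strictMono_sigmaLex (g : ∀ i, A i → Z) (h₁ : ∀ i, StrictMono (g i))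
    (h₂ : ∀ i j, i < j → ∀ a b, g i a < g j b) :
    StrictMono (fun x : Σₗ i, A i => g (ofLex x).1 (ofLex x).2) := by
  rintro ⟨i, a⟩ ⟨j, b⟩ h
  rcases Sigma.Lex.lt_def.1 h with h | ⟨h, h'⟩
  · exact h₂ _ _ h _ _
  · change i = j at h
    subst h
    exact h₁ _ h'

theorem strictMono_sumLex (f : α → Z) (g : β → Z) (hf : StrictMono f) (hg : StrictMono g)
    (h : ∀ a b, f a < g b) : StrictMono (fun x : α ⊕ₗ β => Sum.elim f g (ofLex x)) := by
  intro x y hxy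
  obtain ⟨x, rfl⟩ := toLex.surjective x
  obtain ⟨y, rfl⟩ := toLex.surjective y
  rcases x with a | a <;> rcases y with b | b
  · exact hf (Sum.Lex.inl_lt_inl_iff.1 hxy)
  · exact h a b
  · exact absurd hxy Sum.Lex.not_inr_lt_inl
  · exact hg (Sum.Lex.inr_lt_inr_iff.1 hxy)

theorem strictMono_sumLexMap {γ δ : Type*} [LinearOrder γ] [LinearOrder δ] {f : α → γ} {g : β → δ}
    (hf : StrictMono f) (hg : StrictMono g) :
    StrictMono (fun x : α ⊕ₗ β => (toLex (Sum.map f g (ofLex x)) : γ ⊕ₗ δ)) := by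
  intro x y hxy
  obtain ⟨x, rfl⟩ := toLex.surjective x
  obtain ⟨y, rfl⟩ := toLex.surjective y
  rcases x with a | a <;> rcases y with b | b
  · exact Sum.Lex.inl_lt_inl_iff.2 (hf (Sum.Lex.inl_lt_inl_iff.1 hxy))
  · exact Sum.Lex.inl_lt_inr _ _
  · exact absurd hxy Sum.Lex.not_inr_lt_inl
  · exact Sum.Lex.inr_lt_inr_iff.2 (hg (Sum.Lex.inr_lt_inr_iff.1 hxy))

theorem nonempty_sigmaLexCongr (e : ι ≃o κ) (h : ∀ i, Nonempty (A i ≃o B (e i))) :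
    Nonempty ((Σₗ i, A i) ≃o Σₗ k, B k) := by
  let f := fun i => (h i).some
  refine ⟨StrictMono.orderIsoOfSurjective _
    (strictMono_sigmaLex (fun i a => (toLex ⟨e i, f i a⟩ : Σₗ k, B k)) ?_ ?_) ?_⟩
  · intro i a b hab
    exact sigmaLex_mk_lt_iff.2 ((f i).strictMono hab)
  · intro i j hij a b
    exact sigmaLex_mk_lt (e.strictMono hij) _ _
  · rintro ⟨k, b⟩
    obtain ⟨i, rfl⟩ := e.surjective k
    exact ⟨toLex ⟨i, (f i).symm b⟩, congrArg (fun c => (toLex ⟨e i, c⟩ : Σₗ k, B k)) ((f i).apply_symm_apply b)⟩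

/-- A linear order is the sum of the fibres of a monotone map. -/
theorem nonempty_fiberIso (f : α → κ) (hf : Monotone f) :
    Nonempty ((Σₗ k, {a : α // f a = k}) ≃o α) := by
  refine ⟨StrictMono.orderIsoOfSurjective _
    (strictMono_sigmaLex (fun k (a : {a : α // f a = k}) => a.1) (fun _ _ _ h => h) ?_) ?_⟩
  · rintro i j hij ⟨a, rfl⟩ ⟨b, rfl⟩
    exact lt_of_not_ge fun h => hij.not_ge (hf h)
  · intro a
    exact ⟨toLex ⟨f a, a, rfl⟩, rfl⟩

theorem nonempty_splitIso (s : Set α) (hs : IsLowerSet s) : Nonempty ((s ⊕ₗ ↥sᶜ) ≃o α) := by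
  refine ⟨StrictMono.orderIsoOfSurjective _
    (strictMono_sumLex (fun a : s => a.1) (fun a : ↥sᶜ => a.1) (fun _ _ h => h)
      (fun _ _ h => h) ?_) ?_⟩
  · rintro ⟨a, ha⟩ ⟨b, hb⟩
    exact lt_of_not_ge fun h => hb (hs h ha)
  · intro a
    by_cases h : a ∈ s
    · exact ⟨toLex (Sum.inl ⟨a, h⟩), rfl⟩
    · exact ⟨toLex (Sum.inr ⟨a, h⟩), rfl⟩

theorem nonempty_sigmaLexUnique [Unique ι] : Nonempty ((Σₗ i, A i) ≃o A default) := by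
  refine ⟨(StrictMono.orderIsoOfSurjective (fun a : A default => (toLex ⟨default, a⟩ : Σₗ i, A i))
    (fun _ _ h => sigmaLex_mk_lt_iff.2 h) ?_).symm⟩
  rintro ⟨i, a⟩
  obtain rfl := Unique.eq_default i
  exact ⟨a, rfl⟩

end Lex

namespace OrdIso

theorem refl (A : LinOrd.{u}) : OrdIso A A := ⟨OrderIso.refl _⟩

theorem symm {A B : LinOrd.{u}} (h : OrdIso A B) : OrdIso B A := h.map OrderIso.symm

theorem trans {A B C : LinOrd.{u}} (h : OrdIso A B) (h' : OrdIso B C) : OrdIso A C :=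
  h.elim fun e => h'.map e.trans

theorem concat {A A' B B' : LinOrd.{u}} (h : OrdIso A A') (h' : OrdIso B B') :
    OrdIso (concat A B) (_root_.concat A' B') :=
  h.elim fun e => h'.map fun e' => OrderIso.sumLexCongr e e'

theorem assoc (A B C : LinOrd.{u}) :
    OrdIso (_root_.concat (_root_.concat A B) C) (_root_.concat A (_root_.concat B C)) :=
  ⟨OrderIso.sumLexAssoc A B C⟩

theorem concat_empty (A B : LinOrd.{u}) [IsEmpty B] : OrdIso (_root_.concat A B) A :=
  ⟨OrderIso.sumLexEmpty⟩

theorem empty_concat (A B : LinOrd.{u}) [IsEmpty A] : OrdIso (_root_.concat A B) B :=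
  ⟨OrderIso.emptySumLex⟩

end OrdIso

/-- The sum of the orders `A i` along the linear order `ι`. -/
abbrev lexSum (ι : Type u) [LinearOrder ι] (A : ι → LinOrd.{u}) : LinOrd.{u} :=
  LinOrd.of (Σₗ i, A i)

theorem OrdIso.lexSum_congr {ι : Type u} [LinearOrder ι] {A B : ι → LinOrd.{u}}
    (h : ∀ i, OrdIso (A i) (B i)) : OrdIso (lexSum ι A) (lexSum ι B) :=
  nonempty_sigmaLexCongr (OrderIso.refl ι) h

theorem OrdIso.lexSum_const_unique {ι : Type u} [LinearOrder ι] {A : ι → LinOrd.{u}}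
    (h : ∀ i, Nonempty (Unique (A i))) : OrdIso (lexSum ι A) (LinOrd.of ι) := by
  refine ⟨StrictMono.orderIsoOfSurjective (fun x : Σₗ i, A i => (ofLex x).1) ?_ ?_⟩
  · refine strictMono_sigmaLex (fun i _ => i) (fun i a b hab => ?_) (fun _ _ h _ _ => h)
    obtain ⟨_⟩ := h i
    exact absurd hab (by simp [Subsingleton.elim a b])
  · intro i
    obtain ⟨hu⟩ := h i
    exact ⟨toLex ⟨i, default⟩, rfl⟩

/-! ### Orders of the type of the rationals -/

/-- Cantor's theorem. It reduces the absorption identities for ℚ to order properties found by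
instance search. -/
theorem OrdIso.rat_of (L : LinOrd.{u}) [Countable L] [DenselyOrdered L] [NoMinOrder L]
    [NoMaxOrder L] [Nonempty L] : OrdIso L rat :=
  ⟨(Order.iso_of_countable_dense L ℚ).some.trans (ULift.orderIso (α := ℚ)).symm⟩

instance : Countable rat.{u} := inferInstanceAs (Countable (ULift ℚ))
instance : Nonempty rat.{u} := inferInstanceAs (Nonempty (ULift ℚ))
instance : DenselyOrdered rat.{u} :=
  (denselyOrdered_iff_of_orderIsoClass (ULift.orderIso (α := ℚ))).2 inferInstance
instance : NoMinOrder rat.{u} := ⟨fun a => ⟨⟨a.down - 1⟩, show a.down - 1 < a.down by linarith⟩⟩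
instance : NoMaxOrder rat.{u} := ⟨fun a => ⟨⟨a.down + 1⟩, show a.down < a.down + 1 by linarith⟩⟩

instance (A B : LinOrd.{u}) [Countable A] [Countable B] : Countable (concat A B) :=
  inferInstanceAs (Countable (A ⊕ B))

instance (ι : Type u) [LinearOrder ι] (A : ι → LinOrd.{u}) [Countable ι]
    [∀ i, Countable (A i)] : Countable (lexSum ι A) :=
  inferInstanceAs (Countable (Σ i, A i))

instance : Countable rat2.{u} := inferInstanceAs (Countable (ULift (Σ _ : ℚ, Fin 2)))
instance : Countable rat12.{u} :=
  inferInstanceAs (Countable (ULift (Σ q : ℚ, Fin (if Even q.den then 2 else 1))))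
instance (n : ℕ) : Countable (finOrd.{u} n) := inferInstanceAs (Countable (ULift (Fin n)))

theorem OrdIso.rat_concat_rat : OrdIso (_root_.concat rat.{u} rat) rat := by
  have : DenselyOrdered (_root_.concat rat.{u} rat) := inferInstanceAs (DenselyOrdered (rat.{u} ⊕ₗ rat))
  have : NoMinOrder (_root_.concat rat.{u} rat) := inferInstanceAs (NoMinOrder (rat.{u} ⊕ₗ rat))
  have : NoMaxOrder (_root_.concat rat.{u} rat) := inferInstanceAs (NoMaxOrder (rat.{u} ⊕ₗ rat))
  have : Nonempty (_root_.concat rat.{u} rat) := inferInstanceAs (Nonempty (rat.{u} ⊕ rat))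
  exact OrdIso.rat_of _

/-- `ℚ + 1 + ℚ ≅ ℚ`. -/
theorem OrdIso.rat_concat_one_concat_rat (A : LinOrd.{u}) [Unique A] :
    OrdIso (_root_.concat rat.{u} (_root_.concat A rat)) rat := by
  have hd : DenselyOrdered (A ⊕ₗ rat.{u}) := by
    constructor
    intro x y hxy
    obtain ⟨x, rfl⟩ := toLex.surjective x
    obtain ⟨y, rfl⟩ := toLex.surjective y
    rcases x with a | a <;> rcases y with b | b
    · exact absurd (Sum.Lex.inl_lt_inl_iff.1 hxy) (by simp [Subsingleton.elim a b])
    · obtain ⟨c, hc⟩ := exists_lt b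
      exact ⟨toLex (Sum.inr c), Sum.Lex.inl_lt_inr _ _, Sum.Lex.inr_lt_inr_iff.2 hc⟩
    · exact absurd hxy Sum.Lex.not_inr_lt_inl
    · obtain ⟨c, hc⟩ := exists_between (Sum.Lex.inr_lt_inr_iff.1 hxy)
      exact ⟨toLex (Sum.inr c), Sum.Lex.inr_lt_inr_iff.2 hc.1, Sum.Lex.inr_lt_inr_iff.2 hc.2⟩
  have : DenselyOrdered (_root_.concat rat.{u} (_root_.concat A rat)) :=
    inferInstanceAs (DenselyOrdered (rat.{u} ⊕ₗ (A ⊕ₗ rat)))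
  have : NoMinOrder (_root_.concat rat.{u} (_root_.concat A rat)) :=
    inferInstanceAs (NoMinOrder (rat.{u} ⊕ₗ (A ⊕ₗ rat)))
  have : NoMaxOrder (_root_.concat rat.{u} (_root_.concat A rat)) :=
    inferInstanceAs (NoMaxOrder (rat.{u} ⊕ₗ (A ⊕ₗ rat)))
  have : Nonempty (_root_.concat rat.{u} (_root_.concat A rat)) :=
    inferInstanceAs (Nonempty (rat.{u} ⊕ (A ⊕ rat)))
  exact OrdIso.rat_of _

/-- Summands without endpoints leave no jump between neighbours, so the sum is dense whatever the
index order is. -/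
theorem OrdIso.lexSum_rat {ι : Type u} [LinearOrder ι] [Countable ι] [Nonempty ι]
    {A : ι → LinOrd.{u}} (h : ∀ i, OrdIso (A i) rat) : OrdIso (lexSum ι A) rat := by
  refine (OrdIso.lexSum_congr h).trans ?_
  have : DenselyOrdered (lexSum ι fun _ => rat.{u}) := inferInstanceAs (DenselyOrdered (Σₗ _ : ι, rat.{u}))
  have : NoMinOrder (lexSum ι fun _ => rat.{u}) := inferInstanceAs (NoMinOrder (Σₗ _ : ι, rat.{u}))
  have : NoMaxOrder (lexSum ι fun _ => rat.{u}) := inferInstanceAs (NoMaxOrder (Σₗ _ : ι, rat.{u}))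
  have : Nonempty (lexSum ι fun _ => rat.{u}) := inferInstanceAs (Nonempty (Σ _ : ι, rat.{u}))
  exact OrdIso.rat_of _

/-! ### Splittings -/

/-- `Z` is the disjoint union of a copy of `A` and a copy of `B`. -/
def Splits (Z A B : LinOrd.{u}) : Prop :=
  ∃ (i : A ↪o Z) (j : B ↪o Z), IsCompl (Set.range i) (Set.range j)

namespace Splits

theorem of_strictMono {Z A B : LinOrd.{u}} (i : A → Z) (j : B → Z) (hi : StrictMono i)
    (hj : StrictMono j) (hd : ∀ a b, i a ≠ j b) (hc : ∀ z, (∃ a, i a = z) ∨ ∃ b, j b = z) :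
    Splits Z A B := by
  refine ⟨OrderEmbedding.ofStrictMono i hi, OrderEmbedding.ofStrictMono j hj, ?_, ?_⟩
  · refine Set.disjoint_left.2 ?_
    rintro _ ⟨a, rfl⟩ ⟨b, hb⟩
    exact hd a b hb.symm
  · exact codisjoint_iff_le_sup.2 fun z _ => hc z

theorem symm {Z A B : LinOrd.{u}} (h : Splits Z A B) : Splits Z B A := by
  obtain ⟨i, j, h⟩ := h
  exact ⟨j, i, h.symm⟩

theorem congr {Z A B Z' A' B' : LinOrd.{u}} (h : Splits Z A B) (hZ : OrdIso Z Z')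
    (hA : OrdIso A A') (hB : OrdIso B B') : Splits Z' A' B' := by
  obtain ⟨i, j, h⟩ := h
  obtain ⟨z⟩ := hZ
  obtain ⟨a⟩ := hA
  obtain ⟨b⟩ := hB
  refine of_strictMono (fun x => z (i (a.symm x))) (fun x => z (j (b.symm x)))
    (fun x y hxy => by simpa using hxy) (fun x y hxy => by simpa using hxy) ?_ ?_
  · intro x y hxy
    exact Set.disjoint_left.1 h.disjoint ⟨_, rfl⟩ ⟨_, (z.injective hxy).symm⟩
  · intro x
    rcases codisjoint_iff_le_sup.1 h.codisjoint (Set.mem_univ (z.symm x)) with ⟨y, hy⟩ | ⟨y, hy⟩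
    · exact Or.inl ⟨a y, by simp [hy]⟩
    · exact Or.inr ⟨b y, by simp [hy]⟩

theorem left (A B : LinOrd.{u}) [IsEmpty B] : Splits A A B :=
  of_strictMono id isEmptyElim strictMono_id (fun b => isEmptyElim b) (fun _ b => isEmptyElim b)
    (fun z => Or.inl ⟨z, rfl⟩)

theorem right (A B : LinOrd.{u}) [IsEmpty A] : Splits B A B := (left B A).symm

theorem iso_left {Z A B : LinOrd.{u}} [IsEmpty B] (h : Splits Z A B) : OrdIso Z A := by
  obtain ⟨i, j, h⟩ := h
  refine OrdIso.symm ⟨StrictMono.orderIsoOfSurjective i i.strictMono fun z => ?_⟩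
  rcases codisjoint_iff_le_sup.1 h.codisjoint (Set.mem_univ z) with hz | ⟨y, hy⟩
  · exact hz
  · exact isEmptyElim y

theorem concat_self (A B : LinOrd.{u}) : Splits (concat A B) A B :=
  ⟨LinSum.std.inl A B, LinSum.std.inr A B, LinSum.std.isCompl_range A B⟩

theorem lexSum {ι : Type u} [LinearOrder ι] {Z A B : ι → LinOrd.{u}}
    (h : ∀ i, Splits (Z i) (A i) (B i)) :
    Splits (lexSum ι Z) (_root_.lexSum ι A) (_root_.lexSum ι B) := by
  choose f g h using h
  refine of_strictMono
    (fun x => (toLex ⟨(ofLex x).1, f _ (ofLex x).2⟩ : Σₗ i, Z i))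
    (fun x => (toLex ⟨(ofLex x).1, g _ (ofLex x).2⟩ : Σₗ i, Z i)) ?_ ?_ ?_ ?_
  · exact strictMono_sigmaLex (fun i a => (toLex ⟨i, f i a⟩ : Σₗ i, Z i))
      (fun i a b hab => sigmaLex_mk_lt_iff.2 ((f i).strictMono hab))
      (fun i j hij a b => sigmaLex_mk_lt hij _ _)
  · exact strictMono_sigmaLex (fun i a => (toLex ⟨i, g i a⟩ : Σₗ i, Z i))
      (fun i a b hab => sigmaLex_mk_lt_iff.2 ((g i).strictMono hab))
      (fun i j hij a b => sigmaLex_mk_lt hij _ _)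
  · rintro ⟨i, a⟩ ⟨j, b⟩ hab
    have hij : i = j := congrArg (fun x : Σₗ i, Z i => (ofLex x).1) hab
    subst hij
    have hab' : f i a = g i b := by
      have := toLex.injective hab
      exact eq_of_heq (Sigma.mk.inj this).2
    exact Set.disjoint_left.1 (h i).disjoint ⟨a, rfl⟩ ⟨b, hab'.symm⟩
  · rintro ⟨i, z⟩
    rcases codisjoint_iff_le_sup.1 (h i).codisjoint (Set.mem_univ z) with ⟨a, ha⟩ | ⟨b, hb⟩
    · exact Or.inl ⟨toLex ⟨i, a⟩, by rw [← ha]; rfl⟩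
    · exact Or.inr ⟨toLex ⟨i, b⟩, by rw [← hb]; rfl⟩

theorem concat {Z A B Z' A' B' : LinOrd.{u}} (h : Splits Z A B) (h' : Splits Z' A' B') :
    Splits (concat Z Z') (_root_.concat A A') (_root_.concat B B') := by
  obtain ⟨f, g, h⟩ := h
  obtain ⟨f', g', h'⟩ := h'
  refine of_strictMono
    (fun x => (toLex (Sum.map f f' (ofLex x)) : Z ⊕ₗ Z'))
    (fun x => (toLex (Sum.map g g' (ofLex x)) : Z ⊕ₗ Z')) ?_ ?_ ?_ ?_
  · exact strictMono_sumLexMap f.strictMono f'.strictMono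
  · exact strictMono_sumLexMap g.strictMono g'.strictMono
  · rintro (a | a) (b | b) hab
    · exact Set.disjoint_left.1 h.disjoint ⟨a, rfl⟩ ⟨b, (Sum.inl.inj hab).symm⟩
    · cases hab
    · cases hab
    · exact Set.disjoint_left.1 h'.disjoint ⟨a, rfl⟩ ⟨b, (Sum.inr.inj hab).symm⟩
  · rintro (z | z)
    · rcases codisjoint_iff_le_sup.1 h.codisjoint (Set.mem_univ z) with ⟨a, ha⟩ | ⟨b, hb⟩
      · exact Or.inl ⟨toLex (Sum.inl a), by rw [← ha]; rfl⟩
      · exact Or.inr ⟨toLex (Sum.inl b), by rw [← hb]; rfl⟩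
    · rcases codisjoint_iff_le_sup.1 h'.codisjoint (Set.mem_univ z) with ⟨a, ha⟩ | ⟨b, hb⟩
      · exact Or.inl ⟨toLex (Sum.inr a), by rw [← ha]; rfl⟩
      · exact Or.inr ⟨toLex (Sum.inr b), by rw [← hb]; rfl⟩

end Splits

/-! ### Dense colourings -/

section Skolem

variable {α β κ : Type*} [LinearOrder α] [LinearOrder β]

/-- Every colour of the colouring `c` is dense. -/
def DenseColoring (c : α → κ) : Prop :=
  ∀ k a b, a < b → ∃ x, a < x ∧ x < b ∧ c x = k

theorem DenseColoring.exists_between_finsets [NoMinOrder α] [NoMaxOrder α] [DenselyOrdered α]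
    [Nonempty α] {c : α → κ} (hc : DenseColoring c) (k : κ) (lo hi : Finset α)
    (h : ∀ x ∈ lo, ∀ y ∈ hi, x < y) :
    ∃ b, (∀ x ∈ lo, x < b) ∧ (∀ y ∈ hi, b < y) ∧ c b = k := by
  classical
  obtain ⟨b₀, hl, hh⟩ := Order.exists_between_finsets lo hi h
  -- A colour is only known to meet open intervals between two points, so a second point of the gap
  -- is taken above `b₀`.
  obtain ⟨b₁, hl', hh'⟩ := Order.exists_between_finsets (insert b₀ lo) hi (by
    intro x hx y hy
    rcases Finset.mem_insert.1 hx with rfl | hx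
    · exact hh y hy
    · exact h x hx y hy)
  obtain ⟨b, hb₀, hb₁, hb⟩ := hc k b₀ b₁ (hl' _ (Finset.mem_insert_self _ _))
  exact ⟨b, fun x hx => (hl x hx).trans hb₀, fun y hy => hb₁.trans (hh' y hy), hb⟩

/-- Finite partial isomorphisms that respect the colourings `c` and `d`. -/
def ColoredPartialIso (c : α → κ) (d : β → κ) : Type _ :=
  {f : Order.PartialIso α β // ∀ p ∈ f.1, c p.1 = d p.2}

namespace ColoredPartialIso

instance (c : α → κ) (d : β → κ) : Preorder (ColoredPartialIso c d) :=
  inferInstanceAs (Preorder {f : Order.PartialIso α β // ∀ p ∈ f.1, c p.1 = d p.2})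

variable {c : α → κ} {d : β → κ}

/-- The "forth" step: a new point goes into the gap between the images of the points below and above
it, and density of its colour makes the choice respect the colouring. The "back" step is the same
for the swapped isomorphism. -/
theorem exists_across [NoMinOrder β] [NoMaxOrder β] [DenselyOrdered β] [Nonempty β]
    (hd : DenseColoring d) (f : ColoredPartialIso c d) (a : α) :
    ∃ b : β, d b = c a ∧ ∀ p ∈ f.1.1, cmp p.1 a = cmp p.2 b := by
  classical
  by_cases h : ∃ b, (a, b) ∈ f.1.1
  · obtain ⟨b, hb⟩ := h
    exact ⟨b, (f.2 _ hb).symm, fun p hp => f.1.2 _ hp _ hb⟩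
  obtain ⟨b, hl, hh, hb⟩ := hd.exists_between_finsets (c a)
    ({p ∈ f.1.1 | p.1 < a}.image Prod.snd) ({p ∈ f.1.1 | a < p.1}.image Prod.snd) (by
      intro x hx y hy
      obtain ⟨p, hp, rfl⟩ := Finset.mem_image.1 hx
      obtain ⟨q, hq, rfl⟩ := Finset.mem_image.1 hy
      rw [Finset.mem_filter] at hp hq
      exact (lt_iff_lt_of_cmp_eq_cmp (f.1.2 _ hp.1 _ hq.1)).1 (hp.2.trans hq.2))
  refine ⟨b, hb, fun p hp => ?_⟩
  rcases lt_trichotomy p.1 a with hpa | hpa | hpa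
  · have h' : p.2 < b := hl _ (Finset.mem_image_of_mem _ (Finset.mem_filter.2 ⟨hp, hpa⟩))
    rw [(cmp_eq_lt_iff _ _).2 hpa, (cmp_eq_lt_iff _ _).2 h']
  · exact absurd ⟨p.2, hpa ▸ hp⟩ h
  · have h' : b < p.2 := hh _ (Finset.mem_image_of_mem _ (Finset.mem_filter.2 ⟨hp, hpa⟩))
    rw [(cmp_eq_gt_iff _ _).2 hpa, (cmp_eq_gt_iff _ _).2 h']

/-- The inverse partial isomorphism. -/
def swap (f : ColoredPartialIso c d) : ColoredPartialIso d c :=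
  ⟨f.1.comm, fun p hp => by
    have hp' : p ∈ f.1.1.map (Equiv.prodComm α β).toEmbedding := by
      rw [Finset.map_eq_image]
      exact hp
    obtain ⟨q, hq, rfl⟩ := Finset.mem_map.1 hp'
    exact (f.2 q hq).symm⟩

theorem mem_swap {f : ColoredPartialIso c d} {p : β × α} : p ∈ f.swap.1.1 ↔ p.swap ∈ f.1.1 := by
  change p ∈ Finset.image (Equiv.prodComm α β) f.1.1 ↔ _
  rw [Finset.mem_image]
  constructor
  · rintro ⟨q, hq, rfl⟩
    exact hq
  · exact fun h => ⟨_, h, rfl⟩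

theorem exists_extend {f : ColoredPartialIso c d} {a : α} {b : β} (hab : c a = d b)
    (h : ∀ p ∈ f.1.1, cmp p.1 a = cmp p.2 b) :
    ∃ g : ColoredPartialIso c d, (a, b) ∈ g.1.1 ∧ f ≤ g := by
  classical
  refine ⟨⟨⟨insert (a, b) f.1.1, fun p hp q hq => ?_⟩, fun p hp => ?_⟩,
    Finset.mem_insert_self _ _, Finset.subset_insert _ _⟩
  · rcases Finset.mem_insert.1 hp with rfl | hp <;> rcases Finset.mem_insert.1 hq with rfl | hq
    · simp only [cmp_self_eq_eq]
    · rw [cmp_eq_cmp_symm]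
      exact h _ hq
    · exact h _ hp
    · exact f.1.2 _ hp _ hq
  · rcases Finset.mem_insert.1 hp with rfl | hp
    · exact hab
    · exact f.2 _ hp

end ColoredPartialIso

open ColoredPartialIso in
/-- Skolem's theorem: countable dense orders without endpoints are isomorphic as coloured orders,
if all colours are dense. -/
theorem exists_orderIso_of_denseColoring [Countable α] [DenselyOrdered α] [NoMinOrder α]
    [NoMaxOrder α] [Nonempty α] [Countable β] [DenselyOrdered β] [NoMinOrder β] [NoMaxOrder β]
    [Nonempty β] {c : α → κ} {d : β → κ} (hc : DenseColoring c) (hd : DenseColoring d) :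
    ∃ e : α ≃o β, ∀ a, d (e a) = c a := by
  cases nonempty_encodable α
  cases nonempty_encodable β
  -- One cofinal set for each point that has to enter the domain or the range. There are countably
  -- many, so one ideal meets them all, and its members glue together because it is directed.
  let C : α ⊕ β → Order.Cofinal (ColoredPartialIso c d) := fun p => p.elim
    (fun a => ⟨{f | ∃ b, (a, b) ∈ f.1.1}, fun f => by
      obtain ⟨b, hb, h⟩ := exists_across hd f a
      obtain ⟨g, hg, hfg⟩ := exists_extend hb.symm h
      exact ⟨g, ⟨b, hg⟩, hfg⟩⟩)
    (fun b => ⟨{f | ∃ a, (a, b) ∈ f.1.1}, fun f => by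
      obtain ⟨a, ha, h⟩ := exists_across hc f.swap b
      obtain ⟨g, hg, hfg⟩ := exists_extend (f := f) ha
        (fun p hp => (h p.swap (mem_swap.2 hp)).symm)
      exact ⟨g, ⟨a, hg⟩, hfg⟩⟩)
  let f₀ : ColoredPartialIso c d := ⟨default, fun p hp => absurd hp (Finset.notMem_empty p)⟩
  let I := Order.idealOfCofinals f₀ C
  have hF : ∀ a, ∃ b, ∃ f ∈ I, (a, b) ∈ f.1.1 := fun a => by
    obtain ⟨f, ⟨b, hb⟩, hf⟩ := Order.cofinal_meets_idealOfCofinals f₀ C (Sum.inl a)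
    exact ⟨b, f, hf, hb⟩
  have hG : ∀ b, ∃ a, ∃ f ∈ I, (a, b) ∈ f.1.1 := fun b => by
    obtain ⟨f, ⟨a, ha⟩, hf⟩ := Order.cofinal_meets_idealOfCofinals f₀ C (Sum.inr b)
    exact ⟨a, f, hf, ha⟩
  choose F f hfI hf using hF
  choose G g hgI hg using hG
  refine ⟨OrderIso.ofCmpEqCmp F G fun a b => ?_, fun a => ((f a).2 _ (hf a)).symm⟩
  obtain ⟨m, -, fm, gm⟩ := I.directed _ (hfI a) _ (hgI b)
  exact m.1.2 (a, _) (fm (hf a)) (_, b) (gm (hg b))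

end Skolem

/-! ### Blow-ups -/

/-- Every point `d` of `D` is replaced by `f d` points. -/
abbrev blowup (D : Type u) [LinearOrder D] (f : D → ℕ) : LinOrd.{u} :=
  lexSum D fun d => finOrd (f d)

instance : IsEmpty (finOrd.{u} 0) := inferInstanceAs (IsEmpty (ULift (Fin 0)))
instance : Unique (finOrd.{u} 1) := inferInstanceAs (Unique (ULift (Fin 1)))

theorem OrdIso.finOrd_one_concat_one : OrdIso (_root_.concat (finOrd.{u} 1) (finOrd 1)) (finOrd 2) := by
  refine ⟨StrictMono.orderIsoOfSurjective _ (strictMono_sumLex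
    (fun _ : finOrd.{u} 1 => (⟨0⟩ : ULift (Fin 2))) (fun _ : finOrd.{u} 1 => (⟨1⟩ : ULift (Fin 2)))
    (fun a b h => absurd h (by simp [Subsingleton.elim a b]))
    (fun a b h => absurd h (by simp [Subsingleton.elim a b])) (fun _ _ => ?_)) ?_⟩
  · exact (by decide : (0 : Fin 2) < 1)
  · rintro ⟨i⟩
    match i with
    | 0 => exact ⟨toLex (Sum.inl default), rfl⟩
    | 1 => exact ⟨toLex (Sum.inr default), rfl⟩

theorem OrdIso.blowup_restrict {D : Type u} [LinearOrder D] (f : D → ℕ) {p : D → Prop}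
    (hp : ∀ d, ¬ p d → f d = 0) : OrdIso (blowup {d : D // p d} (fun d => f d)) (blowup D f) := by
  refine ⟨StrictMono.orderIsoOfSurjective _ (strictMono_sigmaLex
    (fun (d : {d : D // p d}) (a : finOrd (f d)) =>
      (toLex ⟨d.1, a⟩ : Σₗ d : D, finOrd.{u} (f d))) (fun d a b h => sigmaLex_mk_lt_iff.2 h)
    (fun d d' h a b => sigmaLex_mk_lt (Subtype.coe_lt_coe.2 h) _ _)) ?_⟩
  rintro ⟨d, a⟩
  refine ⟨toLex ⟨⟨d, of_not_not fun h => ?_⟩, a⟩, rfl⟩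
  have a' : Fin (f d) := a.down
  rw [hp d h] at a'
  exact a'.elim0

theorem OrdIso.blowup_two {D : Type u} [LinearOrder D] [Countable D] [DenselyOrdered D]
    [NoMinOrder D] [NoMaxOrder D] [Nonempty D] {f : D → ℕ} (hf : ∀ d, f d = 2) :
    OrdIso (blowup D f) rat2 := by
  obtain rfl : f = fun _ => 2 := funext hf
  obtain ⟨e⟩ := Order.iso_of_countable_dense D ℚ
  exact (nonempty_sigmaLexCongr e (fun _ => ⟨ULift.orderIso⟩)).map
    fun e' => e'.trans ULift.orderIso.symm

/-- The parity of the denominator is a dense colouring of the rationals. -/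
theorem exists_odd_den_between {a b : ℚ} (h : a < b) : ∃ x, a < x ∧ x < b ∧ ¬ Even x.den := by
  obtain ⟨k, hk⟩ := exists_nat_gt (1 / (b - a))
  have hba : 0 < b - a := sub_pos.2 h
  -- An odd `n` with `1 / n < b - a`: the first multiple of `1 / n` above `a` is still below `b`,
  -- and its reduced denominator divides `n`.
  set n : ℕ := 2 * k + 1 with hn
  have hn0 : (0 : ℚ) < n := by positivity
  have hkn : (k : ℚ) ≤ n := by exact_mod_cast (by omega : k ≤ n)
  have hnb : 1 < n * (b - a) := by
    have := (div_lt_iff₀ hba).1 (hk.trans_le hkn)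
    exact this
  refine ⟨((⌊a * n⌋ + 1 : ℤ) : ℚ) / ((n : ℤ) : ℚ), ?_, ?_, ?_⟩
  · rw [lt_div_iff₀ (by exact_mod_cast hn0)]
    push_cast
    exact Int.lt_floor_add_one _
  · rw [div_lt_iff₀ (by exact_mod_cast hn0)]
    push_cast
    have := Int.floor_le (a * n)
    nlinarith
  · intro he
    have h1 := Rat.den_dvd (⌊a * n⌋ + 1) (n : ℤ)
    rw [Rat.divInt_eq_div] at h1
    have h2 : (2 : ℤ) ∣ (n : ℤ) := dvd_trans (by exact_mod_cast he.two_dvd) h1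
    omega

/-- Add a small positive power of 1/2 to a point of odd denominator. If the result also had odd
denominator, so would the difference, a positive power of 1/2. -/
theorem exists_even_den_between {a b : ℚ} (h : a < b) : ∃ x, a < x ∧ x < b ∧ Even x.den := by
  obtain ⟨q, hqa, hqb, hq⟩ := exists_odd_den_between h
  obtain ⟨n, hn⟩ := exists_pow_lt_of_lt_one (sub_pos.2 hqb) (by norm_num : (1 / 2 : ℚ) < 1)
  refine ⟨q + (1 / 2) ^ (n + 1), ?_, ?_, ?_⟩
  · have : (0 : ℚ) < (1 / 2) ^ (n + 1) := by positivity
    linarith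
  · have : (1 / 2 : ℚ) ^ (n + 1) ≤ (1 / 2) ^ n :=
      pow_le_pow_of_le_one (by norm_num) (by norm_num) (Nat.le_succ n)
    linarith
  · by_contra hx
    have h1 := Rat.sub_den_dvd (q + (1 / 2) ^ (n + 1)) q
    rw [add_sub_cancel_left, Rat.den_pow] at h1
    have h2 : ((1 / 2 : ℚ)).den = 2 := by norm_num
    rw [h2, pow_succ] at h1
    have h3 : 2 ∣ (q + (1 / 2) ^ (n + 1)).den * q.den := dvd_trans (dvd_mul_left _ _) h1
    rcases (Nat.Prime.dvd_mul Nat.prime_two).1 h3 with h | h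
    · exact hx (even_iff_two_dvd.2 h)
    · exact hq (even_iff_two_dvd.2 h)

theorem denseColoring_even_den : DenseColoring (fun q : ℚ => Even q.den) := by
  intro k a b h
  by_cases hk : k
  · obtain ⟨x, h1, h2, h3⟩ := exists_even_den_between h
    exact ⟨x, h1, h2, by simp [hk, h3]⟩
  · obtain ⟨x, h1, h2, h3⟩ := exists_odd_den_between h
    exact ⟨x, h1, h2, by simp only [hk, h3]⟩

/-- By Skolem's theorem it does not matter which dense, co-dense set of points is doubled. -/
theorem OrdIso.blowup_one_two {D : Type u} [LinearOrder D] [Countable D] [DenselyOrdered D]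
    [NoMinOrder D] [NoMaxOrder D] [Nonempty D] {f : D → ℕ} {p : D → Prop} (hp : DenseColoring p)
    (h₂ : ∀ d, p d → f d = 2) (h₁ : ∀ d, ¬ p d → f d = 1) :
    OrdIso (blowup D f) rat12 := by
  obtain ⟨e, he⟩ := exists_orderIso_of_denseColoring hp denseColoring_even_den
  refine (nonempty_sigmaLexCongr (A := fun d => finOrd.{u} (f d))
    (B := fun q : ℚ => Fin (if Even q.den then 2 else 1)) e (fun d => ?_)).map
    fun e' => e'.trans ULift.orderIso.symm
  have : f d = if Even (e d).den then 2 else 1 := by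
    split_ifs with h
    · exact h₂ d ((he d).mp h)
    · exact h₁ d fun h' => h ((he d).mpr h')
  rw [← this]
  exact ⟨ULift.orderIso⟩

/-! ### Restricting a dense colouring to some of its colours -/

section Coloring

variable {α κ : Type*} [LinearOrder α] {c : α → κ}

theorem DenseColoring.exists_between (hc : DenseColoring c) (s : Set κ) (hs : s.Nonempty)
    {a b : α} (h : a < b) : ∃ x : {x // c x ∈ s}, a < x.1 ∧ x.1 < b := by
  obtain ⟨k, hk⟩ := hs
  obtain ⟨x, h1, h2, h3⟩ := hc k a b h
  exact ⟨⟨x, by rwa [h3]⟩, h1, h2⟩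

theorem DenseColoring.denselyOrdered (hc : DenseColoring c) (s : Set κ) (hs : s.Nonempty) :
    DenselyOrdered {x // c x ∈ s} := by
  refine ⟨fun a b h => ?_⟩
  obtain ⟨x, h1, h2⟩ := hc.exists_between s hs (Subtype.coe_lt_coe.2 h)
  exact ⟨x, h1, h2⟩

theorem DenseColoring.noMinOrder [NoMinOrder α] (hc : DenseColoring c) (s : Set κ)
    (hs : s.Nonempty) : NoMinOrder {x // c x ∈ s} := by
  refine ⟨fun a => ?_⟩
  obtain ⟨b, hb⟩ := exists_lt a.1
  obtain ⟨x, -, h⟩ := hc.exists_between s hs hb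
  exact ⟨x, h⟩

theorem DenseColoring.noMaxOrder [NoMaxOrder α] (hc : DenseColoring c) (s : Set κ)
    (hs : s.Nonempty) : NoMaxOrder {x // c x ∈ s} := by
  refine ⟨fun a => ?_⟩
  obtain ⟨b, hb⟩ := exists_gt a.1
  obtain ⟨x, h, -⟩ := hc.exists_between s hs hb
  exact ⟨x, h⟩

theorem DenseColoring.nonempty [NoMaxOrder α] [Nonempty α] (hc : DenseColoring c) (s : Set κ)
    (hs : s.Nonempty) : Nonempty {x // c x ∈ s} := by
  obtain ⟨b, hb⟩ := exists_gt (Classical.arbitrary α)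
  obtain ⟨x, -⟩ := hc.exists_between s hs hb
  exact ⟨x⟩

/-- There is a colouring of the rationals with three dense colours. -/
theorem exists_denseColoring_three : ∃ c : ℚ → Fin 3, DenseColoring c := by
  classical
  let p : ℚ → Prop := fun q => Even q.den
  have hp : DenseColoring p := denseColoring_even_den
  let D := {q : ℚ // p q ∈ ({True} : Set Prop)}
  have hs : ({True} : Set Prop).Nonempty := ⟨True, rfl⟩
  have := hp.denselyOrdered _ hs
  have := hp.noMinOrder _ hs
  have := hp.noMaxOrder _ hs
  have := hp.nonempty _ hs
  -- The points of even denominator form another copy of ℚ, so parity of the denominator,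
  -- transported along `e`, splits them into two dense colours.
  obtain ⟨e⟩ := Order.iso_of_countable_dense D ℚ
  refine ⟨fun q => if h : p q ∈ ({True} : Set Prop) then
    (if p (e ⟨q, h⟩) then 2 else 1) else 0, ?_⟩
  intro k a b hab
  by_cases hk : k = 0
  · obtain ⟨x, h1, h2, h3⟩ := exists_odd_den_between hab
    refine ⟨x, h1, h2, ?_⟩
    exact (dif_neg fun h => h3 (of_eq_true h)).trans hk.symm
  -- Two points of `D` inside the interval are needed: a colour is dense in the copy of ℚ between `e
  -- x` and `e y`.
  · obtain ⟨x, h1, h2⟩ := hp.exists_between _ hs hab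
    obtain ⟨y, h3, h4⟩ := hp.exists_between _ hs h2
    obtain ⟨z, h5, h6, h7⟩ := hp (k = 2) (e x) (e y) (e.strictMono h3)
    have h8 : x < e.symm z := by rwa [← e.lt_iff_lt, e.apply_symm_apply]
    have h9 : e.symm z < y := by rwa [← e.lt_iff_lt, e.apply_symm_apply]
    refine ⟨(e.symm z).1, h1.trans h8, lt_trans (Subtype.coe_lt_coe.2 h9) h4, ?_⟩
    refine (dif_pos (e.symm z).2).trans ?_
    rw [Subtype.coe_eta, e.apply_symm_apply]
    split_ifs with h <;> rw [h7] at h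
    · exact h.symm
    · omega

end Coloring

/-- Points of multiplicity 0 disappear, so only the colours `i` and `j` remain; they are dense in
each other, and the doubling pattern is that of ℚ(1,2). -/
theorem OrdIso.blowup_rat12 {D : Type u} [LinearOrder D] [Countable D] [NoMinOrder D]
    [NoMaxOrder D] [Nonempty D] {κ : Type*} {c : D → κ} (hc : DenseColoring c) {f : D → ℕ}
    (i j : κ) (hij : j ≠ i) (hi : ∀ d, c d = i → f d = 2) (hj : ∀ d, c d = j → f d = 1)
    (hk : ∀ d, c d ≠ i → c d ≠ j → f d = 0) : OrdIso (blowup D f) rat12 := by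
  have hs : ({i, j} : Set κ).Nonempty := ⟨i, Set.mem_insert _ _⟩
  have hs' : ∀ d, ¬ c d ∈ ({i, j} : Set κ) → f d = 0 := fun d h =>
    hk d (fun h' => h (Or.inl h')) (fun h' => h (Or.inr h'))
  refine (OrdIso.blowup_restrict f hs').symm.trans ?_
  have := hc.denselyOrdered _ hs
  have := hc.noMinOrder _ hs
  have := hc.noMaxOrder _ hs
  have := hc.nonempty _ hs
  refine OrdIso.blowup_one_two (p := fun d => c d = i) ?_ (fun d => hi d) fun d h =>
    hj d (d.2.resolve_left h)
  intro k a b hab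
  by_cases hk' : k
  · obtain ⟨x, h1, h2, h3⟩ := hc i _ _ (Subtype.coe_lt_coe.2 hab)
    exact ⟨⟨x, Or.inl h3⟩, h1, h2, by simp [hk', h3]⟩
  · obtain ⟨x, h1, h2, h3⟩ := hc j _ _ (Subtype.coe_lt_coe.2 hab)
    exact ⟨⟨x, Or.inr h3⟩, h1, h2, by simp [hk', h3, hij]⟩

/-! ### Splitting ℚ and ℚ(2) -/

namespace Splits

/-- The order `ℚ` absorbs all countable orders. -/
theorem rat_absorb (R : LinOrd.{u}) [Countable R] : Splits rat rat R := by
  rcases isEmpty_or_nonempty R with hR | hR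
  · exact left rat R
  -- Write ℚ as a sum over `R` of copies of ℚ + 1 + ℚ. The middle points form `R`, and what is left
  -- is a sum over `R` of copies of ℚ + ℚ, again ℚ.
  have h : ∀ _ : R, Splits (_root_.concat rat.{u} (_root_.concat (finOrd 1) rat))
      (_root_.concat rat (_root_.concat (finOrd 0) rat))
      (_root_.concat (finOrd 0) (_root_.concat (finOrd 1) (finOrd 0))) := fun _ =>
    (left _ _).concat ((right _ _).concat (left _ _))
  refine (lexSum h).congr (OrdIso.lexSum_rat fun _ => OrdIso.rat_concat_one_concat_rat _)
    (OrdIso.lexSum_rat fun _ => ((OrdIso.refl _).concat (OrdIso.empty_concat _ _)).trans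
      OrdIso.rat_concat_rat) (OrdIso.lexSum_const_unique fun _ => ?_)
  obtain ⟨e⟩ := (OrdIso.empty_concat (finOrd.{u} 0) (_root_.concat (finOrd 1) (finOrd 0))).trans
    (OrdIso.concat_empty (finOrd 1) (finOrd 0))
  exact ⟨e.toEquiv.unique⟩

theorem two_one_one : Splits (finOrd.{u} 2) (finOrd 1) (finOrd 1) :=
  (concat_self _ _).congr OrdIso.finOrd_one_concat_one (OrdIso.refl _) (OrdIso.refl _)

theorem rat2_rat_rat : Splits rat2.{u} rat rat := by
  refine (lexSum (fun _ : rat.{u} => two_one_one)).congr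
    (OrdIso.blowup_two (D := rat.{u}) fun _ => rfl) ?_ ?_ <;>
  exact OrdIso.lexSum_const_unique fun _ => ⟨inferInstance⟩

/-- This is 1 + 1 = 0. Colour the pairs of ℚ(2) by three dense colours: pairs of the first go to the
left part, pairs of the second to the right part, and pairs of the third are divided. Each part then
has dense sets of pairs and of single points. -/
theorem rat2_rat12_rat12 : Splits rat2.{u} rat12 rat12 := by
  obtain ⟨c, hc⟩ := exists_denseColoring_three
  let c' : rat.{u} → Fin 3 := fun q => c q.down
  have hc' : DenseColoring c' := by
    intro k a b hab
    obtain ⟨x, h1, h2, h3⟩ := hc k a.down b.down hab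
    exact ⟨⟨x⟩, h1, h2, h3⟩
  let f : Fin 3 → ℕ := ![2, 0, 1]
  let g : Fin 3 → ℕ := ![0, 2, 1]
  have h : ∀ k : Fin 3, Splits (finOrd.{u} 2) (finOrd (f k)) (finOrd (g k)) := by
    intro k
    fin_cases k
    · exact left _ (finOrd 0)
    · exact right (finOrd 0) _
    · exact two_one_one
  refine (lexSum (fun q : rat.{u} => h (c' q))).congr
    (OrdIso.blowup_two (D := rat.{u}) fun _ => rfl)
    (OrdIso.blowup_rat12 hc' 0 2 (by decide) ?_ ?_ ?_)
    (OrdIso.blowup_rat12 hc' 1 2 (by decide) ?_ ?_ ?_) <;>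
  · intro d
    generalize c' d = k
    revert k
    decide

/-- If `R` is countable, then `P + ℚ` can be split into `P + ℚ` and `R + ℚ`. -/
theorem concat_rat (P R : LinOrd.{u}) [Countable R] :
    Splits (_root_.concat P rat) (_root_.concat P rat) (_root_.concat R rat) := by
  -- With ℚ written as ℚ + ℚ, the first copy gives up `R` and the second gives up the final ℚ, while
  -- `P` stays whole.
  have h := (left P (finOrd 0)).concat ((rat_absorb R).concat (rat_absorb rat))
  exact h.congr ((OrdIso.refl _).concat OrdIso.rat_concat_rat)
    ((OrdIso.refl _).concat OrdIso.rat_concat_rat) (OrdIso.empty_concat _ _)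

end Splits

/-! ### The class `𝒬` -/

theorem nonempty_subtypeIso {α β : Type*} [LinearOrder α] [LinearOrder β] (e : α ≃o β)
    {s : Set α} {t : Set β} (h : ∀ a, a ∈ s ↔ e a ∈ t) : Nonempty (s ≃o t) := by
  refine ⟨StrictMono.orderIsoOfSurjective (fun a : s => (⟨e a.1, (h a).1 a.2⟩ : t))
    (fun a b hab => e.strictMono hab) ?_⟩
  rintro ⟨b, hb⟩
  exact ⟨⟨e.symm b, (h _).2 (by simpa using hb)⟩, by simp⟩

theorem OrdIso.subtype {A B : LinOrd.{u}} (e : A ≃o B) {p : A → Prop} {q : B → Prop}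
    (h : ∀ a, p a ↔ q (e a)) : OrdIso (LinOrd.of {a // p a}) (LinOrd.of {b // q b}) :=
  nonempty_subtypeIso e h

theorem isLeftSGC_classQ : IsLeftSGC classQ.{u} where
  iso_mem A B h hA C hC hG := hC.iso_mem A B h (hA C hC hG)
  right_mem A B hA C hC hG := hC.right_mem A B (hA C hC hG)
  lexSum_mem ι _ _ A hA C hC hG := hC.lexSum_mem ι A fun i => hA i C hC hG

theorem OrdIso.classQ {A B : LinOrd.{u}} (h : OrdIso A B) (hA : classQ A) : classQ B :=
  isLeftSGC_classQ.iso_mem A B h hA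

theorem classQ_rat : classQ rat.{u} := fun _ _ hG => hG _ (Or.inl rfl)

theorem classQ_rat12_concat_rat : classQ (concat rat12.{u} rat) :=
  fun _ _ hG => hG _ (Or.inr (Or.inl rfl))

theorem classQ_rat2_concat_rat : classQ (concat rat2.{u} rat) :=
  fun _ _ hG => hG _ (Or.inr (Or.inr rfl))

theorem classQ_lexSum {ι : Type u} [LinearOrder ι] [WellFoundedLT ι] {A : ι → LinOrd.{u}}
    (h : ∀ i, classQ (A i)) : classQ (lexSum ι A) :=
  isLeftSGC_classQ.lexSum_mem ι A h

theorem classQ_of_isEmpty (L : LinOrd.{u}) [IsEmpty L] : classQ L := by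
  have h : classQ (lexSum PEmpty.{u + 1} fun _ => L) := classQ_lexSum fun i => i.elim
  refine OrdIso.classQ ⟨StrictMono.orderIsoOfSurjective
    (fun x : Σₗ _ : PEmpty.{u + 1}, L => (ofLex x).2) ?_ ?_⟩ h
  · exact fun x => (ofLex x).1.elim
  · exact fun x => isEmptyElim x

/-- The main way to recognise members of 𝒬. The values of `f` may live in any universe, so one
representative is chosen in each fibre: the representatives form a well-order inside `L`, and `L` is
the sum of the fibres over it. -/
theorem classQ_of_fiber {L : LinOrd.{u}} {X : Type*} [LinearOrder X] (f : L → X)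
    (hf : Monotone f) (hw : (Set.range f).IsWF)
    (h : ∀ x, classQ (LinOrd.of {l // f l = x})) : classQ L := by
  let g : Set.range f → L := fun y => y.2.choose
  have hg : ∀ y, f (g y) = y.1 := fun y => y.2.choose_spec
  let r : L → L := fun l => g ⟨f l, l, rfl⟩
  have hfr : ∀ l, f (r l) = f l := fun l => hg _
  have hr : ∀ l l', f l = f l' → r l = r l' := fun l l' h => by simp only [r, h]
  let ι := {l : L // r l = l}
  have hι : StrictMono (fun i : ι => f i.1) := by
    intro i j hij
    refine lt_of_le_of_ne (hf hij.le) fun h => hij.ne ?_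
    rw [Subtype.ext_iff, ← i.2, ← j.2]
    exact hr _ _ h
  have : WellFoundedLT ι := by
    have h1 : WellFounded (Function.onFun (· < ·) f) := Set.wellFoundedOn_range.1 hw
    refine ⟨Subrelation.wf (r := InvImage (Function.onFun (· < ·) f) Subtype.val) ?_
      (InvImage.wf _ h1)⟩
    intro i j hij
    exact hι hij
  let p : L → ι := fun l => ⟨r l, hr _ _ (hfr l)⟩
  have hp : ∀ l i, p l = i ↔ f l = f i.1 := by
    intro l i
    constructor
    · rintro rfl
      exact (hfr l).symm
    · intro h
      exact Subtype.ext ((hr _ _ h).trans i.2)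
  have hpm : Monotone p := by
    intro l l' hl
    by_contra hlt
    have h1 : f (p l').1 < f (p l).1 := hι (not_le.1 hlt)
    rw [show f (p l').1 = f l' from hfr l', show f (p l).1 = f l from hfr l] at h1
    exact h1.not_ge (hf hl)
  obtain ⟨e⟩ := nonempty_fiberIso p hpm
  refine OrdIso.classQ (A := lexSum ι fun i => LinOrd.of {l // p l = i}) ⟨e⟩
    (classQ_lexSum fun i => ?_)
  exact (OrdIso.subtype (OrderIso.refl L) fun l => (hp l i).symm).classQ (h (f i.1))

theorem classQ_of_lower {L : LinOrd.{u}} (s : Set L) (hs : IsLowerSet s)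
    (h₁ : classQ (LinOrd.of s)) (h₂ : classQ (LinOrd.of ↥sᶜ)) : classQ L := by
  classical
  refine classQ_of_fiber (fun l => decide (l ∉ s)) ?_ (Set.IsWF.of_wellFoundedLT _) ?_
  · intro a b hab
    by_cases hb : b ∈ s
    · simp [hb, hs hab hb]
    · simp [hb, Bool.le_true]
  · intro x
    cases x
    · exact (OrdIso.subtype (p := fun l => l ∈ s) (q := fun l => decide (l ∉ s) = false)
        (OrderIso.refl L) fun l => not_not.symm.trans decide_eq_false_iff_not.symm).classQ h₁
    · exact (OrdIso.subtype (p := fun l => l ∈ sᶜ) (q := fun l => decide (l ∉ s) = true)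
        (OrderIso.refl L) fun l => decide_eq_true_iff.symm).classQ h₂

theorem classQ_upper {L : LinOrd.{u}} (h : classQ L) (s : Set L) (hs : IsUpperSet s) :
    classQ (LinOrd.of s) := by
  obtain ⟨e⟩ := nonempty_splitIso sᶜ hs.compl
  have h1 : classQ (concat (LinOrd.of ↥sᶜ) (LinOrd.of ↥sᶜᶜ)) := OrdIso.classQ ⟨e.symm⟩ h
  exact (OrdIso.subtype (p := fun l => l ∈ sᶜᶜ) (q := fun l => l ∈ s) (OrderIso.refl L)
    fun l => by simp).classQ (isLeftSGC_classQ.right_mem _ _ h1)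

theorem classQ_concat {A B : LinOrd.{u}} (hA : classQ A) (hB : classQ B) :
    classQ (concat A B) := by
  have hs : IsLowerSet (Set.range (LinSum.std.inl A B)) := by
    rintro x y hxy ⟨a, rfl⟩
    obtain ⟨y, rfl⟩ := toLex.surjective y
    rcases y with b | b
    · exact ⟨b, rfl⟩
    · exact absurd hxy Sum.Lex.not_inr_le_inl
  refine classQ_of_lower (L := concat A B) _ hs ?_ ?_
  · exact OrdIso.classQ ⟨(LinSum.std.inl A B).orderIso⟩ hA
  · refine OrdIso.classQ ?_ hB
    have h := (LinSum.std.isCompl_range A B).compl_eq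
    exact ⟨(LinSum.std.inr A B).orderIso.trans (OrderIso.setCongr _ _ h.symm)⟩

/-! ### Dense intervals and presentations -/

/-- Above every point there is an interval `[u, v]` that is densely ordered, such that the points
below `v` form an order in `𝒬`. -/
def HasCuts (L : LinOrd.{u}) : Prop :=
  ∀ x : L, ∃ u v : L, x ≤ u ∧ u < v ∧ (∀ a b, u ≤ a → a < b → b ≤ v → ∃ c, a < c ∧ c < b) ∧
    classQ (LinOrd.of (Set.Iio v))

theorem OrdIso.hasCuts {A B : LinOrd.{u}} (h : OrdIso A B) (hA : HasCuts A) : HasCuts B := by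
  obtain ⟨e⟩ := h
  intro x
  obtain ⟨u, v, h1, h2, h3, h4⟩ := hA (e.symm x)
  refine ⟨e u, e v, (OrderIso.symm_apply_le e).1 h1, e.strictMono h2, ?_, ?_⟩
  · intro a b ha hab hb
    obtain ⟨c, h5, h6⟩ := h3 (e.symm a) (e.symm b) ((OrderIso.le_symm_apply e).2 ha)
      (e.symm.strictMono hab) ((OrderIso.symm_apply_le e).2 hb)
    exact ⟨e c, (OrderIso.symm_apply_lt e).1 h5, (OrderIso.lt_symm_apply e).1 h6⟩
  · exact (OrdIso.subtype (p := fun a => a < v) (q := fun b => b < e v) e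
      fun a => e.lt_iff_lt.symm).classQ h4

theorem HasCuts.right {A B : LinOrd.{u}} (h : HasCuts (concat A B)) : HasCuts B := by
  intro x
  obtain ⟨u, v, h1, h2, h3, h4⟩ := h (toLex (Sum.inr x))
  have key : ∀ (y : B) (z : concat A B), (toLex (Sum.inr y) : A ⊕ₗ B) ≤ z →
      ∃ w : B, z = toLex (Sum.inr w) := by
    intro y z hz
    obtain ⟨z, rfl⟩ := toLex.surjective z
    rcases z with z | z
    · exact absurd hz Sum.Lex.not_inr_le_inl
    · exact ⟨z, rfl⟩
  obtain ⟨u, rfl⟩ := key _ _ h1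
  obtain ⟨v, rfl⟩ := key _ _ (h1.trans h2.le)
  refine ⟨u, v, Sum.Lex.inr_le_inr_iff.1 h1, Sum.Lex.inr_lt_inr_iff.1 h2, ?_, ?_⟩
  · intro a b ha hab hb
    obtain ⟨c, hc, hc'⟩ := h3 (toLex (Sum.inr a)) (toLex (Sum.inr b))
      (Sum.Lex.inr_le_inr_iff.2 ha) (Sum.Lex.inr_lt_inr_iff.2 hab) (Sum.Lex.inr_le_inr_iff.2 hb)
    obtain ⟨c, rfl⟩ := key _ _ hc.le
    exact ⟨c, Sum.Lex.inr_lt_inr_iff.1 hc, Sum.Lex.inr_lt_inr_iff.1 hc'⟩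
  · let s : Set (LinOrd.of (Set.Iio (toLex (Sum.inr v) : A ⊕ₗ B))) :=
      {y | ∃ b : B, toLex (Sum.inr b) ≤ y.1}
    have hs : IsUpperSet s := fun y z hyz ⟨b, hb⟩ => ⟨b, hb.trans hyz⟩
    refine OrdIso.classQ (OrdIso.symm ⟨StrictMono.orderIsoOfSurjective
      (fun b : Set.Iio v => (⟨⟨toLex (Sum.inr b.1), Sum.Lex.inr_lt_inr_iff.2 b.2⟩, b.1, le_rfl⟩ : s))
      (fun b b' hb => Sum.Lex.inr_lt_inr_iff.2 (Subtype.coe_lt_coe.2 hb)) ?_⟩) (classQ_upper h4 s hs)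
    rintro ⟨⟨y, hy⟩, b, hb⟩
    obtain ⟨c, rfl⟩ := key _ _ hb
    exact ⟨⟨c, Sum.Lex.inr_lt_inr_iff.1 hy⟩, rfl⟩

/-- A cut of one summand is a cut of the sum. The points below it consist of all earlier summands
and an initial part of the present one, which is why membership of the summands in 𝒬 is needed too.
-/
theorem HasCuts.lexSum {ι : Type u} [LinearOrder ι] [WellFoundedLT ι] {A : ι → LinOrd.{u}}
    (hQ : ∀ i, classQ (A i)) (h : ∀ i, HasCuts (A i)) : HasCuts (lexSum ι A) := by
  rintro ⟨i, x⟩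
  obtain ⟨u, v, h1, h2, h3, h4⟩ := h i x
  refine ⟨toLex ⟨i, u⟩, toLex ⟨i, v⟩, (sigmaLex_mk_le_iff (A := fun i => A i)).2 h1, (sigmaLex_mk_lt_iff (A := fun i => A i)).2 h2, ?_, ?_⟩
  · rintro ⟨j, a⟩ ⟨k, b⟩ ha hab hb
    have hij : i ≤ j := sigmaLex_fst_mono ha
    have hjk : j ≤ k := sigmaLex_fst_mono hab.le
    have hki : k ≤ i := sigmaLex_fst_mono hb
    obtain rfl : i = j := le_antisymm hij (hjk.trans hki)
    obtain rfl : i = k := le_antisymm hjk hki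
    obtain ⟨c, h5, h6⟩ := h3 a b ((sigmaLex_mk_le_iff (A := fun i => A i)).1 ha) ((sigmaLex_mk_lt_iff (A := fun i => A i)).1 hab)
      ((sigmaLex_mk_le_iff (A := fun i => A i)).1 hb)
    exact ⟨toLex ⟨i, c⟩, (sigmaLex_mk_lt_iff (A := fun i => A i)).2 h5, (sigmaLex_mk_lt_iff (A := fun i => A i)).2 h6⟩
  · refine classQ_of_fiber
      (L := LinOrd.of (Set.Iio (toLex ⟨i, v⟩ : Σₗ i, A i))) (fun y => (ofLex y.1).1)
      (fun y z hyz => sigmaLex_fst_mono hyz) (Set.IsWF.of_wellFoundedLT _) fun j => ?_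
    rcases lt_trichotomy j i with hj | rfl | hj
    · refine OrdIso.classQ ⟨StrictMono.orderIsoOfSurjective
        (fun a : A j => (⟨⟨toLex ⟨j, a⟩, sigmaLex_mk_lt hj _ _⟩, rfl⟩ :
          {y : Set.Iio (toLex ⟨i, v⟩ : Σₗ i, A i) // (ofLex y.1).1 = j}))
        (fun a b hab => (sigmaLex_mk_lt_iff (A := fun i => A i)).2 hab) ?_⟩ (hQ j)
      rintro ⟨⟨⟨k, a⟩, hk⟩, h⟩
      obtain rfl : k = j := h
      exact ⟨a, rfl⟩
    · refine OrdIso.classQ ⟨StrictMono.orderIsoOfSurjective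
        (fun a : Set.Iio v => (⟨⟨toLex ⟨j, a.1⟩, (sigmaLex_mk_lt_iff (A := fun i => A i)).2 a.2⟩, rfl⟩ :
          {y : Set.Iio (toLex ⟨j, v⟩ : Σₗ i, A i) // (ofLex y.1).1 = j}))
        (fun a b hab => (sigmaLex_mk_lt_iff (A := fun i => A i)).2 (Subtype.coe_lt_coe.2 hab)) ?_⟩ h4
      rintro ⟨⟨⟨k, a⟩, hk⟩, h⟩
      obtain rfl : k = j := h
      exact ⟨⟨a, (sigmaLex_mk_lt_iff (A := fun i => A i)).1 hk⟩, rfl⟩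
    · have : IsEmpty {y : Set.Iio (toLex ⟨i, v⟩ : Σₗ i, A i) // (ofLex y.1).1 = j} := by
        refine ⟨?_⟩
        rintro ⟨⟨y, hy⟩, rfl⟩
        exact hj.not_ge (sigmaLex_fst_mono (le_of_lt hy))
      exact @classQ_of_isEmpty (LinOrd.of _) this

theorem OrdIso.rat_Iio (v : rat.{u}) : OrdIso (LinOrd.of (Set.Iio v)) rat :=
  OrdIso.rat_of _

theorem hasCuts_concat_rat (P : LinOrd.{u}) (h : classQ (concat P rat)) :
    HasCuts (concat P rat) := by
  intro x
  obtain ⟨q, hq⟩ : ∃ q : rat.{u}, x ≤ (toLex (Sum.inr q) : P ⊕ₗ rat.{u}) := by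
    obtain ⟨x, rfl⟩ := toLex.surjective x
    rcases x with x | x
    · exact ⟨Classical.arbitrary _, Sum.Lex.inl_le_inr _ _⟩
    · exact ⟨x, le_rfl⟩
  obtain ⟨r, hr⟩ := exists_gt q
  refine ⟨toLex (Sum.inr q), toLex (Sum.inr r), hq, Sum.Lex.inr_lt_inr_iff.2 hr, ?_, ?_⟩
  · intro a b ha hab hb
    obtain ⟨a, rfl⟩ := toLex.surjective a
    obtain ⟨b, rfl⟩ := toLex.surjective b
    rcases a with a | a
    · exact absurd ha Sum.Lex.not_inr_le_inl
    rcases b with b | b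
    · exact absurd hab Sum.Lex.not_inr_lt_inl
    obtain ⟨c, h1, h2⟩ := exists_between (Sum.Lex.inr_lt_inr_iff.1 hab)
    exact ⟨toLex (Sum.inr c), Sum.Lex.inr_lt_inr_iff.2 h1, Sum.Lex.inr_lt_inr_iff.2 h2⟩
  · have h1 : OrdIso (concat P (LinOrd.of (Set.Iio r)))
        (LinOrd.of (Set.Iio (toLex (Sum.inr r) : P ⊕ₗ rat.{u}))) := by
      refine ⟨StrictMono.orderIsoOfSurjective _ (strictMono_sumLex
        (fun p : P => (⟨toLex (Sum.inl p), Sum.Lex.inl_lt_inr _ _⟩ :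
          Set.Iio (toLex (Sum.inr r) : P ⊕ₗ rat.{u})))
        (fun q : Set.Iio r => (⟨toLex (Sum.inr q.1), Sum.Lex.inr_lt_inr_iff.2 q.2⟩ :
          Set.Iio (toLex (Sum.inr r) : P ⊕ₗ rat.{u})))
        (fun _ _ h => Sum.Lex.inl_lt_inl_iff.2 h) (fun _ _ h => Sum.Lex.inr_lt_inr_iff.2 h)
        fun _ _ => Sum.Lex.inl_lt_inr _ _) ?_⟩
      rintro ⟨y, hy⟩
      obtain ⟨y, rfl⟩ := toLex.surjective y
      rcases y with y | y
      · exact ⟨toLex (Sum.inl y), rfl⟩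
      · exact ⟨toLex (Sum.inr ⟨y, Sum.Lex.inr_lt_inr_iff.1 hy⟩), rfl⟩
    exact (((OrdIso.refl P).concat (OrdIso.rat_Iio r)).symm.trans h1).classQ h

/-- Induction on the generated class: members of 𝒬 with cuts form a left sum-generating class, and
the generators all end in ℚ. -/
theorem classQ.hasCuts {L : LinOrd.{u}} (h : classQ L) : HasCuts L := by
  refine (h (fun L => classQ L ∧ HasCuts L) ⟨?_, ?_, ?_⟩ ?_).2
  · exact fun A B h hA => ⟨h.classQ hA.1, h.hasCuts hA.2⟩
  · exact fun A B h => ⟨isLeftSGC_classQ.right_mem A B h.1, h.2.right⟩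
  · exact fun ι _ _ A h => ⟨classQ_lexSum fun i => (h i).1,
      HasCuts.lexSum (fun i => (h i).1) fun i => (h i).2⟩
  · rintro X (rfl | rfl | rfl)
    · have h := OrdIso.empty_concat (finOrd.{u} 0) rat
      exact ⟨classQ_rat, h.hasCuts (hasCuts_concat_rat _ (h.symm.classQ classQ_rat))⟩
    · exact ⟨classQ_rat12_concat_rat, hasCuts_concat_rat _ classQ_rat12_concat_rat⟩
    · exact ⟨classQ_rat2_concat_rat, hasCuts_concat_rat _ classQ_rat2_concat_rat⟩

/-! ### Presentations of countable members of `𝒬` -/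

/-- The order `∑_n (R n + ℚ)`. -/
abbrev ratSum (R : ℕ → LinOrd.{u}) : LinOrd.{u} :=
  lexSum (ULift.{u} ℕ) fun n => concat (R n.down) rat

theorem OrdIso.rat_Ioo {L : LinOrd.{u}} [Countable L] {u v : L} (huv : u < v)
    (h : ∀ a b, u ≤ a → a < b → b ≤ v → ∃ c, a < c ∧ c < b) :
    OrdIso (LinOrd.of (Set.Ioo u v)) rat := by
  have : DenselyOrdered (Set.Ioo u v) := ⟨fun a b hab => by
    obtain ⟨c, h1, h2⟩ := h a b a.2.1.le hab b.2.2.le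
    exact ⟨⟨c, a.2.1.trans h1, h2.trans b.2.2⟩, h1, h2⟩⟩
  have : NoMinOrder (Set.Ioo u v) := ⟨fun a => by
    obtain ⟨c, h1, h2⟩ := h u a le_rfl a.2.1 a.2.2.le
    exact ⟨⟨c, h1, h2.trans a.2.2⟩, h2⟩⟩
  have : NoMaxOrder (Set.Ioo u v) := ⟨fun a => by
    obtain ⟨c, h1, h2⟩ := h a v a.2.1.le a.2.2 le_rfl
    exact ⟨⟨c, a.2.1.trans h1, h2⟩, h1⟩⟩
  have : Nonempty (Set.Ioo u v) := by
    obtain ⟨c, h1, h2⟩ := h u v le_rfl huv le_rfl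
    exact ⟨⟨c, h1, h2⟩⟩
  exact OrdIso.rat_of _

/-- Cut `L` at a cofinal ω-sequence of right ends of dense intervals. Each piece then ends with a
countable dense interval without endpoints, a copy of ℚ. Only the first piece has to be in 𝒬, since
targets keep no other `R n`. -/
theorem classQ.exists_ratSum {L : LinOrd.{u}} (hL : classQ L) [Countable L] [Nonempty L] :
    ∃ R : ℕ → LinOrd.{u}, (∀ n, Countable (R n)) ∧ classQ (concat (R 0) rat) ∧
      OrdIso L (ratSum R) := by
  classical
  obtain ⟨x, hx⟩ := exists_surjective_nat L
  choose U V hU hUV hd hV using hL.hasCuts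
  -- The maximum pushes `p` past the previous cut, making the cuts increase, and past the
  -- enumeration `x`, making them cofinal.
  let p : ℕ → L := fun n => Nat.rec (x 0) (fun n y => max (V y) (x (n + 1))) n
  have hp : ∀ n, V (p n) ≤ p (n + 1) := fun n => le_max_left _ _
  have hxp : ∀ n, x n ≤ p n := by
    intro n
    cases n
    · exact le_rfl
    · exact le_max_right _ _
  have hmono : StrictMono (fun n => V (p n)) := strictMono_nat_of_lt_succ fun n =>
    (hp n).trans_lt ((hU _).trans_lt (hUV _))
  have hex : ∀ l : L, ∃ n, l < V (p n) := by
    intro l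
    obtain ⟨n, rfl⟩ := hx l
    exact ⟨n, (hxp n).trans_lt ((hU _).trans_lt (hUV _))⟩
  let f : L → ℕ := fun l => Nat.find (hex l)
  have hf : Monotone f := fun a b hab => Nat.find_min' _ (hab.trans_lt (Nat.find_spec (hex b)))
  have hfu : ∀ n l, U (p n) < l → l < V (p n) → f l = n := by
    intro n l h1 h2
    refine (Nat.find_eq_iff _).2 ⟨h2, fun m hm h3 => ?_⟩
    obtain ⟨k, rfl⟩ : ∃ k, n = k + 1 := ⟨n - 1, by omega⟩
    have : V (p m) ≤ l := ((hmono.monotone (Nat.lt_succ_iff.1 hm)).trans ((hp k).trans (hU _))).trans h1.le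
    exact this.not_gt h3
  let g : L → ULift.{u} ℕ := fun l => ⟨f l⟩
  let R : ℕ → LinOrd.{u} := fun n => LinOrd.of {l : {l : L // f l = n} // l.1 ≤ U (p n)}
  have key : ∀ n, OrdIso (LinOrd.of {l : L // f l = n}) (concat (R n) rat) := by
    intro n
    obtain ⟨e⟩ := nonempty_splitIso {l : {l : L // f l = n} | l.1 ≤ U (p n)}
      (fun a b hab ha => le_trans (Subtype.coe_le_coe.2 hab) ha)
    have he : OrdIso (concat (R n) (LinOrd.of
        ↥{l : {l : L // f l = n} | l.1 ≤ U (p n)}ᶜ)) (LinOrd.of {l : L // f l = n}) := ⟨e⟩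
    refine he.symm.trans
      ((OrdIso.refl _).concat (OrdIso.trans (OrdIso.symm ?_) (OrdIso.rat_Ioo (hUV _) (hd (p n)))))
    refine ⟨StrictMono.orderIsoOfSurjective (fun l : Set.Ioo (U (p n)) (V (p n)) =>
      (⟨⟨l.1, hfu n l.1 l.2.1 l.2.2⟩, not_le.2 l.2.1⟩ :
        ↥{l : {l : L // f l = n} | l.1 ≤ U (p n)}ᶜ)) (fun a b hab => hab) ?_⟩
    rintro ⟨⟨l, rfl⟩, hl⟩
    exact ⟨⟨l, not_le.1 hl, Nat.find_spec (hex l)⟩, rfl⟩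
  refine ⟨R, fun n => inferInstanceAs (Countable {l : {l : L // f l = n} // l.1 ≤ U (p n)}),
    (key 0).classQ ?_, ?_⟩
  · refine (OrdIso.subtype (p := fun l => l < V (p 0)) (q := fun l => f l = 0)
      (OrderIso.refl L) fun l => ?_).classQ (hV (p 0))
    exact (Nat.find_eq_zero (hex l)).symm
  · obtain ⟨e⟩ := nonempty_fiberIso g fun a b hab => hf hab
    refine (OrdIso.symm ⟨e⟩ : OrdIso L (lexSum _ fun n => LinOrd.of {l // g l = n})).trans
      (OrdIso.lexSum_congr fun n => OrdIso.trans ?_ (key n.down))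
    exact OrdIso.subtype (p := fun l => g l = n) (q := fun l => f l = n.down) (OrderIso.refl L)
      fun l => ULift.ext_iff

/-- `∑_n (A n + B n) = A 0 + ∑_n (B n + A (n + 1))`. -/
theorem OrdIso.regroup (A B : ℕ → LinOrd.{u}) :
    OrdIso (_root_.concat (A 0) (lexSum (ULift.{u} ℕ) fun n => _root_.concat (B n.down) (A (n.down + 1))))
      (lexSum (ULift.{u} ℕ) fun n => _root_.concat (A n.down) (B n.down)) := by
  let T := Σₗ n : ULift.{u} ℕ, _root_.concat (A n.down) (B n.down)
  let a : ∀ n, A n → T := fun n x => toLex ⟨⟨n⟩, toLex (Sum.inl x)⟩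
  let b : ∀ n, B n → T := fun n x => toLex ⟨⟨n⟩, toLex (Sum.inr x)⟩
  have hlt : ∀ {m n : ℕ}, m < n → (⟨m⟩ : ULift.{u} ℕ) < ⟨n⟩ := fun h => h
  have ha : ∀ n, StrictMono (a n) := fun n x y h =>
    sigmaLex_mk_lt_iff.2 (Sum.Lex.inl_lt_inl_iff.2 h)
  have hb : ∀ n, StrictMono (b n) := fun n x y h =>
    sigmaLex_mk_lt_iff.2 (Sum.Lex.inr_lt_inr_iff.2 h)
  have hg : ∀ n, StrictMono fun x : B n ⊕ₗ A (n + 1) => Sum.elim (b n) (a (n + 1)) (ofLex x) :=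
    fun n => strictMono_sumLex _ _ (hb n) (ha (n + 1))
      fun x y => sigmaLex_mk_lt (hlt (Nat.lt_succ_self n)) _ _
  have hg' : StrictMono fun x : Σₗ n : ULift.{u} ℕ, B n.down ⊕ₗ A (n.down + 1) =>
      Sum.elim (b _) (a _) (ofLex (ofLex x).2) := by
    refine strictMono_sigmaLex (fun (n : ULift.{u} ℕ) (x : B n.down ⊕ₗ A (n.down + 1)) =>
      Sum.elim (b n.down) (a (n.down + 1)) (ofLex x)) (fun n => hg n.down) ?_
    intro i j hij x y
    have hij' : i.down < j.down := hij
    rcases x with x | x <;> rcases y with y | y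
    · exact sigmaLex_mk_lt (hlt hij') _ _
    · exact sigmaLex_mk_lt (hlt (by omega)) _ _
    · rcases Nat.lt_or_ge (i.down + 1) j.down with h | h
      · exact sigmaLex_mk_lt (hlt h) _ _
      · obtain ⟨i⟩ := i
        obtain ⟨j⟩ := j
        obtain rfl : j = i + 1 := by
          simp only at h hij'
          omega
        exact sigmaLex_mk_lt_iff.2 (Sum.Lex.inl_lt_inr _ _)
    · exact sigmaLex_mk_lt (hlt (by omega)) _ _
  refine ⟨StrictMono.orderIsoOfSurjective _ (strictMono_sumLex (a 0) _ (ha 0) hg' ?_) ?_⟩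
  · rintro x ⟨⟨n⟩, y | y⟩
    · rcases Nat.eq_zero_or_pos n with rfl | hn
      · exact sigmaLex_mk_lt_iff.2 (Sum.Lex.inl_lt_inr _ _)
      · exact sigmaLex_mk_lt (hlt hn) _ _
    · exact sigmaLex_mk_lt (hlt (Nat.succ_pos n)) _ _
  · rintro ⟨⟨n⟩, y | y⟩
    · cases n with
      | zero => exact ⟨toLex (Sum.inl y), rfl⟩
      | succ n => exact ⟨toLex (Sum.inr (toLex ⟨⟨n⟩, toLex (Sum.inr y)⟩)), rfl⟩
    · exact ⟨toLex (Sum.inr (toLex ⟨⟨n⟩, toLex (Sum.inl y)⟩)), rfl⟩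

/-- The sequence `R 0, ℚ(2) + ℚ, ℚ(2) + ℚ, …`. -/
def targetSeq (P : LinOrd.{u}) : ℕ → LinOrd.{u}
  | 0 => P
  | _ + 1 => concat rat2 rat

/-- `z` is the target of `x`: both have a presentation `∑_n (R n + ℚ)` with the same initial
term, and the remaining terms of the presentation of `z` are `ℚ(2) + ℚ`. -/
def IsTarget (x z : LinOrd.{u}) : Prop :=
  ∃ R : ℕ → LinOrd.{u}, (∀ n, Countable (R n)) ∧ classQ (concat (R 0) rat) ∧
    OrdIso x (ratSum R) ∧ OrdIso z (ratSum (targetSeq (R 0)))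

instance countable_targetSeq (P : LinOrd.{u}) [Countable P] (n : ℕ) :
    Countable (targetSeq P n) := by
  cases n
  · assumption
  · exact inferInstanceAs (Countable (concat rat2.{u} rat))

/-- A target keeps its first term, so its own presentation witnesses that it is a target of itself.
This permits an idempotent choice of targets. -/
theorem IsTarget.self {x z : LinOrd.{u}} (h : IsTarget x z) : IsTarget z z := by
  obtain ⟨R, h1, h2, h3, h4⟩ := h
  have := h1 0
  exact ⟨targetSeq (R 0), fun n => inferInstance, h2, h4, h4⟩

theorem IsTarget.congr {x x' z z' : LinOrd.{u}} (h : IsTarget x z) (hx : OrdIso x x')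
    (hz : OrdIso z z') : IsTarget x' z' := by
  obtain ⟨R, h1, h2, h3, h4⟩ := h
  exact ⟨R, h1, h2, hx.symm.trans h3, hz.symm.trans h4⟩

theorem IsTarget.classQ {x z : LinOrd.{u}} (h : IsTarget x z) : classQ z := by
  obtain ⟨R, h1, h2, h3, h4⟩ := h
  refine h4.symm.classQ (classQ_lexSum ?_)
  rintro ⟨n⟩
  cases n with
  | zero => exact h2
  | succ n => exact classQ_concat classQ_rat2_concat_rat classQ_rat

theorem OrdIso.mk_eq {A B : LinOrd.{u}} (h : OrdIso A B) : #A = #B :=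
  h.elim fun e => Cardinal.mk_congr e.toEquiv

theorem OrdIso.countable {A B : LinOrd.{u}} (h : OrdIso A B) [Countable A] : Countable B :=
  h.elim fun e => e.toEquiv.countable_iff.1 inferInstance

theorem countable_ratSum (R : ℕ → LinOrd.{u}) (h : ∀ n, Countable (R n)) :
    Countable (ratSum R) :=
  inferInstanceAs (Countable (Σ n : ULift.{u} ℕ, concat (R n.down) rat))

/-- A non-empty countable member of 𝒬 is infinite because its presentation has infinitely many
copies of ℚ; only the empty order is excluded. -/
theorem countableQ_iff {L : LinOrd.{u}} : countableQ L ↔ classQ L ∧ Countable L ∧ Nonempty L := by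
  constructor
  · rintro ⟨h1, h2⟩
    refine ⟨h1, Cardinal.mk_le_aleph0_iff.1 h2.le, Cardinal.mk_ne_zero_iff.1 ?_⟩
    rw [h2]
    exact Cardinal.aleph0_ne_zero
  · rintro ⟨h1, h2, h3⟩
    refine ⟨h1, le_antisymm (Cardinal.mk_le_aleph0_iff.2 h2) ?_⟩
    obtain ⟨R, -, -, ⟨e⟩⟩ := h1.exists_ratSum
    rw [Cardinal.mk_congr e.toEquiv]
    have : Function.Injective (fun n : ULift.{u} ℕ =>
        (toLex ⟨n, toLex (Sum.inr (Classical.arbitrary rat.{u}))⟩ : ratSum R)) := by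
      intro m n hmn
      exact congrArg (fun x : ratSum R => (ofLex x).1) hmn
    have := Cardinal.mk_le_of_injective this
    rwa [Cardinal.mk_uLift, Cardinal.mk_nat, Cardinal.lift_aleph0] at this

theorem IsTarget.countableQ {x z : LinOrd.{u}} (h : IsTarget x z) : countableQ z := by
  refine countableQ_iff.2 ⟨h.classQ, ?_⟩
  obtain ⟨R, h1, h2, h3, h4⟩ := h
  have := h1 0
  have := countable_ratSum (targetSeq (R 0)) (fun n => inferInstance)
  refine ⟨h4.symm.countable, ?_⟩
  obtain ⟨e⟩ := h4
  exact ⟨e.symm (toLex ⟨⟨0⟩, toLex (Sum.inr (Classical.arbitrary rat.{u}))⟩)⟩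

theorem countableQ.exists_isTarget {x : LinOrd.{u}} (h : countableQ x) : ∃ z, IsTarget x z := by
  obtain ⟨h1, h2, h3⟩ := countableQ_iff.1 h
  obtain ⟨R, h4, h5, h6⟩ := h1.exists_ratSum
  exact ⟨_, R, h4, h5, h6, OrdIso.refl _⟩

/-- Shift the brackets: z is R 0 + ∑ (ℚ + ℚ(2) + ℚ) and x is R 0 + ∑ (ℚ + R (n+1)). In each piece
the first ℚ gives up R' n to y, ℚ(2) is shared as ℚ and ℚ, and the last ℚ gives R (n+1) to x while
keeping a ℚ for y. So x receives ℚ + ℚ + R (n+1) and y receives R' n + ℚ + ℚ, where y = ∑ (R' n +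
ℚ); the initial R 0 goes to x. -/
theorem IsTarget.splits {x z : LinOrd.{u}} (h : IsTarget x z) {y : LinOrd.{u}}
    (hy : _root_.countableQ y) : Splits z x y := by
  obtain ⟨R, h1, h2, h3, h4⟩ := h
  obtain ⟨h5, h6, h7⟩ := countableQ_iff.1 hy
  obtain ⟨R', h8, -, h9⟩ := h5.exists_ratSum
  have piece : ∀ n : ULift.{u} ℕ, Splits (concat rat (concat rat2 rat))
      (concat rat (R (n.down + 1))) (concat (R' n.down) rat) := by
    intro n
    have := h8 n.down
    have := h1 (n.down + 1)
    have h := (Splits.rat_absorb (R' n.down)).concat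
      (Splits.rat2_rat_rat.concat (Splits.rat_absorb (R (n.down + 1))).symm)
    exact h.congr (OrdIso.refl _)
      ((OrdIso.assoc _ _ _).symm.trans (OrdIso.rat_concat_rat.concat (OrdIso.refl _)))
      ((OrdIso.refl _).concat OrdIso.rat_concat_rat)
  have h := (Splits.left (R 0) (finOrd 0)).concat (Splits.lexSum piece)
  refine h.congr ?_ ?_ ?_
  · exact (OrdIso.regroup (targetSeq (R 0)) fun _ => rat).trans h4.symm
  · exact (OrdIso.regroup R fun _ => rat).trans h3.symm
  · exact (OrdIso.empty_concat _ _).trans h9.symm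

/-! ### Jumps -/

/-- There are jumps above every point. -/
def CofinalJumps (L : LinOrd.{u}) : Prop :=
  ∀ x : L, ∃ u v : L, x ≤ u ∧ u ⋖ v

theorem OrdIso.cofinalJumps {A B : LinOrd.{u}} (h : OrdIso A B) (hA : CofinalJumps A) :
    CofinalJumps B := by
  obtain ⟨e⟩ := h
  intro x
  obtain ⟨u, v, h1, h2⟩ := hA (e.symm x)
  exact ⟨e u, e v, (OrderIso.symm_apply_le e).1 h1, (apply_covBy_apply_iff e).2 h2⟩

theorem not_cofinalJumps_concat_rat (P : LinOrd.{u}) : ¬ CofinalJumps (concat P rat) := by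
  intro h
  obtain ⟨u, v, h1, h2⟩ := h (toLex (Sum.inr (Classical.arbitrary rat.{u})))
  obtain ⟨u, rfl⟩ := toLex.surjective u
  obtain ⟨v, rfl⟩ := toLex.surjective v
  rcases u with u | u
  · exact Sum.Lex.not_inr_le_inl h1
  rcases v with v | v
  · exact Sum.Lex.not_inr_lt_inl h2.lt
  · obtain ⟨w, h3, h4⟩ := exists_between (Sum.Lex.inr_lt_inr_iff.1 h2.lt)
    exact h2.2 (Sum.Lex.inr_lt_inr_iff.2 h3 : (toLex (Sum.inr u) : P ⊕ₗ rat.{u}) < _)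
      (Sum.Lex.inr_lt_inr_iff.2 h4)

theorem rat2_covBy (q : ℚ) : (⟨toLex ⟨q, 0⟩⟩ : rat2.{u}) ⋖ (⟨toLex ⟨q, 1⟩⟩ : rat2.{u}) := by
  refine ⟨(sigmaLex_mk_lt_iff (A := fun _ : ℚ => Fin 2)).2 (by decide), ?_⟩
  rintro ⟨⟨r, i⟩⟩ h1 h2
  obtain rfl : q = r := le_antisymm (sigmaLex_fst_mono (le_of_lt h1))
    (sigmaLex_fst_mono (le_of_lt h2))
  have h5 := (sigmaLex_mk_lt_iff (A := fun _ : ℚ => Fin 2)).1 h1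
  have h6 := (sigmaLex_mk_lt_iff (A := fun _ : ℚ => Fin 2)).1 h2
  omega

theorem inl_covBy_inl {A B : LinOrd.{u}} {u v : A} (h : u ⋖ v) :
    (toLex (Sum.inl u) : A ⊕ₗ B) ⋖ toLex (Sum.inl v) := by
  refine ⟨Sum.Lex.inl_lt_inl_iff.2 h.lt, fun c h1 h2 => ?_⟩
  obtain ⟨c, rfl⟩ := toLex.surjective c
  rcases c with c | c
  · exact h.2 (Sum.Lex.inl_lt_inl_iff.1 h1) (Sum.Lex.inl_lt_inl_iff.1 h2)
  · exact Sum.Lex.not_inr_lt_inl h2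

theorem mk_covBy_mk {ι : Type u} [LinearOrder ι] {A : ι → LinOrd.{u}} {i : ι} {u v : A i}
    (h : u ⋖ v) : (toLex ⟨i, u⟩ : Σₗ i, A i) ⋖ toLex ⟨i, v⟩ := by
  refine ⟨(sigmaLex_mk_lt_iff (A := fun i => A i)).2 h.lt, ?_⟩
  rintro ⟨j, c⟩ h1 h2
  have h3 : i ≤ j := sigmaLex_fst_mono (le_of_lt h1)
  have h4 : j ≤ i := sigmaLex_fst_mono (le_of_lt h2)
  obtain rfl : i = j := le_antisymm h3 h4
  exact h.2 ((sigmaLex_mk_lt_iff (A := fun i => A i)).1 h1)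
    ((sigmaLex_mk_lt_iff (A := fun i => A i)).1 h2)

/-- Each term after the first contains ℚ(2). Hence no order ending in ℚ is a target, which keeps the
prescribed table apart from the rest. -/
theorem IsTarget.cofinalJumps {x z : LinOrd.{u}} (h : IsTarget x z) : CofinalJumps z := by
  obtain ⟨R, h1, h2, h3, h4⟩ := h
  refine h4.symm.cofinalJumps ?_
  rintro ⟨⟨n⟩, x⟩
  refine ⟨toLex ⟨⟨n + 1⟩, toLex (Sum.inl (toLex (Sum.inl ⟨toLex ⟨0, 0⟩⟩)))⟩,
    toLex ⟨⟨n + 1⟩, toLex (Sum.inl (toLex (Sum.inl ⟨toLex ⟨0, 1⟩⟩)))⟩, ?_, ?_⟩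
  · exact (sigmaLex_mk_lt (show (⟨n⟩ : ULift.{u} ℕ) < ⟨n + 1⟩ from Nat.lt_succ_self n) _ _).le
  · exact mk_covBy_mk (A := fun m : ULift.{u} ℕ => concat (targetSeq (R 0) m.down) rat)
      (inl_covBy_inl (A := concat rat2 rat) (inl_covBy_inl (rat2_covBy 0)))

/-! ### The sum on the countable members of `𝒬` -/

/-- Adjoining to a commutative semigroup on a subset `T = range t` of `X`, on which it acts as an
identity, a semilattice on the image of a projection `ρ` onto a subset disjoint from `T`. -/
theorem exists_extended_table {X ι : Type*} (t : ι → X) (ht : Function.Injective t)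
    (m : ι → ι → ι) (hm : ∀ i j, m i j = m j i) (hm' : ∀ i j k, m i (m j k) = m (m i j) k)
    (ρ : X → X) (hρ : ∀ x, ρ (ρ x) = ρ x) (hρt : ∀ x, ρ x ∉ Set.range t) :
    ∃ star : X → X → X, (∀ i j, star (t i) (t j) = t (m i j)) ∧
      (∀ x y, star x y = star y x) ∧ (∀ x y z, star x (star y z) = star (star x y) z) ∧
      ∀ x y, (∃ i j, x = t i ∧ y = t j) ∨ star x y = ρ x ∨ star x y = ρ y := by
  classical
  rcases isEmpty_or_nonempty X with hX | hX
  · exact ⟨fun x => isEmptyElim x, fun i => isEmptyElim (t i), fun x => isEmptyElim x,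
      fun x => isEmptyElim x, fun x => isEmptyElim x⟩
  -- The rank of an element encodes its ρ-image as a cardinal, with elements of the table ranked at
  -- the top. Outside the table the product decodes the smaller rank.
  let r : X → WithTop Cardinal := fun x =>
    if x ∈ Set.range t then ⊤ else (embeddingToCardinal (ρ x) : Cardinal)
  have hr : ∀ x, r x = ⊤ ↔ x ∈ Set.range t := fun x => by simp [r]
  have hr' : ∀ x, x ∉ Set.range t → r x = (embeddingToCardinal (ρ x) : Cardinal) :=
    fun x hx => if_neg hx
  have hdec : ∃ dec : WithTop Cardinal → X, ∀ x : X, dec (embeddingToCardinal x : Cardinal) = x :=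
    ⟨Function.invFun fun x : X => ((embeddingToCardinal x : Cardinal) : WithTop Cardinal),
      Function.leftInverse_invFun fun x y h =>
        embeddingToCardinal.injective (WithTop.coe_injective h)⟩
  obtain ⟨dec, hdec⟩ := hdec
  let star : X → X → X := fun x y =>
    if h : x ∈ Set.range t ∧ y ∈ Set.range t then t (m h.1.choose h.2.choose)
    else dec (min (r x) (r y))
  have h₁ : ∀ i j, star (t i) (t j) = t (m i j) := by
    intro i j
    have h : t i ∈ Set.range t ∧ t j ∈ Set.range t := ⟨⟨i, rfl⟩, ⟨j, rfl⟩⟩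
    have hi : h.1.choose = i := ht h.1.choose_spec
    have hj : h.2.choose = j := ht h.2.choose_spec
    exact (dif_pos h).trans (by rw [hi, hj])
  have h₂ : ∀ x y, ¬ (x ∈ Set.range t ∧ y ∈ Set.range t) → star x y = dec (min (r x) (r y)) :=
    fun x y h => dif_neg h
  have h₃ : ∀ x y, ¬ (x ∈ Set.range t ∧ y ∈ Set.range t) →
      ∃ z, (z = x ∨ z = y) ∧ min (r x) (r y) = r z ∧ r z = (embeddingToCardinal (ρ z) : Cardinal) ∧
        star x y = ρ z := by
    intro x y h
    have key : ∀ z, min (r x) (r y) = r z → r z = (embeddingToCardinal (ρ z) : Cardinal) ∧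
        star x y = ρ z := by
      intro z hz
      have hz' : z ∉ Set.range t := fun hzt => h <| by
        rw [(hr z).2 hzt, min_eq_top, hr, hr] at hz
        exact hz
      refine ⟨hr' z hz', ?_⟩
      rw [h₂ x y h, hz, hr' z hz', hdec]
    rcases min_choice (r x) (r y) with h' | h'
    · exact ⟨x, Or.inl rfl, h', key x h'⟩
    · exact ⟨y, Or.inr rfl, h', key y h'⟩
  -- The rank turns products into minima, so associativity outside the table is that of `min`.
  -- Idempotence of `ρ` and the disjointness of its image from the table enter here.
  have h₄ : ∀ x y, r (star x y) = min (r x) (r y) := by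
    intro x y
    by_cases h : x ∈ Set.range t ∧ y ∈ Set.range t
    · obtain ⟨⟨i, rfl⟩, ⟨j, rfl⟩⟩ := h
      rw [h₁, (hr _).2 ⟨_, rfl⟩, (hr _).2 ⟨_, rfl⟩, (hr _).2 ⟨_, rfl⟩, min_self]
    · obtain ⟨z, -, h5, h6, h7⟩ := h₃ x y h
      rw [h5, h7, h6, hr' _ (hρt z), hρ]
  have h₅ : ∀ x y, star x y ∈ Set.range t ↔ x ∈ Set.range t ∧ y ∈ Set.range t := by
    intro x y
    rw [← hr, h₄, min_eq_top, hr, hr]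
  refine ⟨star, h₁, ?_, ?_, ?_⟩
  · intro x y
    by_cases h : x ∈ Set.range t ∧ y ∈ Set.range t
    · obtain ⟨⟨i, rfl⟩, ⟨j, rfl⟩⟩ := h
      rw [h₁, h₁, hm]
    · rw [h₂ x y h, h₂ y x fun h' => h h'.symm, min_comm]
  · intro x y z
    by_cases h : x ∈ Set.range t ∧ y ∈ Set.range t ∧ z ∈ Set.range t
    · obtain ⟨⟨i, rfl⟩, ⟨j, rfl⟩, ⟨k, rfl⟩⟩ := h
      rw [h₁, h₁, h₁, h₁, hm']
    · rw [h₂ x (star y z) (by rwa [h₅]), h₂ (star x y) z (by rwa [h₅, and_assoc]), h₄, h₄,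
        min_assoc]
  · intro x y
    by_cases h : x ∈ Set.range t ∧ y ∈ Set.range t
    · obtain ⟨⟨i, rfl⟩, ⟨j, rfl⟩⟩ := h
      exact Or.inl ⟨i, j, rfl, rfl⟩
    · obtain ⟨z, rfl | rfl, -, -, h7⟩ := h₃ x y h
      · exact Or.inr (Or.inl h7)
      · exact Or.inr (Or.inr h7)

theorem OrdIso.countableQ {A B : LinOrd.{u}} (h : OrdIso A B) (hA : countableQ A) :
    countableQ B :=
  ⟨h.classQ hA.1, h.mk_eq ▸ hA.2⟩

theorem type_eq_type_iff {A B : LinOrd.{u}} :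
    OrderType.type A = OrderType.type B ↔ OrdIso A B :=
  OrderType.type_eq_type

/-- A chosen order of the given type. -/
noncomputable abbrev typeRep (o : OrderType.{u}) : LinOrd.{u} := LinOrd.of o.ToType

theorem type_typeRep (o : OrderType.{u}) : OrderType.type (typeRep o) = o :=
  OrderType.type_toType o

theorem ordIso_typeRep (A : LinOrd.{u}) : OrdIso (typeRep (OrderType.type A)) A :=
  type_eq_type_iff.1 (type_typeRep _)

/-- A finite or infinite table of splittings of countable members of `𝒬` that end in a copy of the
rationals extends to a good sum. -/
theorem exists_isGoodOn_hasTable {ι : Type} (x : ι → LinOrd.{u}) (m : ι → ι → ι)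
    (hx : ∀ i, countableQ (x i)) (hinj : ∀ i j, OrdIso (x i) (x j) → i = j)
    (hj : ∀ i, ¬ CofinalJumps (x i)) (hs : ∀ i j, Splits (x (m i j)) (x i) (x j))
    (hm : ∀ i j, m i j = m j i) (hm' : ∀ i j k, m i (m j k) = m (m i j) k) :
    ∃ S : LinSum.{u}, S.IsGoodOn countableQ ∧ S.HasTable x m := by
  classical
  let X := {o : OrderType.{u} // countableQ (typeRep o)}
  let mk : ∀ A : LinOrd.{u}, countableQ A → X := fun A hA =>
    ⟨OrderType.type A, (ordIso_typeRep A).symm.countableQ hA⟩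
  have hmk : ∀ {A B : LinOrd.{u}} (hA : countableQ A) (hB : countableQ B), OrdIso A B →
      mk A hA = mk B hB := fun hA hB h => Subtype.ext (type_eq_type_iff.2 h)
  have htgt : ∀ o : X, ∃ z : X, IsTarget (typeRep o.1) (typeRep z.1) := by
    intro o
    obtain ⟨z, hz⟩ := o.2.exists_isTarget
    exact ⟨mk z hz.countableQ, hz.congr (OrdIso.refl _) (ordIso_typeRep z).symm⟩
  choose τ hτ using htgt
  -- The choice `τ` alone need not be idempotent, because an order has many presentations; keeping
  -- fixed what is already a target of itself repairs this.
  let ρ : X → X := fun o => if IsTarget (typeRep o.1) (typeRep o.1) then o else τ o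
  have hρ : ∀ o : X, IsTarget (typeRep o.1) (typeRep (ρ o).1) := by
    intro o
    by_cases h : IsTarget (typeRep o.1) (typeRep o.1)
    · simpa only [ρ, if_pos h] using h
    · simpa only [ρ, if_neg h] using hτ o
  have hρρ : ∀ o, ρ (ρ o) = ρ o := fun o => if_pos (hρ o).self
  let t : ι → X := fun i => mk (x i) (hx i)
  have ht : Function.Injective t := fun i j h =>
    hinj i j (type_eq_type_iff.1 (congrArg Subtype.val h))
  have hρt : ∀ o, ρ o ∉ Set.range t := by
    rintro o ⟨i, hi⟩
    have h1 : OrdIso (typeRep (ρ o).1) (x i) := by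
      rw [← hi]
      exact ordIso_typeRep (x i)
    exact hj i (h1.cofinalJumps (hρ o).cofinalJumps)
  obtain ⟨star, h1, h2, h3, h4⟩ := exists_extended_table t ht m hm hm' ρ hρρ hρt
  have hstar : ∀ o o' : X, Splits (typeRep (star o o').1) (typeRep o.1) (typeRep o'.1) := by
    intro o o'
    rcases h4 o o' with ⟨i, j, rfl, rfl⟩ | h | h
    · rw [h1]
      exact (hs i j).congr (ordIso_typeRep _).symm (ordIso_typeRep _).symm (ordIso_typeRep _).symm
    · rw [h]
      exact (hρ o).splits o'.2
    · rw [h]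
      exact ((hρ o').splits o.2).symm
  have hop : ∀ A B : LinOrd.{u}, ∃ Z, Splits Z A B ∧
      ∀ (hA : countableQ A) (hB : countableQ B), OrderType.type Z = (star (mk A hA) (mk B hB)).1 := by
    intro A B
    by_cases h : countableQ A ∧ countableQ B
    · exact ⟨typeRep (star (mk A h.1) (mk B h.2)).1,
        (hstar _ _).congr (OrdIso.refl _) (ordIso_typeRep A) (ordIso_typeRep B),
        fun _ _ => type_typeRep _⟩
    -- Outside the class the sum is arbitrary; concatenation is a convenient default.
    · exact ⟨concat A B, Splits.concat_self A B, fun hA hB => absurd ⟨hA, hB⟩ h⟩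
  choose op hsp hop using hop
  choose inl inr hcompl using hsp
  have hK : ∀ {A B : LinOrd.{u}}, countableQ A → countableQ B → countableQ (op A B) := by
    intro A B hA hB
    refine OrdIso.countableQ (type_eq_type_iff.1 ?_) (star (mk A hA) (mk B hB)).2
    rw [type_typeRep, hop A B hA hB]
  have hmkop : ∀ {A B : LinOrd.{u}} (hA : countableQ A) (hB : countableQ B),
      mk (op A B) (hK hA hB) = star (mk A hA) (mk B hB) := fun hA hB => Subtype.ext (hop _ _ hA hB)
  refine ⟨⟨op, inl, inr, hcompl⟩, ⟨fun A B h hA => h.countableQ hA, fun A B => hK, ?_, ?_, ?_⟩, ?_⟩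
  · intro A A' B B' hA hA' hB hB' h h'
    refine type_eq_type_iff.1 ?_
    rw [hop A B hA hB, hop A' B' hA' hB', hmk hA hA' h, hmk hB hB' h']
  · intro A B C hA hB hC
    refine type_eq_type_iff.1 ?_
    rw [hop A _ hA (hK hB hC), hop _ C (hK hA hB) hC, hmkop hB hC, hmkop hA hB, h3]
  · intro A B hA hB
    refine type_eq_type_iff.1 ?_
    rw [hop A B hA hB, hop B A hB hA, h2]
  · intro i j
    refine type_eq_type_iff.1 ?_
    have := congrArg Subtype.val (h1 i j)
    rw [hop _ _ (hx i) (hx j)]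
    exact this

/-! ### The two tables -/

theorem countableQ_concat_rat {P : LinOrd.{u}} [Countable P] (h : classQ (concat P rat)) :
    countableQ (concat P rat) :=
  countableQ_iff.2 ⟨h, inferInstance, ⟨toLex (Sum.inr (Classical.arbitrary rat.{u}))⟩⟩

theorem OrdIso.lexSum_concat {α β : LinOrd.{u}} (A : α ⊕ₗ β → LinOrd.{u}) :
    OrdIso (_root_.concat (lexSum α fun a => A (toLex (Sum.inl a)))
      (lexSum β fun b => A (toLex (Sum.inr b)))) (lexSum (α ⊕ₗ β) A) := by
  refine ⟨StrictMono.orderIsoOfSurjective _ (strictMono_sumLex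
    _ _ (strictMono_sigmaLex (fun a (x : A (toLex (Sum.inl a))) =>
      (toLex ⟨toLex (Sum.inl a), x⟩ : Σₗ i, A i)) ?_ ?_)
    (strictMono_sigmaLex (fun b (x : A (toLex (Sum.inr b))) =>
      (toLex ⟨toLex (Sum.inr b), x⟩ : Σₗ i, A i)) ?_ ?_) ?_) ?_⟩
  · exact fun a x y h => (sigmaLex_mk_lt_iff (A := fun i => A i)).2 h
  · exact fun a b h x y => sigmaLex_mk_lt (Sum.Lex.inl_lt_inl_iff.2 h) _ _
  · exact fun a x y h => (sigmaLex_mk_lt_iff (A := fun i => A i)).2 h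
  · exact fun a b h x y => sigmaLex_mk_lt (Sum.Lex.inr_lt_inr_iff.2 h) _ _
  · exact fun a b => sigmaLex_mk_lt (Sum.Lex.inl_lt_inr _ _) _ _
  · rintro ⟨i, x⟩
    obtain ⟨i, rfl⟩ := toLex.surjective i
    rcases i with i | i
    · exact ⟨toLex (Sum.inl (toLex ⟨i, x⟩)), rfl⟩
    · exact ⟨toLex (Sum.inr (toLex ⟨i, x⟩)), rfl⟩

/-- `ℚ(2) + 2 + ℚ(2) ≅ ℚ(2)`. -/
theorem OrdIso.rat2_concat_two_concat_rat2 :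
    OrdIso (_root_.concat rat2.{u} (_root_.concat (finOrd 2) rat2)) rat2 := by
  have h1 := OrdIso.lexSum_concat (α := rat.{u}) (β := _root_.concat (finOrd 1) rat) fun _ => finOrd.{u} 2
  have h2 := OrdIso.lexSum_concat (α := finOrd.{u} 1) (β := rat) fun _ => finOrd.{u} 2
  have h3 : OrdIso (lexSum (finOrd.{u} 1) fun _ => finOrd.{u} 2) (finOrd 2) :=
    nonempty_sigmaLexUnique (A := fun _ : finOrd.{u} 1 => finOrd.{u} 2)
  have h4 : OrdIso (blowup rat.{u} fun _ => 2) rat2 := OrdIso.blowup_two fun _ => rfl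
  obtain ⟨e⟩ := OrdIso.rat_concat_one_concat_rat (finOrd.{u} 1)
  have h5 : OrdIso (lexSum (rat.{u} ⊕ₗ _root_.concat (finOrd.{u} 1) rat) fun _ => finOrd.{u} 2)
      (blowup rat.{u} fun _ => 2) :=
    nonempty_sigmaLexCongr (A := fun _ => finOrd.{u} 2) (B := fun _ => finOrd.{u} 2) e
      fun _ => ⟨OrderIso.refl _⟩
  exact ((h4.symm.concat ((h3.symm.concat h4.symm).trans h2)).trans h1).trans (h5.trans h4)

theorem classQ_one_concat_rat : classQ (concat (finOrd.{u} 1) rat) :=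
  isLeftSGC_classQ.right_mem _ _
    ((OrdIso.rat_concat_one_concat_rat (finOrd.{u} 1)).symm.classQ classQ_rat)

/-- It is the final segment of ℚ(2) + ℚ that starts at one of the pairs. -/
theorem classQ_two_concat_rat2_concat_rat : classQ (concat (finOrd.{u} 2) (concat rat2 rat)) := by
  have h := (OrdIso.rat2_concat_two_concat_rat2.{u}.symm.concat (OrdIso.refl rat)).classQ
    classQ_rat2_concat_rat
  exact (OrdIso.assoc _ _ _).classQ (isLeftSGC_classQ.right_mem _ _ ((OrdIso.assoc _ _ _).classQ h))

theorem tripleE_ordIso (i : Fin 3) :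
    ∃ P : LinOrd.{u}, Countable P ∧ OrdIso (tripleE i) (concat P rat) := by
  fin_cases i
  · exact ⟨concat (finOrd 2) rat2, inferInstance, (OrdIso.assoc _ _ _).symm⟩
  · exact ⟨finOrd 0, inferInstance, (OrdIso.empty_concat _ _).symm⟩
  · exact ⟨concat (finOrd 1) (concat rat rat2), inferInstance,
      ((OrdIso.refl _).concat (OrdIso.assoc _ _ _).symm).trans (OrdIso.assoc _ _ _).symm⟩

theorem classQ_tripleE (i : Fin 3) : classQ (tripleE.{u} i) := by
  fin_cases i
  · exact classQ_two_concat_rat2_concat_rat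
  · exact classQ_rat
  · exact (OrdIso.assoc _ _ _).classQ (classQ_concat classQ_one_concat_rat classQ_rat2_concat_rat)

theorem pairZ2_ordIso (g : ZMod 2) :
    ∃ P : LinOrd.{u}, Countable P ∧ OrdIso (pairZ2 g) (concat P rat) := by
  unfold pairZ2
  split_ifs
  · exact ⟨rat2, inferInstance, OrdIso.refl _⟩
  · exact ⟨rat12, inferInstance, OrdIso.refl _⟩

theorem classQ_pairZ2 (g : ZMod 2) : classQ (pairZ2.{u} g) := by
  unfold pairZ2
  split_ifs
  · exact classQ_rat2_concat_rat
  · exact classQ_rat12_concat_rat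

theorem Splits.self_of_concat_rat {A B : LinOrd.{u}}
    (hA : ∃ P : LinOrd.{u}, Countable P ∧ OrdIso A (_root_.concat P rat))
    (hB : ∃ P : LinOrd.{u}, Countable P ∧ OrdIso B (_root_.concat P rat)) : Splits A A B := by
  obtain ⟨P, -, hP⟩ := hA
  obtain ⟨R, _, hR⟩ := hB
  exact (Splits.concat_rat P R).congr hP.symm hP.symm hR.symm

/-- In 1 + ℚ + ℚ(2) + ℚ, the order a takes the first point, one point of the first ℚ, all of ℚ(2)
and a copy of ℚ from the last ℚ. The remainders of the two ℚ's form q. -/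
theorem splits_tripleE_zero_one : Splits (tripleE.{u} 2) (tripleE 0) (tripleE 1) := by
  have h := (Splits.left (finOrd.{u} 1) (finOrd 0)).concat ((Splits.rat_absorb (finOrd 1)).symm.concat
    ((Splits.left rat2 (finOrd 0)).concat (Splits.rat_absorb rat)))
  refine h.congr (OrdIso.refl _) ?_ ?_
  · exact (OrdIso.assoc _ _ _).symm.trans (OrdIso.finOrd_one_concat_one.concat (OrdIso.refl _))
  · exact (OrdIso.empty_concat _ _).trans (((OrdIso.refl _).concat
      (OrdIso.empty_concat _ _)).trans OrdIso.rat_concat_rat)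

theorem splits_tripleE (i j : Fin 3) :
    Splits (tripleE.{u} (tableE i j)) (tripleE i) (tripleE j) := by
  have h : ∀ i j, Splits (tripleE.{u} i) (tripleE i) (tripleE j) := fun i j =>
    Splits.self_of_concat_rat (tripleE_ordIso i) (tripleE_ordIso j)
  fin_cases i <;> fin_cases j
  · exact h 0 0
  · exact splits_tripleE_zero_one
  · exact (h 2 0).symm
  · exact splits_tripleE_zero_one.symm
  · exact h 1 1
  · exact (h 2 1).symm
  · exact h 2 0
  · exact h 2 1
  · exact h 2 2

theorem splits_pairZ2 (g h : ZMod 2) : Splits (pairZ2.{u} (g + h)) (pairZ2 g) (pairZ2 h) := by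
  have H : ∀ g h, Splits (pairZ2.{u} g) (pairZ2 g) (pairZ2 h) := fun g h =>
    Splits.self_of_concat_rat (pairZ2_ordIso g) (pairZ2_ordIso h)
  have h11 : Splits (pairZ2.{u} 0) (pairZ2 1) (pairZ2 1) :=
    Splits.rat2_rat12_rat12.concat (Splits.rat_absorb rat)
  fin_cases g <;> fin_cases h
  · exact H 0 0
  · exact (H 1 0).symm
  · exact H 1 0
  · exact h11

/-! ### Invariants that distinguish the entries of the tables -/

theorem OrdIso.exists_isBot {A B : LinOrd.{u}} (h : OrdIso A B) (hA : ∃ x : A, IsBot x) :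
    ∃ x : B, IsBot x := by
  obtain ⟨e⟩ := h
  obtain ⟨x, hx⟩ := hA
  exact ⟨e x, fun y => (OrderIso.le_symm_apply e).1 (hx _)⟩

theorem OrdIso.exists_isBot_covBy {A B : LinOrd.{u}} (h : OrdIso A B)
    (hA : ∃ x y : A, IsBot x ∧ x ⋖ y) : ∃ x y : B, IsBot x ∧ x ⋖ y := by
  obtain ⟨e⟩ := h
  obtain ⟨x, y, hx, hy⟩ := hA
  exact ⟨e x, e y, fun y => (OrderIso.le_symm_apply e).1 (hx _), (apply_covBy_apply_iff e).2 hy⟩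

theorem isBot_inl {A B : LinOrd.{u}} {x : A} (h : IsBot x) :
    IsBot (toLex (Sum.inl x) : A ⊕ₗ B) := by
  intro y
  obtain ⟨y, rfl⟩ := toLex.surjective y
  rcases y with y | y
  · exact Sum.Lex.inl_le_inl_iff.2 (h y)
  · exact Sum.Lex.inl_le_inr _ _

theorem isBot_finOrd_two : IsBot (⟨(0 : Fin 2)⟩ : finOrd.{u} 2) := fun z => Fin.zero_le z.down

theorem finOrd_two_covBy : (⟨(0 : Fin 2)⟩ : finOrd.{u} 2) ⋖ (⟨(1 : Fin 2)⟩ : finOrd.{u} 2) := by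
  refine ⟨(by decide : (0 : Fin 2) < 1), fun z h1 h2 => ?_⟩
  have h3 : (0 : Fin 2) < z.down := h1
  have h4 : z.down < (1 : Fin 2) := h2
  omega

theorem exists_isBot_covBy_tripleE_zero : ∃ x y : tripleE.{u} 0, IsBot x ∧ x ⋖ y :=
  ⟨_, _, isBot_inl isBot_finOrd_two, inl_covBy_inl finOrd_two_covBy⟩

theorem not_exists_isBot_tripleE_one : ¬ ∃ x : tripleE.{u} 1, IsBot x := by
  rintro ⟨x, hx⟩
  obtain ⟨y, hy⟩ := exists_lt (show rat.{u} from x)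
  exact (hx y).not_gt hy

theorem exists_isBot_tripleE_two : ∃ x : tripleE.{u} 2, IsBot x :=
  ⟨toLex (Sum.inl (default : finOrd.{u} 1)), isBot_inl fun _ => (Subsingleton.elim _ _).le⟩

theorem not_exists_isBot_covBy_tripleE_two : ¬ ∃ x y : tripleE.{u} 2, IsBot x ∧ x ⋖ y := by
  rintro ⟨x, y, hx, hxy⟩
  let z : tripleE.{u} 2 := toLex (Sum.inl (default : finOrd.{u} 1))
  have hz : IsBot z := isBot_inl fun _ => (Subsingleton.elim _ _).le
  obtain rfl : x = z := le_antisymm (hx z) (hz x)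
  change (finOrd.{u} 1 ⊕ₗ (rat.{u} ⊕ₗ (rat2.{u} ⊕ₗ rat.{u})) : Type u) at y
  have key : ∃ q : rat.{u}, (toLex (Sum.inr (toLex (Sum.inl q))) :
      finOrd.{u} 1 ⊕ₗ (rat.{u} ⊕ₗ (rat2.{u} ⊕ₗ rat.{u}))) < y := by
    obtain ⟨y, rfl⟩ := toLex.surjective y
    rcases y with y | y
    · exact absurd hxy.lt (by rw [Subsingleton.elim y default]; exact lt_irrefl _)
    · obtain ⟨y, rfl⟩ := toLex.surjective y
      rcases y with y | y
      · obtain ⟨q, hq⟩ := exists_lt y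
        exact ⟨q, Sum.Lex.inr_lt_inr_iff.2 (Sum.Lex.inl_lt_inl_iff.2 hq)⟩
      · exact ⟨Classical.arbitrary _, Sum.Lex.inr_lt_inr_iff.2 (Sum.Lex.inl_lt_inr _ _)⟩
  obtain ⟨q, hq⟩ := key
  exact hxy.2 (Sum.Lex.inl_lt_inr _ _) hq

/-- The least point has a successor in a and none in c, and q has no least point. -/
theorem tripleE_injective (i j : Fin 3) (h : OrdIso (tripleE.{u} i) (tripleE j)) : i = j := by
  have h01 : ¬ OrdIso (tripleE.{u} 0) (tripleE 1) := fun h =>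
    not_exists_isBot_tripleE_one (h.exists_isBot
      (exists_isBot_covBy_tripleE_zero.imp fun x ⟨_, hx, _⟩ => hx))
  have h02 : ¬ OrdIso (tripleE.{u} 0) (tripleE 2) := fun h =>
    not_exists_isBot_covBy_tripleE_two (h.exists_isBot_covBy exists_isBot_covBy_tripleE_zero)
  have h21 : ¬ OrdIso (tripleE.{u} 2) (tripleE 1) := fun h =>
    not_exists_isBot_tripleE_one (h.exists_isBot exists_isBot_tripleE_two)
  fin_cases i <;> fin_cases j
  · rfl
  · exact absurd h h01
  · exact absurd h h02
  · exact absurd h.symm h01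
  · rfl
  · exact absurd h.symm h21
  · exact absurd h.symm h02
  · exact absurd h h21
  · rfl

/-- Below some point, every point is part of a jump. -/
def InitialJumps (L : LinOrd.{u}) : Prop :=
  ∃ x : L, ∀ y < x, ∃ z, y ⋖ z ∨ z ⋖ y

theorem OrdIso.initialJumps {A B : LinOrd.{u}} (h : OrdIso A B) (hA : InitialJumps A) :
    InitialJumps B := by
  obtain ⟨e⟩ := h
  obtain ⟨x, hx⟩ := hA
  refine ⟨e x, fun y hy => ?_⟩
  obtain ⟨z, hz⟩ := hx (e.symm y) ((OrderIso.symm_apply_lt e).2 hy)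
  refine ⟨e z, ?_⟩
  rwa [← apply_covBy_apply_iff e, ← apply_covBy_apply_iff e, e.apply_symm_apply] at hz

theorem initialJumps_rat2_concat_rat : InitialJumps (concat rat2.{u} rat) := by
  refine ⟨toLex (Sum.inl ⟨toLex ⟨0, 0⟩⟩), fun y hy => ?_⟩
  obtain ⟨y, rfl⟩ := toLex.surjective y
  rcases y with ⟨⟨q, i⟩⟩ | y
  · fin_cases i
    · exact ⟨_, Or.inl (inl_covBy_inl (rat2_covBy q))⟩
    · exact ⟨_, Or.inr (inl_covBy_inl (rat2_covBy q))⟩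
  · exact absurd hy Sum.Lex.not_inr_lt_inl

/-- The first point of `ℚ(1, 2)` over the rational number `q`. -/
def rat12Point (q : ℚ) : rat12.{u} := ⟨toLex ⟨q, ⟨0, by split_ifs <;> omega⟩⟩⟩

theorem rat12_lt {x y : rat12.{u}} (h : (ofLex x.down).1 < (ofLex y.down).1) : x < y :=
  sigmaLex_mk_lt (A := fun q : ℚ => Fin (if Even q.den then 2 else 1)) h _ _

theorem rat12Point_eq {q : ℚ} (hq : ¬ Even q.den) {x : rat12.{u}} (h : (ofLex x.down).1 = q) :
    x = rat12Point q := by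
  obtain ⟨⟨r, i⟩⟩ := x
  obtain rfl : r = q := h
  have hi : i = ⟨0, by split_ifs <;> omega⟩ := by
    have := i.2.trans_eq (if_neg hq)
    exact Fin.ext (Nat.lt_one_iff.1 this)
  rw [hi]
  rfl

/-- Below every point there is an undoubled point of ℚ(1,2), over a rational of odd denominator, and
such a point is a limit from both sides. -/
theorem not_initialJumps_rat12_concat_rat : ¬ InitialJumps (concat rat12.{u} rat) := by
  rintro ⟨x, hx⟩
  have key : ∃ q : ℚ, ¬ Even q.den ∧
      (toLex (Sum.inl (rat12Point q)) : rat12.{u} ⊕ₗ rat.{u}) < x := by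
    obtain ⟨x, rfl⟩ := toLex.surjective x
    rcases x with x | x
    · obtain ⟨q, -, h1, h2⟩ := exists_odd_den_between (sub_one_lt (ofLex x.down).1)
      exact ⟨q, h2, Sum.Lex.inl_lt_inl_iff.2 (rat12_lt h1)⟩
    · obtain ⟨q, -, -, h2⟩ := exists_odd_den_between (zero_lt_one' ℚ)
      exact ⟨q, h2, Sum.Lex.inl_lt_inr _ _⟩
  obtain ⟨q, hq, hqx⟩ := key
  obtain ⟨z, hz⟩ := hx _ hqx
  obtain ⟨z, rfl⟩ := toLex.surjective z
  rcases z with z | z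
  · have hne : (ofLex z.down).1 ≠ q := by
      intro h
      rw [rat12Point_eq hq h] at hz
      rcases hz with hz | hz <;> exact lt_irrefl _ hz.lt
    rcases lt_or_gt_of_ne hne with h | h
    · obtain ⟨r, h1, h2⟩ := exists_between h
      have h3 : (toLex (Sum.inl z) : rat12.{u} ⊕ₗ rat.{u}) < toLex (Sum.inl (rat12Point r)) :=
        Sum.Lex.inl_lt_inl_iff.2 (rat12_lt h1)
      have h4 : (toLex (Sum.inl (rat12Point r)) : rat12.{u} ⊕ₗ rat.{u}) <
          toLex (Sum.inl (rat12Point q)) := Sum.Lex.inl_lt_inl_iff.2 (rat12_lt h2)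
      rcases hz with hz | hz
      · exact hz.lt.not_gt (h3.trans h4)
      · exact hz.2 h3 h4
    · obtain ⟨r, h1, h2⟩ := exists_between h
      have h3 : (toLex (Sum.inl (rat12Point q)) : rat12.{u} ⊕ₗ rat.{u}) <
          toLex (Sum.inl (rat12Point r)) := Sum.Lex.inl_lt_inl_iff.2 (rat12_lt h1)
      have h4 : (toLex (Sum.inl (rat12Point r)) : rat12.{u} ⊕ₗ rat.{u}) < toLex (Sum.inl z) :=
        Sum.Lex.inl_lt_inl_iff.2 (rat12_lt h2)
      rcases hz with hz | hz
      · exact hz.2 h3 h4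
      · exact hz.lt.not_gt (h3.trans h4)
  · rcases hz with hz | hz
    · exact hz.2 (Sum.Lex.inl_lt_inl_iff.2 (rat12_lt (lt_add_one q)) :
        (toLex (Sum.inl (rat12Point q)) : rat12.{u} ⊕ₗ rat.{u}) <
          toLex (Sum.inl (rat12Point (q + 1)))) (Sum.Lex.inl_lt_inr _ _)
    · exact Sum.Lex.not_inr_lt_inl hz.lt

theorem pairZ2_injective (g h : ZMod 2) (H : OrdIso (pairZ2.{u} g) (pairZ2 h)) : g = h := by
  have h01 : ¬ OrdIso (pairZ2.{u} 0) (pairZ2 1) := fun H =>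
    not_initialJumps_rat12_concat_rat (OrdIso.initialJumps H initialJumps_rat2_concat_rat)
  fin_cases g <;> fin_cases h
  · rfl
  · exact absurd H h01
  · exact absurd H.symm h01
  · rfl

theorem countableQ_tripleE (i : Fin 3) : countableQ (tripleE.{u} i) := by
  obtain ⟨P, _, hP⟩ := tripleE_ordIso.{u} i
  exact hP.symm.countableQ (countableQ_concat_rat (hP.classQ (classQ_tripleE i)))

theorem countableQ_pairZ2 (g : ZMod 2) : countableQ (pairZ2.{u} g) := by
  obtain ⟨P, _, hP⟩ := pairZ2_ordIso.{u} g
  exact hP.symm.countableQ (countableQ_concat_rat (hP.classQ (classQ_pairZ2 g)))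

theorem exists_isGoodOn_tripleE :
    ∃ S : LinSum.{u}, S.IsGoodOn countableQ ∧ S.HasTable tripleE tableE := by
  refine exists_isGoodOn_hasTable tripleE tableE countableQ_tripleE tripleE_injective (fun i h => ?_)
    splits_tripleE (by decide) (by decide)
  obtain ⟨P, -, hP⟩ := tripleE_ordIso.{u} i
  exact not_cofinalJumps_concat_rat P (hP.cofinalJumps h)

theorem exists_isGoodOn_pairZ2 :
    ∃ S : LinSum.{u}, S.IsGoodOn countableQ ∧ S.HasTable pairZ2 (fun g h => g + h) := by
  refine exists_isGoodOn_hasTable pairZ2 (fun g h => g + h) countableQ_pairZ2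
    pairZ2_injective (fun i h => ?_) splits_pairZ2 add_comm (fun i j k => (add_assoc i j k).symm)
  obtain ⟨P, -, hP⟩ := pairZ2_ordIso.{u} i
  exact not_cofinalJumps_concat_rat P (hP.cofinalJumps h)

/-! ### Longest initial segments -/

/-- The longest initial segment of `L` that belongs to `𝒬`. -/
noncomputable abbrev qPart (L : LinOrd.{u}) : LowerSet L := longestInitial classQ L

theorem le_qPart {L : LinOrd.{u}} {I : LowerSet L} (h : classQ (LinOrd.of I)) : I ≤ qPart L :=
  le_sSup h

theorem mem_longestInitial {C : LinOrd.{u} → Prop} {L : LinOrd.{u}} {a : L} :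
    a ∈ longestInitial C L ↔ ∃ I : LowerSet L, C (LinOrd.of I) ∧ a ∈ I :=
  LowerSet.mem_sSup_iff

/-- Well-order the initial segments in 𝒬 and send each point to the first one containing it. A
segment containing `y` contains everything below `y`, so this map is monotone, and each fibre is a
final segment of a member of 𝒬. -/
theorem classQ_qPart (L : LinOrd.{u}) : classQ (LinOrd.of (qPart L)) := by
  let S := {I : LowerSet L // classQ (LinOrd.of I)}
  let c : S → Cardinal := embeddingToCardinal
  let s : L → Set Cardinal := fun x => {κ | ∃ I : S, c I = κ ∧ x ∈ I.1}
  have hne : ∀ x : qPart L, (s x.1).Nonempty := by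
    rintro ⟨x, hx⟩
    obtain ⟨I, hI, hx⟩ := mem_longestInitial.1 hx
    exact ⟨c ⟨I, hI⟩, ⟨I, hI⟩, rfl, hx⟩
  let f : LinOrd.of (qPart L) → Cardinal := fun x => sInf (s x.1)
  have hf : Monotone f := by
    intro x y hxy
    refine csInf_le' ?_
    obtain ⟨I, hI, hy⟩ := csInf_mem (hne y)
    exact ⟨I, hI, I.1.lower hxy hy⟩
  refine classQ_of_fiber f hf (Set.IsWF.of_wellFoundedLT _) fun κ => ?_
  rcases isEmpty_or_nonempty {x // f x = κ} with h | ⟨⟨x, rfl⟩⟩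
  · exact @classQ_of_isEmpty (LinOrd.of _) h
  obtain ⟨I, hI, hx⟩ := csInf_mem (hne x)
  have hIq : ∀ y ∈ I.1, y ∈ qPart L := fun y hy => le_qPart I.2 hy
  have hmem : ∀ y, f y = f x → y.1 ∈ I.1 := by
    intro y hy
    obtain ⟨J, hJ, hyJ⟩ := csInf_mem (hne y)
    have : J = I := embeddingToCardinal.injective (hJ.trans (hy.trans hI.symm))
    rwa [← this]
  let t : Set (LinOrd.of I.1) := {y | f ⟨y.1, hIq _ y.2⟩ = f x}
  have ht : IsUpperSet t := by
    intro y z hyz hy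
    refine le_antisymm (csInf_le' ⟨I, hI, z.2⟩) ?_
    rw [← show f ⟨y.1, hIq _ y.2⟩ = f x from hy]
    exact hf hyz
  refine OrdIso.classQ ⟨StrictMono.orderIsoOfSurjective
    (fun y : t => (⟨⟨y.1.1, hIq _ y.1.2⟩, y.2⟩ : {y // f y = f x})) (fun _ _ h => h) ?_⟩
    (classQ_upper I.2 t ht)
  rintro ⟨y, hy⟩
  exact ⟨⟨⟨y.1, hmem y hy⟩, hy⟩, rfl⟩

/-! ### Cardinalities of final segments -/

theorem classQ.aleph0_le_Ici {L : LinOrd.{u}} (h : classQ L) (a : L) : ℵ₀ ≤ #(Set.Ici a) := by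
  have : NoMaxOrder (Set.Ici a) := ⟨fun x => by
    obtain ⟨u, v, h1, h2, -⟩ := h.hasCuts x.1
    exact ⟨⟨v, x.2.trans (h1.trans h2.le)⟩, h1.trans_lt h2⟩⟩
  have : Nonempty (Set.Ici a) := ⟨⟨a, le_rfl⟩⟩
  exact Cardinal.aleph0_le_mk _

theorem classQ_subset_lexSum {ι : Type u} [LinearOrder ι] [WellFoundedLT ι] {A : ι → LinOrd.{u}}
    (s : Set (lexSum ι A)) (h : ∀ i, classQ (LinOrd.of {a : A i // (toLex ⟨i, a⟩ : Σₗ i, A i) ∈ s})) :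
    classQ (LinOrd.of s) := by
  refine classQ_of_fiber (L := LinOrd.of s) (fun y => (ofLex y.1).1)
    (fun y z hyz => sigmaLex_fst_mono (A := fun i => A i) hyz) (Set.IsWF.of_wellFoundedLT _) fun j => ?_
  refine OrdIso.classQ ⟨StrictMono.orderIsoOfSurjective
    (fun a : {a : A j // (toLex ⟨j, a⟩ : Σₗ i, A i) ∈ s} =>
      (⟨⟨toLex ⟨j, a.1⟩, a.2⟩, rfl⟩ : {y : s // (ofLex y.1).1 = j}))
    (fun a b hab => (sigmaLex_mk_lt_iff (A := fun i => A i)).2 (Subtype.coe_lt_coe.2 hab)) ?_⟩ (h j)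
  rintro ⟨⟨⟨k, a⟩, hk⟩, h⟩
  obtain rfl : k = j := h
  exact ⟨⟨a, hk⟩, rfl⟩

/-- The points with at least `κ` points above them form an order in `𝒬`, and there are fewer than
`κ` other points. -/
def TailSplit (κ : Cardinal.{u}) (L : LinOrd.{u}) : Prop :=
  classQ (LinOrd.of {a : L // κ ≤ #(Set.Ici a)}) ∧ #{a : L // ¬ κ ≤ #(Set.Ici a)} < κ

theorem mk_Ici_orderIso {A B : Type u} [LinearOrder A] [LinearOrder B] (e : A ≃o B) (a : A) :
    #(Set.Ici (e a)) = #(Set.Ici a) :=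
  Cardinal.mk_congr (e.toEquiv.subtypeEquiv fun b => (e.le_iff_le (x := a) (y := b)).symm).symm

theorem OrdIso.tailSplit {κ : Cardinal.{u}} {A B : LinOrd.{u}} (h : OrdIso A B)
    (hA : TailSplit κ A) : TailSplit κ B := by
  obtain ⟨e⟩ := h
  have he : ∀ a : A, κ ≤ #(Set.Ici a) ↔ κ ≤ #(Set.Ici (e a)) := fun a => by rw [mk_Ici_orderIso e]
  refine ⟨(OrdIso.subtype e he).classQ hA.1, ?_⟩
  rw [← Cardinal.mk_congr (e.toEquiv.subtypeEquiv fun a => not_congr (he a))]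
  exact hA.2

theorem TailSplit.right {κ : Cardinal.{u}} {A B : LinOrd.{u}} (h : TailSplit κ (concat A B)) :
    TailSplit κ B := by
  let j : B → concat A B := fun b => toLex (Sum.inr b)
  have hj : ∀ b : B, #(Set.Ici (j b)) = #(Set.Ici b) := by
    intro b
    refine (Cardinal.mk_congr (Equiv.ofBijective
      (fun x : Set.Ici b => (⟨j x.1, Sum.Lex.inr_le_inr_iff.2 x.2⟩ : Set.Ici (j b))) ⟨?_, ?_⟩)).symm
    · intro x y hxy
      exact Subtype.ext (Sum.inr_injective (toLex.injective (congrArg Subtype.val hxy)))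
    · rintro ⟨x, hx⟩
      obtain ⟨x, rfl⟩ := toLex.surjective x
      rcases x with x | x
      · exact absurd hx Sum.Lex.not_inr_le_inl
      · exact ⟨⟨x, Sum.Lex.inr_le_inr_iff.1 hx⟩, rfl⟩
  constructor
  · let s : Set (LinOrd.of {a : concat A B // κ ≤ #(Set.Ici a)}) := {a | ∃ b, j b ≤ a.1}
    have hs : IsUpperSet s := fun x y hxy ⟨b, hb⟩ => ⟨b, hb.trans hxy⟩
    refine OrdIso.classQ (OrdIso.symm ⟨StrictMono.orderIsoOfSurjective
      (fun b : {b : B // κ ≤ #(Set.Ici b)} => (⟨⟨j b.1, by rw [hj]; exact b.2⟩, b.1, le_rfl⟩ : s))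
      (fun b b' hb => Sum.Lex.inr_lt_inr_iff.2 (Subtype.coe_lt_coe.2 hb)) ?_⟩)
      (classQ_upper h.1 s hs)
    rintro ⟨⟨x, hx⟩, b, hb⟩
    obtain ⟨x, rfl⟩ := toLex.surjective x
    rcases x with x | x
    · exact absurd hb Sum.Lex.not_inr_le_inl
    · exact ⟨⟨x, by rwa [← hj]⟩, rfl⟩
  · refine lt_of_le_of_lt (Cardinal.mk_le_of_injective
      (f := fun b : {b : B // ¬ κ ≤ #(Set.Ici b)} =>
        (⟨j b.1, by rw [hj]; exact b.2⟩ : {a : concat A B // ¬ κ ≤ #(Set.Ici a)})) ?_) h.2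
    intro x y hxy
    exact Subtype.ext (Sum.inr_injective (toLex.injective (congrArg Subtype.val hxy)))

/-- Let `i₀` be the first index after which fewer than κ points remain. All points of earlier
summands have large tails and no later ones do; in the summand `i₀` the tail inside that summand
decides, since adding fewer than κ points to fewer than κ cannot reach an infinite κ. Without such
an index all tails are large. -/
theorem TailSplit.lexSum {κ : Cardinal.{u}} (hκ : ℵ₀ ≤ κ) {ι : Type u} [LinearOrder ι]
    [WellFoundedLT ι] {A : ι → LinOrd.{u}} (hQ : ∀ i, classQ (A i)) (h : ∀ i, TailSplit κ (A i)) :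
    TailSplit κ (_root_.lexSum ι A) := by
  let p : ∀ i, A i → _root_.lexSum ι A := fun i a => (toLex ⟨i, a⟩ : Σₗ i, A i)
  let T : ι → Set (_root_.lexSum ι A) := fun i => {x | i < (ofLex x).1}
  have hTle : ∀ (i : ι) (x : _root_.lexSum ι A), (ofLex x).1 ≤ i → #(T i) ≤ #(Set.Ici x) := fun i x hx =>
    Cardinal.mk_le_mk_of_subset fun y hy =>
      (sigmaLex_mk_lt (A := fun i => A i) (hx.trans_lt hy) (ofLex x).2 (ofLex y).2).le
  have hTge : ∀ (i : ι) (x : _root_.lexSum ι A), i < (ofLex x).1 → #(Set.Ici x) ≤ #(T i) := fun i x hx =>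
    Cardinal.mk_le_mk_of_subset fun y hy =>
      hx.trans_le (sigmaLex_fst_mono (A := fun i => A i) hy)
  by_cases hex : ∃ i, #(T i) < κ
  · let i₀ := wellFounded_lt.min {i | #(T i) < κ} hex
    have hi₀ : #(T i₀) < κ := wellFounded_lt.min_mem {i | #(T i) < κ} hex
    have hlt : ∀ j < i₀, κ ≤ #(T j) := fun j hj =>
      not_lt.1 fun h' => wellFounded_lt.not_lt_min {i | #(T i) < κ} h' hj
    have h₁ : ∀ j < i₀, ∀ a : A j, κ ≤ #(Set.Ici (p j a)) := fun j hj a =>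
      (hlt j hj).trans (hTle j (p j a) (le_refl j))
    have h₂ : ∀ j, i₀ < j → ∀ a : A j, ¬ κ ≤ #(Set.Ici (p j a)) :=
      fun j hj a => not_le.2 ((hTge i₀ (p j a) hj).trans_lt hi₀)
    have h₃ : ∀ a : A i₀, κ ≤ #(Set.Ici a) ↔ κ ≤ #(Set.Ici (p i₀ a)) := by
      intro a
      constructor
      · intro ha
        refine ha.trans (Cardinal.mk_le_of_injective (f := fun b : Set.Ici a =>
          (⟨p i₀ b.1, (sigmaLex_mk_le_iff (A := fun i => A i)).2 b.2⟩ :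
            Set.Ici (p i₀ a))) ?_)
        intro b c hbc
        exact Subtype.ext (eq_of_heq (Sigma.mk.inj (toLex.injective (congrArg Subtype.val hbc))).2)
      · intro ha
        by_contra hlt'
        have hsub : Set.Ici (p i₀ a) ⊆
            (fun b : A i₀ => (p i₀ b)) '' Set.Ici a ∪ T i₀ := by
          rintro ⟨j, b⟩ hb
          rcases (sigmaLex_fst_mono (A := fun i => A i) hb : i₀ ≤ j).eq_or_lt with hj | hj
          · subst hj
            exact Or.inl ⟨b, (sigmaLex_mk_le_iff (A := fun i => A i)).1 hb, rfl⟩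
          · exact Or.inr hj
        exact (((Cardinal.mk_le_mk_of_subset hsub).trans (Cardinal.mk_union_le _ _)).trans_lt
          (Cardinal.add_lt_of_lt hκ (Cardinal.mk_image_le.trans_lt (not_le.1 hlt')) hi₀)).not_ge ha
    constructor
    · refine classQ_subset_lexSum {a : _root_.lexSum ι A | κ ≤ #(Set.Ici a)} fun j => ?_
      rcases lt_trichotomy j i₀ with hj | rfl | hj
      · refine OrdIso.classQ ⟨StrictMono.orderIsoOfSurjective
          (fun a : A j => (⟨a, h₁ j hj a⟩ : {a : A j // (p j a) ∈
            {a : _root_.lexSum ι A | κ ≤ #(Set.Ici a)}})) (fun _ _ h => h) fun a => ⟨a.1, rfl⟩⟩ (hQ j)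
      · exact (OrdIso.subtype (OrderIso.refl _) h₃).classQ (h _).1
      · have : IsEmpty {a : A j // (p j a) ∈
            {a : _root_.lexSum ι A | κ ≤ #(Set.Ici a)}} := ⟨fun a => h₂ j hj a.1 a.2⟩
        exact @classQ_of_isEmpty (LinOrd.of _) this
    · have hsub : {a : _root_.lexSum ι A | ¬ κ ≤ #(Set.Ici a)} ⊆
          (fun b : A i₀ => (p i₀ b)) '' {a | ¬ κ ≤ #(Set.Ici a)} ∪ T i₀ := by
        rintro ⟨j, b⟩ hb
        rcases lt_trichotomy j i₀ with hj | hj | hj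
        · exact absurd (h₁ j hj b) hb
        · subst hj
          exact Or.inl ⟨b, fun h' => hb ((h₃ b).1 h'), rfl⟩
        · exact Or.inr hj
      exact ((Cardinal.mk_le_mk_of_subset hsub).trans (Cardinal.mk_union_le _ _)).trans_lt
        (Cardinal.add_lt_of_lt hκ (Cardinal.mk_image_le.trans_lt (h i₀).2) hi₀)
  · push Not at hex
    have hall : ∀ a : _root_.lexSum ι A, κ ≤ #(Set.Ici a) := fun a =>
      (hex (ofLex a).1).trans (hTle _ a le_rfl)
    constructor
    · refine OrdIso.classQ ⟨StrictMono.orderIsoOfSurjective (fun a : _root_.lexSum ι A =>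
        (⟨a, hall a⟩ : {a : _root_.lexSum ι A // κ ≤ #(Set.Ici a)})) (fun _ _ h => h)
        fun a => ⟨a.1, rfl⟩⟩ (classQ_lexSum hQ)
    · have : IsEmpty {a : _root_.lexSum ι A // ¬ κ ≤ #(Set.Ici a)} := ⟨fun a => a.2 (hall a.1)⟩
      rw [Cardinal.mk_eq_zero]
      exact Cardinal.aleph0_pos.trans_le hκ

theorem tailSplit_of_countable {κ : Cardinal.{u}} (hκ : ℵ₀ ≤ κ) {L : LinOrd.{u}} [Countable L]
    (h : classQ L) : TailSplit κ L := by
  rcases hκ.eq_or_lt with rfl | hκ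
  · have hall := h.aleph0_le_Ici
    constructor
    · refine OrdIso.classQ ⟨StrictMono.orderIsoOfSurjective (fun a : L =>
        (⟨a, hall a⟩ : {a : L // ℵ₀ ≤ #(Set.Ici a)})) (fun _ _ h => h)
        fun a => ⟨a.1, rfl⟩⟩ h
    · have : IsEmpty {a : L // ¬ ℵ₀ ≤ #(Set.Ici a)} := ⟨fun a => a.2 (hall a.1)⟩
      rw [Cardinal.mk_eq_zero]
      exact Cardinal.aleph0_pos
  · have hall : ∀ s : Set L, #s < κ := fun s => Cardinal.mk_le_aleph0.trans_lt hκ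
    constructor
    · have : IsEmpty {a : L // κ ≤ #(Set.Ici a)} := ⟨fun a => (hall _).not_ge a.2⟩
      exact @classQ_of_isEmpty (LinOrd.of _) this
    · exact hall _

theorem classQ.tailSplit {κ : Cardinal.{u}} (hκ : ℵ₀ ≤ κ) {L : LinOrd.{u}} (h : classQ L) :
    TailSplit κ L := by
  refine (h (fun L => classQ L ∧ TailSplit κ L) ⟨?_, ?_, ?_⟩ ?_).2
  · exact fun A B h hA => ⟨h.classQ hA.1, h.tailSplit hA.2⟩
  · exact fun A B h => ⟨isLeftSGC_classQ.right_mem A B h.1, h.2.right⟩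
  · exact fun ι _ _ A h => ⟨classQ_lexSum fun i => (h i).1,
      TailSplit.lexSum hκ (fun i => (h i).1) fun i => (h i).2⟩
  · rintro X (rfl | rfl | rfl)
    · exact ⟨classQ_rat, tailSplit_of_countable hκ classQ_rat⟩
    · exact ⟨classQ_rat12_concat_rat, tailSplit_of_countable hκ classQ_rat12_concat_rat⟩
    · exact ⟨classQ_rat2_concat_rat, tailSplit_of_countable hκ classQ_rat2_concat_rat⟩

/-! ### Layers -/

/-- The number of points above `a` in the longest initial segment of `L` in `𝒬`. -/
noncomputable def tailCard (L : LinOrd.{u}) (a : L) : Cardinal.{u} :=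
  #{y : L // y ∈ qPart L ∧ a ≤ y}

theorem mk_Ici_qPart {L : LinOrd.{u}} (a : LinOrd.of (qPart L)) :
    #(Set.Ici a) = tailCard L a.1 :=
  Cardinal.mk_congr
    { toFun := fun y => ⟨y.1.1, y.1.2, y.2⟩
      invFun := fun y => ⟨⟨y.1, y.2.1⟩, y.2.2⟩
      left_inv := fun _ => rfl
      right_inv := fun _ => rfl }

theorem tailCard_anti {L : LinOrd.{u}} {a b : L} (h : a ≤ b) : tailCard L b ≤ tailCard L a :=
  Cardinal.mk_subtype_mono fun _ hy => ⟨hy.1, h.trans hy.2⟩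

theorem aleph0_le_tailCard {L : LinOrd.{u}} {a : L} (h : a ∈ qPart L) : ℵ₀ ≤ tailCard L a := by
  rw [← mk_Ici_qPart ⟨a, h⟩]
  exact (classQ_qPart L).aleph0_le_Ici _

theorem exists_tailCard_eq {L : LinOrd.{u}} {a : L} (h : a ∈ qPart L) :
    ∃ α : Ordinal.{u}, tailCard L a = ℵ_ α := by
  obtain ⟨α, hα⟩ := Cardinal.mem_range_aleph_iff.2 (aleph0_le_tailCard h)
  exact ⟨α, hα.symm⟩

theorem classQ_le_tailCard (L : LinOrd.{u}) {κ : Cardinal.{u}} (hκ : ℵ₀ ≤ κ) :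
    classQ (LinOrd.of {a : L // a ∈ qPart L ∧ κ ≤ tailCard L a}) := by
  refine OrdIso.classQ ⟨StrictMono.orderIsoOfSurjective
    (fun a : {a : LinOrd.of (qPart L) // κ ≤ #(Set.Ici a)} =>
      (⟨a.1.1, a.1.2, by rw [← mk_Ici_qPart]; exact a.2⟩ :
        {a : L // a ∈ qPart L ∧ κ ≤ tailCard L a})) (fun _ _ h => h) ?_⟩
    ((classQ_qPart L).tailSplit hκ).1
  rintro ⟨a, ha, h⟩
  exact ⟨⟨⟨a, ha⟩, by rwa [mk_Ici_qPart]⟩, rfl⟩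

theorem mk_tailCard_lt (L : LinOrd.{u}) {κ : Cardinal.{u}} (hκ : ℵ₀ ≤ κ) :
    #{a : L // a ∈ qPart L ∧ tailCard L a < κ} < κ := by
  refine lt_of_le_of_lt (Cardinal.mk_le_of_injective
    (f := fun a : {a : L // a ∈ qPart L ∧ tailCard L a < κ} =>
      (⟨⟨a.1, a.2.1⟩, by rw [mk_Ici_qPart]; exact not_le.2 a.2.2⟩ :
        {a : LinOrd.of (qPart L) // ¬ κ ≤ #(Set.Ici a)})) ?_) ((classQ_qPart L).tailSplit hκ).2
  intro a b hab
  exact Subtype.ext (congrArg (fun x => x.1.1) hab)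

/-- The points of `qPart L` with tail at least ℵ_α form an order in 𝒬, and removing the others
deletes fewer than ℵ_α points. So the final segments of what remains are still large. -/
theorem mem_longestInitial_cardFiltration {α : Ordinal.{u}} {L : LinOrd.{u}} {a : L} :
    a ∈ longestInitial (cardFiltration classQ α) L ↔ a ∈ qPart L ∧ ℵ_ α ≤ tailCard L a := by
  constructor
  · intro h
    obtain ⟨I, ⟨hI, hF⟩, ha⟩ := mem_longestInitial.1 h
    have hIq := le_qPart hI
    refine ⟨hIq ha, (hF (UpperSet.Ici ⟨a, ha⟩) ⟨⟨a, ha⟩, le_rfl⟩).trans ?_⟩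
    refine Cardinal.mk_le_of_injective (f := fun y : UpperSet.Ici (⟨a, ha⟩ : LinOrd.of I) =>
      (⟨y.1.1, hIq y.1.2, y.2⟩ : {y : L // y ∈ qPart L ∧ a ≤ y})) ?_
    intro x y hxy
    exact Subtype.ext (Subtype.ext (congrArg (fun z => z.1) hxy))
  · rintro ⟨h1, h2⟩
    have hα := Cardinal.aleph0_le_aleph α
    let I : LowerSet L := ⟨{a | a ∈ qPart L ∧ ℵ_ α ≤ tailCard L a}, fun x y hxy hx =>
      ⟨(qPart L).lower hxy hx.1, hx.2.trans (tailCard_anti hxy)⟩⟩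
    refine mem_longestInitial.2 ⟨I, ⟨classQ_le_tailCard L hα, ?_⟩, h1, h2⟩
    rintro F ⟨b, hb⟩
    by_contra hlt
    have hsub : {y : L | y ∈ qPart L ∧ b.1 ≤ y} ⊆
        (fun y : LinOrd.of I => y.1) '' (F : Set (LinOrd.of I)) ∪
          {y : L | y ∈ qPart L ∧ tailCard L y < ℵ_ α} := by
      rintro y ⟨hy, hby⟩
      rcases le_or_gt (ℵ_ α) (tailCard L y) with h | h
      · exact Or.inl ⟨⟨y, hy, h⟩, F.upper hby hb, rfl⟩
      · exact Or.inr ⟨hy, h⟩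
    exact (((Cardinal.mk_le_mk_of_subset hsub).trans (Cardinal.mk_union_le _ _)).trans_lt
      (Cardinal.add_lt_of_lt hα (Cardinal.mk_image_le.trans_lt (not_le.1 hlt))
        (mk_tailCard_lt L hα))).not_ge b.2.2

/-- The set underlying the layer of index `α` of `L` in the cardinality filtration of `𝒬`. -/
abbrev layerSet (α : Ordinal.{u}) (L : LinOrd.{u}) : Set L :=
  (longestInitial (cardFiltration classQ α) L : Set L) \
    longestInitial (cardFiltration classQ (α + 1)) L

theorem mem_layerSet {α : Ordinal.{u}} {L : LinOrd.{u}} {a : L} :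
    a ∈ layerSet α L ↔ a ∈ qPart L ∧ tailCard L a = ℵ_ α := by
  rw [Set.mem_sdiff, SetLike.mem_coe, SetLike.mem_coe, mem_longestInitial_cardFiltration,
    mem_longestInitial_cardFiltration, ← Cardinal.succ_aleph, Order.succ_le_iff]
  constructor
  · rintro ⟨⟨h1, h2⟩, h3⟩
    exact ⟨h1, le_antisymm (not_lt.1 fun h => h3 ⟨h1, h⟩) h2⟩
  · rintro ⟨h1, h2⟩
    exact ⟨⟨h1, h2.ge⟩, fun h => h.2.ne' h2⟩

theorem mem_remainderSet {L : LinOrd.{u}} {a : L} :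
    a ∈ (longestInitial (cardFiltration classQ 0) L : Set L)ᶜ ↔ a ∉ qPart L := by
  rw [Set.mem_compl_iff, SetLike.mem_coe, mem_longestInitial_cardFiltration, Cardinal.aleph_zero]
  exact ⟨fun h h' => h ⟨h', aleph0_le_tailCard h'⟩, fun h h' => h h'.1⟩

theorem classQ_layer (α : Ordinal.{u}) (L : LinOrd.{u}) :
    classQ (layer (cardFiltration classQ) α L) := by
  have h := classQ_le_tailCard L (Cardinal.aleph0_le_aleph α)
  let s : Set (LinOrd.of {a : L // a ∈ qPart L ∧ ℵ_ α ≤ tailCard L a}) :=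
    {a | tailCard L a.1 = ℵ_ α}
  have hs : IsUpperSet s := fun a b hab ha => 
    le_antisymm ((tailCard_anti (Subtype.coe_le_coe.2 hab)).trans (le_of_eq ha)) b.2.2
  refine OrdIso.classQ ⟨StrictMono.orderIsoOfSurjective
    (fun a : s => (⟨a.1.1, mem_layerSet.2 ⟨a.1.2.1, a.2⟩⟩ : layerSet α L)) (fun _ _ h => h) ?_⟩
    (classQ_upper h s hs)
  rintro ⟨a, ha⟩
  obtain ⟨h1, h2⟩ := mem_layerSet.1 ha
  exact ⟨⟨⟨a, h1, h2.ge⟩, h2⟩, rfl⟩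

theorem mk_layer_le (α : Ordinal.{u}) (L : LinOrd.{u}) :
    #(layer (cardFiltration classQ) α L) ≤ ℵ_ α := by
  have h := mk_tailCard_lt L (Cardinal.aleph0_le_aleph (α + 1))
  rw [← Cardinal.succ_aleph, Order.lt_succ_iff] at h
  refine le_trans (Cardinal.mk_le_of_injective (f := fun a : layerSet α L =>
    (⟨a.1, (mem_layerSet.1 a.2).1, ?_⟩ :
      {a : L // a ∈ qPart L ∧ tailCard L a < Order.succ (ℵ_ α)})) ?_) h
  · rw [(mem_layerSet.1 a.2).2]
    exact Order.lt_succ _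
  · intro a b hab
    exact Subtype.ext (congrArg (fun x => x.1) hab)

/-- In the reverse order, the indices of the non-empty layers are well-ordered. -/
theorem isWF_layerIndex (L : LinOrd.{u}) :
    {α : Ordinal.{u}ᵒᵈ | (layerSet (OrderDual.ofDual α) L).Nonempty}.IsWF := by
  rw [Set.isWF_iff_no_descending_seq]
  intro f hf hfm
  choose x hx using hfm
  let κ : Cardinal.{u} := ⨆ n, ℵ_ (OrderDual.ofDual (f n))
  have hbdd : BddAbove (Set.range fun n => ℵ_ (OrderDual.ofDual (f n))) :=
    Cardinal.bddAbove_of_small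
  have hle : ∀ n, ℵ_ (OrderDual.ofDual (f n)) ≤ κ := fun n => le_ciSup hbdd n
  have hlt : ∀ n, ℵ_ (OrderDual.ofDual (f n)) < κ := fun n =>
    lt_of_lt_of_le (Cardinal.aleph_lt_aleph.2 (hf (Nat.lt_succ_self n))) (hle (n + 1))
  have hκ : ℵ₀ ≤ κ := (Cardinal.aleph0_le_aleph _).trans (hle 0)
  -- Infinitely many increasing indices would give tails of sizes with supremum `κ`, all made of
  -- points whose own tails are below `κ`; but there are fewer than `κ` such points.
  refine (mk_tailCard_lt L hκ).not_ge (ciSup_le' fun n => ?_)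
  rw [← (mem_layerSet.1 (hx n)).2]
  refine Cardinal.mk_subtype_mono fun y hy => ⟨hy.1, (tailCard_anti hy.2).trans_lt ?_⟩
  rw [(mem_layerSet.1 (hx n)).2]
  exact hlt n

/-! ### Existence of sifted sums -/

theorem LinSum.mem_range (S : LinSum.{u}) {A B : LinOrd.{u}} (x : S.op A B) :
    (∃ a, S.inl A B a = x) ∨ ∃ b, S.inr A B b = x :=
  codisjoint_iff_le_sup.1 (S.isCompl_range A B).codisjoint (Set.mem_univ x)

theorem LinSum.inl_ne_inr (S : LinSum.{u}) {A B : LinOrd.{u}} (a : A) (b : B) :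
    S.inl A B a ≠ S.inr A B b :=
  fun h => Set.disjoint_left.1 (S.isCompl_range A B).disjoint ⟨a, rfl⟩ ⟨b, h.symm⟩

/-- The points of `A ⊕ B` are those of the disjoint union of `A` and `B`. -/
noncomputable def LinSum.sumEquiv (S : LinSum.{u}) (A B : LinOrd.{u}) : A ⊕ B ≃ S.op A B :=
  Equiv.ofBijective (Sum.elim (S.inl A B) (S.inr A B)) <| by
    constructor
    · exact (S.inl A B).injective.sumElim (S.inr A B).injective S.inl_ne_inr
    · intro x
      rcases S.mem_range x with ⟨a, ha⟩ | ⟨b, hb⟩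
      · exact ⟨Sum.inl a, ha⟩
      · exact ⟨Sum.inr b, hb⟩

theorem layerSet_index_unique {L : LinOrd.{u}} {α β : Ordinal.{u}} {a : L}
    (h : a ∈ layerSet α L) (h' : a ∈ layerSet β L) : α = β :=
  Cardinal.aleph.injective ((mem_layerSet.1 h).2.symm.trans (mem_layerSet.1 h').2)

theorem exists_mem_layerSet {L : LinOrd.{u}} {a : L} (h : a ∈ qPart L) :
    ∃ α, a ∈ layerSet α L :=
  (exists_tailCard_eq h).imp fun _ hα => mem_layerSet.2 ⟨h, hα⟩

/-- A linear order is the disjoint union of its layers and its remainder. -/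
theorem bijective_layer_remainder (L : LinOrd.{u}) :
    Function.Bijective (Sum.elim
      (fun x : Σ α : Ordinal.{u}ᵒᵈ, layer (cardFiltration classQ) (OrderDual.ofDual α) L => x.2.1)
      (fun x : remainder (cardFiltration classQ) L => x.1) : _ → L) := by
  constructor
  · refine Function.Injective.sumElim ?_ Subtype.val_injective ?_
    · rintro ⟨α, a, ha⟩ ⟨β, b, hb⟩ h
      obtain rfl : a = b := h
      obtain rfl : α = β := layerSet_index_unique ha hb
      rfl
    · rintro ⟨α, a, ha⟩ ⟨b, hb⟩ h
      obtain rfl : a = b := h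
      exact mem_remainderSet.1 hb (mem_layerSet.1 ha).1
  · intro a
    by_cases h : a ∈ qPart L
    · obtain ⟨α, hα⟩ := exists_mem_layerSet h
      exact ⟨Sum.inl ⟨OrderDual.toDual α, a, hα⟩, rfl⟩
    · exact ⟨Sum.inr ⟨a, mem_remainderSet.2 h⟩, rfl⟩

/-- The embedding of a linear order into a sum over its layers and the remainder. -/
theorem strictMono_of_layers {L : LinOrd.{u}} {Z : Type*} [LinearOrder Z]
    {M : Ordinal.{u}ᵒᵈ → Type*} [∀ α, LinearOrder (M α)] (f : L → (Σₗ α, M α) ⊕ₗ Z)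
    (i : ∀ α : Ordinal.{u}, layer (cardFiltration classQ) α L → M (OrderDual.toDual α))
    (hi : ∀ α, StrictMono (i α)) (r : remainder (cardFiltration classQ) L → Z) (hr : StrictMono r)
    (hf : ∀ (α : Ordinal.{u}) (a : layer (cardFiltration classQ) α L), f a.1 =
      toLex (Sum.inl (toLex ⟨OrderDual.toDual α, i α a⟩)))
    (hf' : ∀ a : remainder (cardFiltration classQ) L, f a.1 = toLex (Sum.inr (r a))) :
    StrictMono f := by
  intro a b hab
  by_cases hb : b ∈ qPart L
  · have ha : a ∈ qPart L := (qPart L).lower hab.le hb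
    obtain ⟨α, hα⟩ := exists_mem_layerSet ha
    obtain ⟨β, hβ⟩ := exists_mem_layerSet hb
    rw [hf α ⟨a, hα⟩, hf β ⟨b, hβ⟩, Sum.Lex.inl_lt_inl_iff]
    have h : β ≤ α := by
      rw [← Cardinal.aleph_le_aleph, ← (mem_layerSet.1 hα).2, ← (mem_layerSet.1 hβ).2]
      exact tailCard_anti hab.le
    rcases h.eq_or_lt with rfl | h
    · exact (sigmaLex_mk_lt_iff (A := M)).2 (hi β hab)
    · exact sigmaLex_mk_lt (A := M) (OrderDual.toDual_lt_toDual.2 h) _ _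
  · rw [hf' ⟨b, mem_remainderSet.2 hb⟩]
    by_cases ha : a ∈ qPart L
    · obtain ⟨α, hα⟩ := exists_mem_layerSet ha
      rw [hf α ⟨a, hα⟩]
      exact Sum.Lex.inl_lt_inr _ _
    · rw [hf' ⟨a, mem_remainderSet.2 ha⟩]
      exact Sum.Lex.inr_lt_inr_iff.2 (hr hab)

/-- Brings the sifted order down one universe: its points correspond to those of A ⊕ B, which
carries the pulled-back order. -/
theorem exists_linOrd_equiv {X : Type u} {Z : Type*} [LinearOrder Z] (e : X ≃ Z) :
    ∃ (T : LinOrd.{u}) (k : T ≃o Z) (i : X ≃ T), ∀ x, k (i x) = e x :=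
  letI := LinearOrder.lift' e e.injective
  ⟨LinOrd.of X, { e with map_rel_iff' := Iff.rfl }, Equiv.refl X, fun _ => rfl⟩

theorem exists_isSiftedSum (S : Ordinal.{u} → LinSum.{u}) :
    ∃ T : LinSum.{u}, IsSiftedSum (cardFiltration classQ) S T := by
  have key : ∀ A B : LinOrd.{u}, ∃ (T : LinOrd.{u}) (f : A ↪o T) (g : B ↪o T)
      (_ : IsCompl (Set.range f) (Set.range g))
      (e : T ≃o SiftedOrder (cardFiltration classQ) S A B),
      (∀ (α : Ordinal.{u}) (a : layer (cardFiltration classQ) α A), e (f a.1) =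
        toLex (Sum.inl (toLex ⟨OrderDual.toDual α, (S α).inl _ _ a⟩))) ∧
      (∀ (α : Ordinal.{u}) (b : layer (cardFiltration classQ) α B), e (g b.1) =
        toLex (Sum.inl (toLex ⟨OrderDual.toDual α, (S α).inr _ _ b⟩))) ∧
      (∀ a : remainder (cardFiltration classQ) A, e (f a.1) =
        toLex (Sum.inr (toLex (Sum.inl a)))) ∧
      (∀ b : remainder (cardFiltration classQ) B, e (g b.1) =
        toLex (Sum.inr (toLex (Sum.inr b)))) := by
    intro A B
    let lay : Ordinal.{u}ᵒᵈ → LinOrd.{u} → LinOrd.{u} := fun α L =>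
      layer (cardFiltration classQ) (OrderDual.ofDual α) L
    let kA := Equiv.ofBijective _ (bijective_layer_remainder A)
    let kB := Equiv.ofBijective _ (bijective_layer_remainder B)
    let h : ((Σ α : Ordinal.{u}ᵒᵈ, lay α A ⊕ lay α B) ⊕
        (remainder (cardFiltration classQ) A ⊕ remainder (cardFiltration classQ) B)) ≃
        SiftedOrder (cardFiltration classQ) S A B :=
      (Equiv.sumCongr ((Equiv.sigmaCongrRight fun α =>
        (S (OrderDual.ofDual α)).sumEquiv (lay α A) (lay α B)).trans toLex) toLex).trans toLex
    let e : A ⊕ B ≃ SiftedOrder (cardFiltration classQ) S A B :=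
      (Equiv.sumCongr kA.symm kB.symm).trans ((Equiv.sumSumSumComm _ _ _ _).trans
        ((Equiv.sumCongr (Equiv.sigmaSumDistrib _ _).symm (Equiv.refl _)).trans h))
    have h₁ : ∀ (α : Ordinal.{u}) (a : layer (cardFiltration classQ) α A), e (Sum.inl a.1) =
        toLex (Sum.inl (toLex ⟨OrderDual.toDual α, (S α).inl _ _ a⟩)) := by
      intro α a
      have : kA.symm a.1 = Sum.inl ⟨OrderDual.toDual α, a⟩ := (Equiv.symm_apply_eq _).2 rfl
      simp only [e, Equiv.trans_apply, Equiv.sumCongr_apply, Sum.map_inl, this]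
      rfl
    have h₂ : ∀ (α : Ordinal.{u}) (b : layer (cardFiltration classQ) α B), e (Sum.inr b.1) =
        toLex (Sum.inl (toLex ⟨OrderDual.toDual α, (S α).inr _ _ b⟩)) := by
      intro α b
      have : kB.symm b.1 = Sum.inl ⟨OrderDual.toDual α, b⟩ := (Equiv.symm_apply_eq _).2 rfl
      simp only [e, Equiv.trans_apply, Equiv.sumCongr_apply, Sum.map_inr, this]
      rfl
    have h₃ : ∀ a : remainder (cardFiltration classQ) A, e (Sum.inl a.1) =
        toLex (Sum.inr (toLex (Sum.inl a))) := by
      intro a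
      have : kA.symm a.1 = Sum.inr a := (Equiv.symm_apply_eq _).2 rfl
      simp only [e, Equiv.trans_apply, Equiv.sumCongr_apply, Sum.map_inl, this]
      rfl
    have h₄ : ∀ b : remainder (cardFiltration classQ) B, e (Sum.inr b.1) =
        toLex (Sum.inr (toLex (Sum.inr b))) := by
      intro b
      have : kB.symm b.1 = Sum.inr b := (Equiv.symm_apply_eq _).2 rfl
      simp only [e, Equiv.trans_apply, Equiv.sumCongr_apply, Sum.map_inr, this]
      rfl
    obtain ⟨T, k, i, hk⟩ := exists_linOrd_equiv e
    have hf : StrictMono (fun a : A => e (Sum.inl a)) :=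
      strictMono_of_layers _ (fun α a => (S α).inl _ _ a)
        (fun α => ((S α).inl _ _).strictMono) (fun a => toLex (Sum.inl a))
        (fun _ _ h => Sum.Lex.inl_lt_inl_iff.2 h) h₁ h₃
    have hg : StrictMono (fun b : B => e (Sum.inr b)) :=
      strictMono_of_layers _ (fun α b => (S α).inr _ _ b)
        (fun α => ((S α).inr _ _).strictMono) (fun b => toLex (Sum.inr b))
        (fun _ _ h => Sum.Lex.inr_lt_inr_iff.2 h) h₂ h₄
    have hki : ∀ x y, i x < i y ↔ e x < e y := fun x y => by rw [← hk, ← hk, k.lt_iff_lt]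
    simp only [← hk] at h₁ h₂ h₃ h₄
    refine ⟨T, OrderEmbedding.ofStrictMono (fun a => i (Sum.inl a)) fun _ _ h => (hki _ _).2 (hf h),
      OrderEmbedding.ofStrictMono (fun b => i (Sum.inr b)) fun _ _ h => (hki _ _).2 (hg h),
      ?_, k, h₁, h₂, h₃, h₄⟩
    have := (Set.isCompl_range_inl_range_inr (α := A) (β := B)).preimage i.symm
    rwa [← Equiv.image_eq_preimage_symm, ← Equiv.image_eq_preimage_symm, ← Set.range_comp,
      ← Set.range_comp] at this
  choose op inl inr hc h using key
  exact ⟨⟨op, inl, inr, hc⟩, h⟩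

/-! ### Layers of isomorphic orders -/

theorem mem_qPart_of_orderIso {A B : LinOrd.{u}} (e : A ≃o B) {a : A} (h : a ∈ qPart A) :
    e a ∈ qPart B := by
  obtain ⟨I, hI, ha⟩ := mem_longestInitial.1 h
  let J : LowerSet B := ⟨{b | e.symm b ∈ I}, fun x y hxy hx => I.lower (e.symm.monotone hxy) hx⟩
  refine mem_longestInitial.2 ⟨J, OrdIso.classQ
    (OrdIso.subtype (p := fun a => a ∈ I) (q := fun b => b ∈ J) e fun a => ?_) hI, ?_⟩
  · show a ∈ I ↔ e.symm (e a) ∈ I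
    rw [e.symm_apply_apply]
  · show e.symm (e a) ∈ I
    rwa [e.symm_apply_apply]

theorem mem_qPart_orderIso {A B : LinOrd.{u}} (e : A ≃o B) {a : A} :
    a ∈ qPart A ↔ e a ∈ qPart B := by
  refine ⟨mem_qPart_of_orderIso e, fun h => ?_⟩
  have := mem_qPart_of_orderIso e.symm h
  rwa [e.symm_apply_apply] at this

theorem tailCard_orderIso {A B : LinOrd.{u}} (e : A ≃o B) (a : A) :
    tailCard A a = tailCard B (e a) :=
  Cardinal.mk_congr (e.toEquiv.subtypeEquiv fun y =>
    and_congr (mem_qPart_orderIso e) (e.le_iff_le (x := a) (y := y)).symm)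

theorem OrdIso.layer {A B : LinOrd.{u}} (h : OrdIso A B) (α : Ordinal.{u}) :
    OrdIso (layer (cardFiltration _root_.classQ) α A)
      (_root_.layer (cardFiltration _root_.classQ) α B) := by
  obtain ⟨e⟩ := h
  refine OrdIso.subtype e fun a => ?_
  show a ∈ layerSet α A ↔ e a ∈ layerSet α B
  rw [mem_layerSet, mem_layerSet, ← mem_qPart_orderIso e, tailCard_orderIso e]

theorem OrdIso.remainder {A B : LinOrd.{u}} (h : OrdIso A B) :
    OrdIso (remainder (cardFiltration _root_.classQ) A)
      (_root_.remainder (cardFiltration _root_.classQ) B) := by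
  obtain ⟨e⟩ := h
  refine OrdIso.subtype e fun a => ?_
  exact mem_remainderSet.trans ((not_congr (mem_qPart_orderIso e)).trans mem_remainderSet.symm)

/-! ### Layers of sifted sums -/

theorem nonempty_preimageIso {X Y Z : Type*} [LinearOrder X] [LinearOrder Y] [LinearOrder Z]
    (e : X ≃o Z) (f : Y → Z) (hf : StrictMono f) : Nonempty ({x // e x ∈ Set.range f} ≃o Y) := by
  refine ⟨(StrictMono.orderIsoOfSurjective
    (fun y => (⟨e.symm (f y), y, (e.apply_symm_apply _).symm⟩ : {x // e x ∈ Set.range f}))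
    (fun _ _ h => e.symm.strictMono (hf h)) ?_).symm⟩
  rintro ⟨x, y, hy⟩
  exact ⟨y, Subtype.ext ((congrArg e.symm hy).trans (e.symm_apply_apply x))⟩

theorem strictMono_sigmaLexMk {ι : Type*} [LinearOrder ι] {A : ι → Type*} [∀ i, LinearOrder (A i)]
    (i : ι) : StrictMono (fun a : A i => (toLex ⟨i, a⟩ : Σₗ i, A i)) :=
  fun _ _ h => sigmaLex_mk_lt_iff.2 h

/-- Needed for sums over the reversed ordinals, which are too large and not well-ordered;
well-ordering of the support is enough. -/
theorem classQ_of_orderIso_sigmaLex {X : Type*} [LinearOrder X] {M : X → LinOrd.{u}}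
    (hM : ∀ x, classQ (M x)) (hw : {x | Nonempty (M x)}.IsWF) {L : LinOrd.{u}}
    (e : L ≃o Σₗ x, M x) : classQ L := by
  refine classQ_of_fiber (fun l => (ofLex (e l)).1)
    (fun a b hab => sigmaLex_fst_mono (A := fun x => M x) (e.monotone hab)) (hw.mono ?_) fun x => ?_
  · rintro _ ⟨l, rfl⟩
    exact ⟨(ofLex (e l)).2⟩
  · obtain ⟨k⟩ := nonempty_preimageIso e _ (strictMono_sigmaLexMk (A := fun x => M x) x)
    refine OrdIso.classQ (OrdIso.symm (OrdIso.trans (OrdIso.subtype (OrderIso.refl L) fun l => ?_)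
      ⟨k⟩)) (hM x)
    constructor
    · intro h
      subst h
      exact ⟨_, rfl⟩
    · rintro ⟨a, ha⟩
      show (ofLex (e l)).1 = x
      rw [show e l = _ from ha.symm]
      rfl

/-- If a final segment of `A` that starts with a point outside `qPart A` is embedded as a final
segment of an initial segment `J` of `T` in `𝒬`, it is empty. -/
theorem mem_qPart_of_embedding {A T : LinOrd.{u}} (j : A ↪o T) (J : LowerSet T)
    (hJ : classQ (LinOrd.of J))
    (hU : ∀ y ∈ J, ∀ a, a ∉ qPart A → j a ≤ y → ∃ a, a ∉ qPart A ∧ j a = y)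
    {a : A} (ha : j a ∈ J) : a ∈ qPart A := by
  by_contra hna
  let I : LowerSet A := ⟨{a | j a ∈ J}, fun x y hxy hx => J.lower (j.monotone hxy) hx⟩
  -- If `a` were outside, the preimage of `J` would be `qPart A` followed by a copy of a final
  -- segment of `J`, hence an initial segment in 𝒬 longer than `qPart A`.
  refine hna (le_qPart (I := I) ?_ ha)
  have hIq : ∀ b ∈ qPart A, b ∈ I := fun b hb =>
    I.lower (le_of_lt (not_le.1 fun h => hna ((qPart A).lower h hb))) ha
  refine classQ_of_lower (L := LinOrd.of I) {x | x.1 ∈ qPart A}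
    (fun x y hxy hx => (qPart A).lower (Subtype.coe_le_coe.2 hxy) hx) ?_ ?_
  · refine OrdIso.classQ ⟨StrictMono.orderIsoOfSurjective (fun x : qPart A =>
      (⟨⟨x.1, hIq _ x.2⟩, x.2⟩ : {x : LinOrd.of I | x.1 ∈ qPart A})) (fun _ _ h => h) ?_⟩
      (classQ_qPart A)
    rintro ⟨⟨x, hx⟩, hx'⟩
    exact ⟨⟨x, hx'⟩, rfl⟩
  · let U : Set (LinOrd.of J) := {y | ∃ a, a ∉ qPart A ∧ j a ≤ y.1}
    have h := classQ_upper hJ U fun x y hxy ⟨a, ha, h⟩ => ⟨a, ha, h.trans hxy⟩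
    refine OrdIso.classQ (OrdIso.symm ⟨StrictMono.orderIsoOfSurjective
      (fun x : ↥{x : LinOrd.of I | x.1 ∈ qPart A}ᶜ => (⟨⟨j x.1.1, x.1.2⟩, x.1.1, x.2, le_rfl⟩ : U))
      (fun _ _ h => j.strictMono h) ?_⟩) h
    rintro ⟨⟨y, hy⟩, b, hb, hby⟩
    obtain ⟨a', h', rfl⟩ := hU y hy b hb hby
    exact ⟨⟨⟨a', hy⟩, h'⟩, rfl⟩

/-- The isomorphism of a sifted sum with the sum over the layers and the remainders. -/
structure IsSiftIso (S : Ordinal.{u} → LinSum.{u}) (T : LinSum.{u}) {A B : LinOrd.{u}}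
    (e : T.op A B ≃o SiftedOrder (cardFiltration classQ) S A B) : Prop where
  inl_layer : ∀ (α : Ordinal.{u}) (a : layer (cardFiltration classQ) α A), e (T.inl A B a.1) =
    toLex (Sum.inl (toLex ⟨OrderDual.toDual α, (S α).inl _ _ a⟩))
  inr_layer : ∀ (α : Ordinal.{u}) (b : layer (cardFiltration classQ) α B), e (T.inr A B b.1) =
    toLex (Sum.inl (toLex ⟨OrderDual.toDual α, (S α).inr _ _ b⟩))
  inl_remainder : ∀ a : remainder (cardFiltration classQ) A, e (T.inl A B a.1) =
    toLex (Sum.inr (toLex (Sum.inl a)))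
  inr_remainder : ∀ b : remainder (cardFiltration classQ) B, e (T.inr A B b.1) =
    toLex (Sum.inr (toLex (Sum.inr b)))

theorem IsSiftedSum.exists_isSiftIso {S : Ordinal.{u} → LinSum.{u}} {T : LinSum.{u}}
    (h : IsSiftedSum (cardFiltration classQ) S T) (A B : LinOrd.{u}) :
    ∃ e : T.op A B ≃o SiftedOrder (cardFiltration classQ) S A B, IsSiftIso S T e := by
  obtain ⟨e, h₁, h₂, h₃, h₄⟩ := h A B
  exact ⟨e, h₁, h₂, h₃, h₄⟩

namespace IsSiftIso

variable {S : Ordinal.{u} → LinSum.{u}} {T : LinSum.{u}} {A B : LinOrd.{u}}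
  {e : T.op A B ≃o SiftedOrder (cardFiltration classQ) S A B}

theorem exists_of_layer (h : IsSiftIso S T e) {x : T.op A B} {α : Ordinal.{u}}
    {w : (S α).op (layer (cardFiltration classQ) α A) (layer (cardFiltration classQ) α B)}
    (hx : e x = toLex (Sum.inl (toLex ⟨OrderDual.toDual α, w⟩))) :
    (∃ a ∈ layerSet α A, T.inl A B a = x) ∨ ∃ b ∈ layerSet α B, T.inr A B b = x := by
  rcases (S α).mem_range w with ⟨a, rfl⟩ | ⟨b, rfl⟩
  · exact Or.inl ⟨a.1, a.2, e.injective ((h.inl_layer α a).trans hx.symm)⟩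
  · exact Or.inr ⟨b.1, b.2, e.injective ((h.inr_layer α b).trans hx.symm)⟩

theorem classQ_layers (hS : ∀ α A B, classQ ((S α).op (layer (cardFiltration classQ) α A)
    (layer (cardFiltration classQ) α B))) (e : T.op A B ≃o SiftedOrder (cardFiltration classQ) S A B) :
    classQ (LinOrd.of {x // e x ∈ Set.range fun y => toLex (Sum.inl y)}) := by
  obtain ⟨k⟩ := nonempty_preimageIso e (fun y => toLex (Sum.inl y))
    fun _ _ h => Sum.Lex.inl_lt_inl_iff.2 h
  refine classQ_of_orderIso_sigmaLex (fun α => hS (OrderDual.ofDual α) A B) ?_ k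
  refine ((isWF_layerIndex A).union (isWF_layerIndex B)).mono ?_
  rintro α ⟨w⟩
  rcases (S _).mem_range w with ⟨a, -⟩ | ⟨b, -⟩
  · exact Or.inl ⟨a.1, a.2⟩
  · exact Or.inr ⟨b.1, b.2⟩

theorem mem_qPart_of_layers (hS : ∀ α A B, classQ ((S α).op (layer (cardFiltration classQ) α A)
    (layer (cardFiltration classQ) α B))) {x : T.op A B}
    (hx : e x ∈ Set.range fun y => toLex (Sum.inl y)) : x ∈ qPart (T.op A B) := by
  let I : LowerSet (T.op A B) := ⟨{x | e x ∈ Set.range fun y => toLex (Sum.inl y)}, by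
    rintro x y hxy ⟨z, hz⟩
    have hyz : e y ≤ toLex (Sum.inl z) := (e.monotone hxy).trans hz.ge
    obtain ⟨w, hw⟩ := toLex.surjective (e y)
    rcases w with w | w
    · exact ⟨w, hw⟩
    · rw [← hw] at hyz
      exact absurd hyz Sum.Lex.not_inr_le_inl⟩
  exact le_qPart (I := I) (classQ_layers hS e) hx

theorem inl_mem_layers (h : IsSiftIso S T e) {a : A} (ha : a ∈ qPart A) :
    e (T.inl A B a) ∈ Set.range fun y => toLex (Sum.inl y) := by
  obtain ⟨α, hα⟩ := exists_mem_layerSet ha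
  exact ⟨_, (h.inl_layer α ⟨a, hα⟩).symm⟩

theorem inr_mem_layers (h : IsSiftIso S T e) {b : B} (hb : b ∈ qPart B) :
    e (T.inr A B b) ∈ Set.range fun y => toLex (Sum.inl y) := by
  obtain ⟨α, hα⟩ := exists_mem_layerSet hb
  exact ⟨_, (h.inr_layer α ⟨b, hα⟩).symm⟩

theorem inr_mem_qPart_iff (h : IsSiftIso S T e)
    (hS : ∀ α A B, classQ ((S α).op (layer (cardFiltration classQ) α A)
      (layer (cardFiltration classQ) α B))) {b : B} :
    T.inr A B b ∈ qPart (T.op A B) ↔ b ∈ qPart B := by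
  refine ⟨mem_qPart_of_embedding _ _ (classQ_qPart _) ?_, fun hb =>
    mem_qPart_of_layers hS (h.inr_mem_layers hb)⟩
  intro y _ b hb hby
  have hle := e.monotone hby
  rw [h.inr_remainder ⟨b, mem_remainderSet.2 hb⟩] at hle
  obtain ⟨w, hw⟩ := toLex.surjective (e y)
  rw [← hw] at hle
  rcases w with w | w
  · exact absurd hle Sum.Lex.not_inr_le_inl
  obtain ⟨w, rfl⟩ := toLex.surjective w
  rcases w with w | w
  · exact absurd (Sum.Lex.inr_le_inr_iff.1 hle) Sum.Lex.not_inr_le_inl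
  · exact ⟨w.1, mem_remainderSet.1 w.2, e.injective ((h.inr_remainder w).trans hw)⟩

/-- The right summand must come first: points above A_R may belong to B_R, and `inr_mem_qPart_iff`
shows that these are not in the 𝒬-part. -/
theorem inl_mem_qPart_iff (h : IsSiftIso S T e)
    (hS : ∀ α A B, classQ ((S α).op (layer (cardFiltration classQ) α A)
      (layer (cardFiltration classQ) α B))) {a : A} :
    T.inl A B a ∈ qPart (T.op A B) ↔ a ∈ qPart A := by
  refine ⟨mem_qPart_of_embedding _ _ (classQ_qPart _) ?_, fun ha =>
    mem_qPart_of_layers hS (h.inl_mem_layers ha)⟩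
  intro y hy a ha hay
  have hle := e.monotone hay
  rw [h.inl_remainder ⟨a, mem_remainderSet.2 ha⟩] at hle
  obtain ⟨w, hw⟩ := toLex.surjective (e y)
  rw [← hw] at hle
  rcases w with w | w
  · exact absurd hle Sum.Lex.not_inr_le_inl
  obtain ⟨w, rfl⟩ := toLex.surjective w
  rcases w with w | w
  · exact ⟨w.1, mem_remainderSet.1 w.2, e.injective ((h.inl_remainder w).trans hw)⟩
  · obtain rfl : T.inr A B w.1 = y := e.injective ((h.inr_remainder w).trans hw)
    exact absurd ((h.inr_mem_qPart_iff hS).1 hy) (mem_remainderSet.1 w.2)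

theorem mem_qPart_iff (h : IsSiftIso S T e)
    (hS : ∀ α A B, classQ ((S α).op (layer (cardFiltration classQ) α A)
      (layer (cardFiltration classQ) α B))) {x : T.op A B} :
    x ∈ qPart (T.op A B) ↔ e x ∈ Set.range fun y => toLex (Sum.inl y) := by
  refine ⟨fun hx => ?_, mem_qPart_of_layers hS⟩
  rcases T.mem_range x with ⟨a, rfl⟩ | ⟨b, rfl⟩
  · exact h.inl_mem_layers ((h.inl_mem_qPart_iff hS).1 hx)
  · exact h.inr_mem_layers ((h.inr_mem_qPart_iff hS).1 hx)

theorem le_tailCard_inl (h : IsSiftIso S T e)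
    (hS : ∀ α A B, classQ ((S α).op (layer (cardFiltration classQ) α A)
      (layer (cardFiltration classQ) α B))) (a : A) :
    tailCard A a ≤ tailCard (T.op A B) (T.inl A B a) :=
  Cardinal.mk_le_of_injective (f := fun y : {y : A // y ∈ qPart A ∧ a ≤ y} =>
    (⟨T.inl A B y.1, (h.inl_mem_qPart_iff hS).2 y.2.1, (T.inl A B).monotone y.2.2⟩ :
      {y // y ∈ qPart (T.op A B) ∧ T.inl A B a ≤ y}))
    fun _ _ hxy => Subtype.ext ((T.inl A B).injective (congrArg Subtype.val hxy))

theorem le_tailCard_inr (h : IsSiftIso S T e)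
    (hS : ∀ α A B, classQ ((S α).op (layer (cardFiltration classQ) α A)
      (layer (cardFiltration classQ) α B))) (b : B) :
    tailCard B b ≤ tailCard (T.op A B) (T.inr A B b) :=
  Cardinal.mk_le_of_injective (f := fun y : {y : B // y ∈ qPart B ∧ b ≤ y} =>
    (⟨T.inr A B y.1, (h.inr_mem_qPart_iff hS).2 y.2.1, (T.inr A B).monotone y.2.2⟩ :
      {y // y ∈ qPart (T.op A B) ∧ T.inr A B b ≤ y}))
    fun _ _ hxy => Subtype.ext ((T.inr A B).injective (congrArg Subtype.val hxy))

/-- Points above `x` in the 𝒬-part come from layers of index at most α in `A` and `B`, which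
together have fewer than ℵ_(α+1) points. Conversely the tail of `x` contains the image of its tail
in `A` or `B`. -/
theorem tailCard_eq (h : IsSiftIso S T e)
    (hS : ∀ α A B, classQ ((S α).op (layer (cardFiltration classQ) α A)
      (layer (cardFiltration classQ) α B))) {x : T.op A B} {α : Ordinal.{u}}
    {w : (S α).op (layer (cardFiltration classQ) α A) (layer (cardFiltration classQ) α B)}
    (hx : e x = toLex (Sum.inl (toLex ⟨OrderDual.toDual α, w⟩))) :
    tailCard (T.op A B) x = ℵ_ α := by
  refine le_antisymm ?_ ?_
  · have hα := Cardinal.aleph0_le_aleph (α + 1)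
    have hlt : ∀ {β : Ordinal.{u}}, β ≤ α → ℵ_ β < ℵ_ (α + 1) := fun h =>
      Cardinal.aleph_lt_aleph.2 (Order.lt_succ_iff.2 h)
    have hsub : {z : T.op A B | z ∈ qPart (T.op A B) ∧ x ≤ z} ⊆
        T.inl A B '' {a | a ∈ qPart A ∧ tailCard A a < ℵ_ (α + 1)} ∪
          T.inr A B '' {b | b ∈ qPart B ∧ tailCard B b < ℵ_ (α + 1)} := by
      rintro z ⟨hz, hxz⟩
      obtain ⟨⟨β, v⟩, hv⟩ := (h.mem_qPart_iff hS).1 hz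
      have hβ : OrderDual.ofDual β ≤ α := by
        have := e.monotone hxz
        rw [hx, ← hv] at this
        exact sigmaLex_fst_mono (A := fun α : Ordinal.{u}ᵒᵈ => (S (OrderDual.ofDual α)).op
          (layer (cardFiltration classQ) (OrderDual.ofDual α) A)
          (layer (cardFiltration classQ) (OrderDual.ofDual α) B)) (Sum.Lex.inl_le_inl_iff.1 this)
      rcases h.exists_of_layer (α := OrderDual.ofDual β) hv.symm with ⟨a, ha, rfl⟩ | ⟨b, hb, rfl⟩
      · obtain ⟨h1, h2⟩ := mem_layerSet.1 ha
        exact Or.inl ⟨a, ⟨h1, h2 ▸ hlt hβ⟩, rfl⟩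
      · obtain ⟨h1, h2⟩ := mem_layerSet.1 hb
        exact Or.inr ⟨b, ⟨h1, h2 ▸ hlt hβ⟩, rfl⟩
    have := ((Cardinal.mk_le_mk_of_subset hsub).trans (Cardinal.mk_union_le _ _)).trans_lt
      (Cardinal.add_lt_of_lt hα (Cardinal.mk_image_le.trans_lt (mk_tailCard_lt A hα))
        (Cardinal.mk_image_le.trans_lt (mk_tailCard_lt B hα)))
    rwa [← Cardinal.succ_aleph, Order.lt_succ_iff] at this
  · rcases h.exists_of_layer hx with ⟨a, ha, rfl⟩ | ⟨b, hb, rfl⟩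
    · rw [← (mem_layerSet.1 ha).2]
      exact h.le_tailCard_inl hS a
    · rw [← (mem_layerSet.1 hb).2]
      exact h.le_tailCard_inr hS b

theorem mem_layerSet_iff (h : IsSiftIso S T e)
    (hS : ∀ α A B, classQ ((S α).op (layer (cardFiltration classQ) α A)
      (layer (cardFiltration classQ) α B))) {x : T.op A B} {α : Ordinal.{u}} :
    x ∈ layerSet α (T.op A B) ↔
      e x ∈ Set.range fun w => toLex (Sum.inl (toLex ⟨OrderDual.toDual α, w⟩)) := by
  rw [mem_layerSet]
  constructor
  · rintro ⟨hx, hα⟩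
    obtain ⟨⟨β, v⟩, hv⟩ := (h.mem_qPart_iff hS).1 hx
    have := h.tailCard_eq hS (α := OrderDual.ofDual β) hv.symm
    obtain rfl : α = OrderDual.ofDual β := Cardinal.aleph.injective (hα.symm.trans this)
    exact ⟨v, hv⟩
  · rintro ⟨w, hw⟩
    exact ⟨(h.mem_qPart_iff hS).2 ⟨_, hw⟩, h.tailCard_eq hS hw.symm⟩

end IsSiftIso

section Sifted

variable {S : Ordinal.{u} → LinSum.{u}} {T : LinSum.{u}}

theorem IsSiftedSum.layer_op (h : IsSiftedSum (cardFiltration classQ) S T)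
    (hS : ∀ α A B, classQ ((S α).op (layer (cardFiltration classQ) α A)
      (layer (cardFiltration classQ) α B))) (α : Ordinal.{u}) (A B : LinOrd.{u}) :
    OrdIso (layer (cardFiltration classQ) α (T.op A B)) ((S α).op
      (layer (cardFiltration classQ) α A) (layer (cardFiltration classQ) α B)) := by
  obtain ⟨e, he⟩ := h.exists_isSiftIso A B
  obtain ⟨k⟩ := nonempty_preimageIso e
    (fun w => toLex (Sum.inl (toLex ⟨OrderDual.toDual α, w⟩)))
    fun _ _ h => Sum.Lex.inl_lt_inl_iff.2 (strictMono_sigmaLexMk _ h)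
  exact (OrdIso.subtype (OrderIso.refl _) fun x => he.mem_layerSet_iff hS).trans ⟨k⟩

theorem IsSiftedSum.remainder_op (h : IsSiftedSum (cardFiltration classQ) S T)
    (hS : ∀ α A B, classQ ((S α).op (layer (cardFiltration classQ) α A)
      (layer (cardFiltration classQ) α B))) (A B : LinOrd.{u}) :
    OrdIso (remainder (cardFiltration classQ) (T.op A B)) (concat
      (remainder (cardFiltration classQ) A) (remainder (cardFiltration classQ) B)) := by
  obtain ⟨e, he⟩ := h.exists_isSiftIso A B
  obtain ⟨k⟩ := nonempty_preimageIso e (fun w => toLex (Sum.inr w))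
    fun _ _ h => Sum.Lex.inr_lt_inr_iff.2 h
  refine (OrdIso.subtype (OrderIso.refl _) fun x => ?_).trans ⟨k⟩
  refine (mem_remainderSet.trans (not_congr (he.mem_qPart_iff hS))).trans ?_
  show _ ↔ e x ∈ _
  obtain ⟨w, hw⟩ := toLex.surjective (e x)
  rw [← hw]
  rcases w with w | w
  · refine iff_of_false (fun h => h ⟨w, rfl⟩) ?_
    rintro ⟨v, hv⟩
    exact Sum.inr_ne_inl (toLex.injective hv)
  · refine iff_of_true ?_ ⟨w, rfl⟩
    rintro ⟨v, hv⟩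
    exact Sum.inl_ne_inr (toLex.injective hv)

theorem IsSiftedSum.op_congr (h : IsSiftedSum (cardFiltration classQ) S T) {A B A' B' : LinOrd.{u}}
    (hl : ∀ α, OrdIso ((S α).op (layer (cardFiltration classQ) α A)
      (layer (cardFiltration classQ) α B)) ((S α).op (layer (cardFiltration classQ) α A')
      (layer (cardFiltration classQ) α B')))
    (hr : OrdIso (concat (remainder (cardFiltration classQ) A) (remainder (cardFiltration classQ) B))
      (concat (remainder (cardFiltration classQ) A') (remainder (cardFiltration classQ) B'))) :
    OrdIso (T.op A B) (T.op A' B') := by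
  obtain ⟨e, -⟩ := h.exists_isSiftIso A B
  obtain ⟨e', -⟩ := h.exists_isSiftIso A' B'
  obtain ⟨r⟩ := hr
  obtain ⟨l⟩ := nonempty_sigmaLexCongr (OrderIso.refl Ordinal.{u}ᵒᵈ)
    (A := fun α => (S (OrderDual.ofDual α)).op (layer (cardFiltration classQ) (OrderDual.ofDual α) A)
      (layer (cardFiltration classQ) (OrderDual.ofDual α) B))
    (B := fun α => (S (OrderDual.ofDual α)).op (layer (cardFiltration classQ) (OrderDual.ofDual α) A')
      (layer (cardFiltration classQ) (OrderDual.ofDual α) B')) fun α => hl (OrderDual.ofDual α)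
  exact ⟨(e.trans (OrderIso.sumLexCongr l r)).trans e'.symm⟩

end Sifted

/-! ### Regularity and associativity of sifted sums -/

theorem LinSum.splits_op (S : LinSum.{u}) (A B : LinOrd.{u}) : Splits (S.op A B) A B :=
  ⟨S.inl A B, S.inr A B, S.isCompl_range A B⟩

theorem LinSum.op_isEmpty (S : LinSum.{u}) (A B : LinOrd.{u}) [IsEmpty B] : OrdIso (S.op A B) A :=
  (S.splits_op A B).iso_left

theorem LinSum.isEmpty_op (S : LinSum.{u}) (A B : LinOrd.{u}) [IsEmpty A] : OrdIso (S.op A B) B :=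
  (S.splits_op A B).symm.iso_left

theorem LinSum.countable_op (S : LinSum.{u}) (A B : LinOrd.{u}) [Countable A] [Countable B] :
    Countable (S.op A B) :=
  (S.sumEquiv A B).symm.injective.countable

theorem isEmpty_or_countableQ {L : LinOrd.{u}} (h : classQ L) (hc : Countable L) :
    IsEmpty L ∨ countableQ L :=
  (isEmpty_or_nonempty L).imp_right fun hn => countableQ_iff.2 ⟨h, hc, hn⟩

namespace LinSum.IsGoodOn

variable {S : LinSum.{u}}

/-- A layer can be empty, and goodness says nothing about the empty order. A sum with an empty
summand is isomorphic to the other summand, which covers this case here and below. -/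
theorem classQ_op (h : S.IsGoodOn countableQ) {A B : LinOrd.{u}} (hA : classQ A) (hB : classQ B)
    (cA : Countable A) (cB : Countable B) : classQ (S.op A B) := by
  rcases isEmpty_or_countableQ hA cA with hA' | hA'
  · exact (S.isEmpty_op A B).symm.classQ hB
  rcases isEmpty_or_countableQ hB cB with hB' | hB'
  · exact (S.op_isEmpty A B).symm.classQ hA
  exact (h.op_mem A B hA' hB').1

theorem op_congr (h : S.IsGoodOn countableQ) {A A' B B' : LinOrd.{u}} (hA : classQ A)
    (hB : classQ B) (cA : Countable A) (cB : Countable B) (eA : OrdIso A A') (eB : OrdIso B B') :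
    OrdIso (S.op A B) (S.op A' B') := by
  rcases isEmpty_or_countableQ hA cA with hA' | hA'
  · have : IsEmpty A' := eA.some.symm.toEquiv.isEmpty
    exact ((S.isEmpty_op A B).trans eB).trans (S.isEmpty_op A' B').symm
  rcases isEmpty_or_countableQ hB cB with hB' | hB'
  · have : IsEmpty B' := eB.some.symm.toEquiv.isEmpty
    exact ((S.op_isEmpty A B).trans eA).trans (S.op_isEmpty A' B').symm
  exact h.regular A A' B B' hA' (eA.countableQ hA') hB' (eB.countableQ hB') eA eB

theorem op_assoc (h : S.IsGoodOn countableQ) {A B C : LinOrd.{u}} (hA : classQ A)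
    (hB : classQ B) (hC : classQ C) (cA : Countable A) (cB : Countable B) (cC : Countable C) :
    OrdIso (S.op A (S.op B C)) (S.op (S.op A B) C) := by
  rcases isEmpty_or_countableQ hA cA with hA' | hA'
  · exact (S.isEmpty_op A _).trans
      (h.op_congr hB hC cB cC (S.isEmpty_op A B).symm (OrdIso.refl C))
  rcases isEmpty_or_countableQ hB cB with hB' | hB'
  · exact (h.op_congr hA hC cA cC (OrdIso.refl A) (S.isEmpty_op B C).symm).symm.trans
      (h.op_congr hA hC cA cC (S.op_isEmpty A B).symm (OrdIso.refl C))
  rcases isEmpty_or_countableQ hC cC with hC' | hC'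
  · exact (h.op_congr hA hB cA cB (OrdIso.refl A) (S.op_isEmpty B C).symm).symm.trans
      (S.op_isEmpty _ C).symm
  exact h.assoc A B C hA' hB' hC'

end LinSum.IsGoodOn

theorem countable_layer_zero (L : LinOrd.{u}) : Countable (layer (cardFiltration classQ) 0 L) := by
  have := mk_layer_le 0 L
  rwa [Cardinal.aleph_zero, Cardinal.mk_le_aleph0_iff] at this

theorem qPart_eq_top {L : LinOrd.{u}} (h : classQ L) (a : L) : a ∈ qPart L :=
  le_qPart (I := ⊤) ((OrdIso.symm ⟨StrictMono.orderIsoOfSurjective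
    (fun a : (⊤ : LowerSet L) => a.1) (fun _ _ h => h) fun a =>
      ⟨(⟨a, trivial⟩ : (⊤ : LowerSet L)), rfl⟩⟩).classQ h) trivial

theorem OrdIso.layer_zero {L : LinOrd.{u}} (h : _root_.classQ L) [Countable L] :
    OrdIso (_root_.layer (cardFiltration _root_.classQ) 0 L) L := by
  refine ⟨StrictMono.orderIsoOfSurjective (fun a : layerSet 0 L => a.1)
    (fun _ _ h => h) fun a => ⟨(⟨a, ?_⟩ : layerSet 0 L), rfl⟩⟩
  have ha := qPart_eq_top h a
  refine mem_layerSet.2 ⟨ha, le_antisymm ?_ ?_⟩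
  · rw [Cardinal.aleph_zero]
    exact Cardinal.mk_le_aleph0
  · rw [Cardinal.aleph_zero]
    exact aleph0_le_tailCard ha

section SchemeFrom

variable {S₀ T : LinSum.{u}}

theorem schemeFrom_zero : schemeFrom S₀ 0 = S₀ := if_pos rfl

theorem schemeFrom_of_ne {α : Ordinal.{u}} (h : α ≠ 0) : schemeFrom S₀ α = LinSum.std := if_neg h

theorem classQ_schemeFrom_layer (h : S₀.IsGoodOn countableQ) (α : Ordinal.{u}) (A B : LinOrd.{u}) :
    classQ ((schemeFrom S₀ α).op (layer (cardFiltration classQ) α A)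
      (layer (cardFiltration classQ) α B)) := by
  rcases eq_or_ne α 0 with rfl | hα
  · rw [schemeFrom_zero]
    exact h.classQ_op (classQ_layer 0 A) (classQ_layer 0 B) (countable_layer_zero A)
      (countable_layer_zero B)
  · rw [schemeFrom_of_ne hα]
    exact classQ_concat (classQ_layer α A) (classQ_layer α B)

theorem schemeFrom_layer_congr (h : S₀.IsGoodOn countableQ) (α : Ordinal.{u}) (A B : LinOrd.{u})
    {A' B' : LinOrd.{u}} (eA : OrdIso (layer (cardFiltration classQ) α A) A')
    (eB : OrdIso (layer (cardFiltration classQ) α B) B') :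
    OrdIso ((schemeFrom S₀ α).op (layer (cardFiltration classQ) α A)
      (layer (cardFiltration classQ) α B)) ((schemeFrom S₀ α).op A' B') := by
  rcases eq_or_ne α 0 with rfl | hα
  · rw [schemeFrom_zero]
    exact h.op_congr (classQ_layer 0 A) (classQ_layer 0 B) (countable_layer_zero A)
      (countable_layer_zero B) eA eB
  · rw [schemeFrom_of_ne hα]
    exact eA.concat eB

theorem schemeFrom_layer_assoc (h : S₀.IsGoodOn countableQ) (α : Ordinal.{u})
    (A B C : LinOrd.{u}) :
    OrdIso ((schemeFrom S₀ α).op (layer (cardFiltration classQ) α A)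
      ((schemeFrom S₀ α).op (layer (cardFiltration classQ) α B) (layer (cardFiltration classQ) α C)))
      ((schemeFrom S₀ α).op ((schemeFrom S₀ α).op (layer (cardFiltration classQ) α A)
        (layer (cardFiltration classQ) α B)) (layer (cardFiltration classQ) α C)) := by
  rcases eq_or_ne α 0 with rfl | hα
  · rw [schemeFrom_zero]
    exact h.op_assoc (classQ_layer 0 A) (classQ_layer 0 B) (classQ_layer 0 C)
      (countable_layer_zero A) (countable_layer_zero B) (countable_layer_zero C)
  · rw [schemeFrom_of_ne hα]
    exact (OrdIso.assoc _ _ _).symm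

theorem IsSiftedFrom.isRegular (hT : IsSiftedFrom S₀ T) (h : S₀.IsGoodOn countableQ) :
    T.IsRegular := fun A _ B _ eA eB =>
  IsSiftedSum.op_congr hT (fun α => schemeFrom_layer_congr h α A B (eA.layer α) (eB.layer α))
    (eA.remainder.concat eB.remainder)

theorem IsSiftedFrom.isAssociative (hT : IsSiftedFrom S₀ T) (h : S₀.IsGoodOn countableQ) :
    T.IsAssociative := by
  intro A B C
  have hS := classQ_schemeFrom_layer h
  refine IsSiftedSum.op_congr hT (fun α => ?_) ?_
  · exact ((schemeFrom_layer_congr h α A (T.op B C) (OrdIso.refl _)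
      (IsSiftedSum.layer_op hT hS α B C)).trans (schemeFrom_layer_assoc h α A B C)).trans
      (schemeFrom_layer_congr h α (T.op A B) C (IsSiftedSum.layer_op hT hS α A B)
        (OrdIso.refl _)).symm
  · exact (((OrdIso.refl _).concat (IsSiftedSum.remainder_op hT hS B C)).trans
      (OrdIso.assoc _ _ _).symm).trans
      ((IsSiftedSum.remainder_op hT hS A B).concat (OrdIso.refl _)).symm

theorem IsSiftedFrom.op_of_countableQ (hT : IsSiftedFrom S₀ T) (h : S₀.IsGoodOn countableQ)
    {A B : LinOrd.{u}} (hA : countableQ A) (hB : countableQ B) :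
    OrdIso (T.op A B) (S₀.op A B) := by
  have hS := classQ_schemeFrom_layer h
  obtain ⟨hA', _, -⟩ := countableQ_iff.1 hA
  obtain ⟨hB', _, -⟩ := countableQ_iff.1 hB
  obtain ⟨e, he⟩ := IsSiftedSum.exists_isSiftIso hT A B
  have hQ : classQ (T.op A B) := by
    refine OrdIso.classQ ⟨StrictMono.orderIsoOfSurjective (fun a : qPart (T.op A B) => a.1)
      (fun _ _ h => h) fun x => ⟨(⟨x, ?_⟩ : qPart (T.op A B)), rfl⟩⟩ (classQ_qPart (T.op A B))
    rcases T.mem_range x with ⟨a, rfl⟩ | ⟨b, rfl⟩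
    · exact (he.inl_mem_qPart_iff hS).2 (qPart_eq_top hA' a)
    · exact (he.inr_mem_qPart_iff hS).2 (qPart_eq_top hB' b)
  have := T.countable_op A B
  have h0 := IsSiftedSum.layer_op hT hS 0 A B
  rw [schemeFrom_zero] at h0
  exact ((OrdIso.layer_zero hQ).symm.trans h0).trans (h.op_congr (classQ_layer 0 A)
    (classQ_layer 0 B) (countable_layer_zero A) (countable_layer_zero B) (OrdIso.layer_zero hA')
    (OrdIso.layer_zero hB'))

theorem IsSiftedFrom.hasTable (hT : IsSiftedFrom S₀ T) (h : S₀.IsGoodOn countableQ) {ι : Type}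
    {x : ι → LinOrd.{u}} {m : ι → ι → ι} (hx : ∀ i, countableQ (x i)) (hm : S₀.HasTable x m) :
    T.HasTable x m :=
  fun i j => (hT.op_of_countableQ h (hx i) (hx j)).trans (hm i j)

end SchemeFrom

/-! ### Failure of canonical regularity -/

theorem inr_covBy_inr {A B : LinOrd.{u}} {u v : B} (h : u ⋖ v) :
    (toLex (Sum.inr u) : A ⊕ₗ B) ⋖ toLex (Sum.inr v) := by
  refine ⟨Sum.Lex.inr_lt_inr_iff.2 h.lt, fun z h1 h2 => ?_⟩
  obtain ⟨z, rfl⟩ := toLex.surjective z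
  rcases z with z | z
  · exact Sum.Lex.not_inr_lt_inl h1
  · exact h.2 (Sum.Lex.inr_lt_inr_iff.1 h1) (Sum.Lex.inr_lt_inr_iff.1 h2)

theorem exists_covBy_lt_rat2 (x : rat2.{u}) : ∃ u v : rat2.{u}, u ⋖ v ∧ v < x := by
  obtain ⟨q, i⟩ := x
  exact ⟨_, _, rat2_covBy (q - 1), sigmaLex_mk_lt (A := fun _ : ℚ => Fin 2) (sub_one_lt q) _ _⟩

theorem exists_covBy_lt_rat2_concat_rat (x : concat rat2.{u} rat) :
    ∃ u v : concat rat2.{u} rat, u ⋖ v ∧ v < x := by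
  obtain ⟨x, rfl⟩ := toLex.surjective x
  rcases x with x | x
  · obtain ⟨u, v, h1, h2⟩ := exists_covBy_lt_rat2 x
    exact ⟨_, _, inl_covBy_inl h1, Sum.Lex.inl_lt_inl_iff.2 h2⟩
  · exact ⟨_, _, inl_covBy_inl (rat2_covBy 0), Sum.Lex.inl_lt_inr _ _⟩

/-- The point `x` is not the least one, there is no jump up to `x`, and there are jumps right
after `x`. -/
def IsFirstJumpLimit {L : LinOrd.{u}} (x : L) : Prop :=
  ¬ IsBot x ∧ (∀ u v, u ⋖ v → ¬ v ≤ x) ∧ ∀ z, x < z → ∃ u v, x < u ∧ u ⋖ v ∧ v < z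

/-- The first point is excluded as least, points of the first ℚ have no jumps just above them, and
every later point has jumps below it. A point between ℚ and ℚ(2) would qualify, but there is none.
-/
theorem not_isFirstJumpLimit_tripleE_two (x : tripleE.{u} 2) : ¬ IsFirstJumpLimit x := by
  change (finOrd.{u} 1 ⊕ₗ (rat.{u} ⊕ₗ (rat2.{u} ⊕ₗ rat.{u})) : Type u) at x
  rintro ⟨h1, h2, h3⟩
  obtain ⟨x, rfl⟩ := toLex.surjective x
  rcases x with x | x
  · exact h1 (isBot_inl fun _ => (Subsingleton.elim _ _).le)
  obtain ⟨x, rfl⟩ := toLex.surjective x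
  rcases x with x | x
  · obtain ⟨z, hz⟩ := exists_gt x
    obtain ⟨u, v, hu, huv, hv⟩ := h3 (toLex (Sum.inr (toLex (Sum.inl z))))
      (Sum.Lex.inr_lt_inr_iff.2 (Sum.Lex.inl_lt_inl_iff.2 hz))
    have key : ∀ w : finOrd.{u} 1 ⊕ₗ (rat.{u} ⊕ₗ (rat2.{u} ⊕ₗ rat.{u})),
        toLex (Sum.inr (toLex (Sum.inl x))) < w → w < toLex (Sum.inr (toLex (Sum.inl z))) →
        ∃ q, w = toLex (Sum.inr (toLex (Sum.inl q))) := by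
      intro w h1 h2
      obtain ⟨w, rfl⟩ := toLex.surjective w
      rcases w with w | w
      · exact absurd h1 Sum.Lex.not_inr_lt_inl
      obtain ⟨w, rfl⟩ := toLex.surjective w
      rcases w with w | w
      · exact ⟨w, rfl⟩
      · exact absurd (Sum.Lex.inr_lt_inr_iff.1 h2) Sum.Lex.not_inr_lt_inl
    obtain ⟨p, rfl⟩ := key u hu (huv.lt.trans hv)
    obtain ⟨q, rfl⟩ := key v (hu.trans huv.lt) hv
    obtain ⟨r, hr1, hr2⟩ := exists_between
      (Sum.Lex.inl_lt_inl_iff.1 (Sum.Lex.inr_lt_inr_iff.1 huv.lt))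
    exact huv.2 (c := toLex (Sum.inr (toLex (Sum.inl r))))
      (Sum.Lex.inr_lt_inr_iff.2 (Sum.Lex.inl_lt_inl_iff.2 hr1))
      (Sum.Lex.inr_lt_inr_iff.2 (Sum.Lex.inl_lt_inl_iff.2 hr2))
  · obtain ⟨u, v, huv, hv⟩ := exists_covBy_lt_rat2_concat_rat x
    exact h2 _ _ (inr_covBy_inr (A := finOrd 1) (inr_covBy_inr (A := rat) huv))
      (Sum.Lex.inr_le_inr_iff.2 (Sum.Lex.inr_le_inr_iff.2 hv.le))

theorem exists_isBot_covBy_jumps_tripleE_zero : ∃ x y : tripleE.{u} 0, IsBot x ∧ x ⋖ y ∧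
    ∀ z, y < z → ∃ u v, y < u ∧ u ⋖ v ∧ v < z := by
  refine ⟨_, _, isBot_inl isBot_finOrd_two, inl_covBy_inl finOrd_two_covBy, fun z hz => ?_⟩
  obtain ⟨z, rfl⟩ := toLex.surjective z
  rcases z with z | z
  · have h : (⟨(1 : Fin 2)⟩ : finOrd.{u} 2) < z := Sum.Lex.inl_lt_inl_iff.1 hz
    have h' : (1 : Fin 2) < z.down := h
    omega
  · obtain ⟨u, v, huv, hv⟩ := exists_covBy_lt_rat2_concat_rat z
    exact ⟨_, _, Sum.Lex.inl_lt_inr _ u, inr_covBy_inr huv, Sum.Lex.inr_lt_inr_iff.2 hv⟩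

theorem exists_orderIso_rat (a b : rat.{u}) : ∃ e : rat.{u} ≃o rat.{u}, e a = b := by
  refine ⟨(ULift.orderIso.trans (OrderIso.addRight (b.down - a.down))).trans
    ULift.orderIso.symm, ULift.down_injective ?_⟩
  show a.down + (b.down - a.down) = b.down
  ring

theorem not_isCanonicallyRegular_of_hasTable {T : LinSum.{u}} (hT : T.HasTable tripleE tableE) :
    ¬ T.IsCanonicallyRegular := by
  intro hc
  let A : LinOrd.{u} := tripleE 0
  let f := T.inl A rat
  let g := T.inr A rat
  obtain ⟨k⟩ : OrdIso (T.op A rat) (tripleE 2) := hT 0 1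
  -- Extend the identity of `A` together with an automorphism of ℚ moving `b` to `b'`.
  have side : ∀ (a : A) (b b' : rat), f a < g b → f a < g b' := by
    intro a b b' h
    obtain ⟨ψ, rfl⟩ := exists_orderIso_rat b b'
    obtain ⟨χ, h1, h2⟩ := hc A A rat rat (OrderIso.refl A) ψ
    have := χ.strictMono h
    rwa [h1, h2] at this
  obtain ⟨x, y, hx, hxy, hj⟩ := exists_isBot_covBy_jumps_tripleE_zero.{u}
  have hbot : IsBot (f x) := by
    obtain ⟨z, hz⟩ := exists_isBot_tripleE_two.{u}
    have hz' : ∀ w, k.symm z ≤ w := fun w => (OrderIso.symm_apply_le k).2 (hz _)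
    rcases T.mem_range (k.symm z) with ⟨a, ha⟩ | ⟨b, hb⟩
    · exact fun w => ((f.monotone (hx a)).trans ha.le).trans (hz' w)
    · obtain ⟨b', hb'⟩ := exists_lt b
      exact absurd (hb.le.trans (hz' (g b'))) (not_le.2 (g.strictMono hb'))
  have hcov : ∀ z, ¬ f x ⋖ z := fun z h => not_exists_isBot_covBy_tripleE_two.{u}
    ⟨k (f x), k z, fun w => (OrderIso.le_symm_apply k).1 (hbot _), (apply_covBy_apply_iff k).2 h⟩
  have hxg : ∀ b, f x < g b := fun b => lt_of_le_of_ne (hbot _) (T.inl_ne_inr x b)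
  -- If one point of ℚ lay above `f y`, then all would, and `f y` would be the successor of the
  -- least point.
  have hgy : ∀ b, g b < f y := by
    intro b'
    by_contra hb'
    have hyb : f y < g b' := lt_of_le_of_ne (not_lt.1 hb') (T.inl_ne_inr y b')
    refine hcov (f y) ⟨f.strictMono hxy.lt, fun z h1 h2 => ?_⟩
    rcases T.mem_range z with ⟨a, rfl⟩ | ⟨b, rfl⟩
    · exact hxy.2 (f.lt_iff_lt.1 h1) (f.lt_iff_lt.1 h2)
    · exact h2.not_gt (side y b' b hyb)
  have habove : ∀ z, f y < z → ∃ a, f a = z := by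
    intro z hz
    rcases T.mem_range z with h | ⟨b, rfl⟩
    · exact h
    · exact absurd hz (hgy b).not_gt
  have hfx : ∀ a, f a < f y → a = x := fun a h => by
    by_contra hne
    exact hxy.2 (lt_of_le_of_ne (hx a) (Ne.symm hne)) (f.lt_iff_lt.1 h)
  refine not_isFirstJumpLimit_tripleE_two (k (f y)) ⟨fun h => ?_, fun u v huv hv => ?_,
    fun z hz => ?_⟩
  · have := h (k (f x))
    rw [k.le_iff_le, f.le_iff_le] at this
    exact this.not_gt hxy.lt
  -- Up to `f y` the order consists of `f x`, the copy of ℚ and `f y`. The point `f x` has no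
  -- successor, and ℚ is dense and has no greatest element, so there is no jump.
  · obtain ⟨u, rfl⟩ := k.surjective u
    obtain ⟨v, rfl⟩ := k.surjective v
    rw [apply_covBy_apply_iff] at huv
    rw [k.le_iff_le] at hv
    rcases T.mem_range u with ⟨a, rfl⟩ | ⟨b, rfl⟩
    · obtain rfl := hfx a (huv.lt.trans_le hv)
      exact hcov v huv
    rcases T.mem_range v with ⟨a, rfl⟩ | ⟨b', rfl⟩
    · rcases hv.eq_or_lt with h | h
      · obtain ⟨b', hb'⟩ := exists_gt b
        refine huv.2 (g.strictMono hb') ?_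
        rw [show T.inl A rat a = f y from h]
        exact hgy b'
      · obtain rfl := hfx a h
        exact huv.lt.not_gt (hxg b)
    · obtain ⟨c, h1, h2⟩ := exists_between (g.lt_iff_lt.1 huv.lt)
      exact huv.2 (g.strictMono h1) (g.strictMono h2)
  · obtain ⟨z, rfl⟩ := k.surjective z
    rw [k.lt_iff_lt] at hz
    obtain ⟨a, rfl⟩ := habove z hz
    obtain ⟨u, v, h1, h2, h3⟩ := hj a (f.lt_iff_lt.1 hz)
    refine ⟨k (f u), k (f v), k.strictMono (f.strictMono h1), (apply_covBy_apply_iff k).2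
      ⟨f.strictMono h2.lt, fun w hw1 hw2 => ?_⟩, k.strictMono (f.strictMono h3)⟩
    obtain ⟨w, rfl⟩ := habove w ((f.strictMono h1).trans hw1)
    exact h2.2 (f.lt_iff_lt.1 hw1) (f.lt_iff_lt.1 hw2)

theorem mainTheorem11 :
    (∃ S₀ S : LinSum.{u},
      S₀.IsGoodOn countableQ ∧ S₀.HasTable tripleE tableE ∧
      IsSiftedFrom S₀ S ∧
      S.IsRegular ∧ S.IsAssociative ∧ S.HasTable tripleE tableE ∧
      ¬ S.IsCanonicallyRegular) ∧
    (∃ S₀ S : LinSum.{u},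
      S₀.IsGoodOn countableQ ∧ S₀.HasTable pairZ2 (fun g h => g + h) ∧
      IsSiftedFrom S₀ S ∧
      S.IsAssociative ∧
      ∃ hS : S.IsRegular,
        IsRepresentation (S.typeOp hS)
          (fun g : Multiplicative (ZMod 2) => OrderType.type (pairZ2 g.toAdd))) := by
  constructor
  · obtain ⟨S₀, h, ht⟩ := exists_isGoodOn_tripleE.{u}
    obtain ⟨S, hS⟩ : ∃ S, IsSiftedFrom S₀ S := exists_isSiftedSum (schemeFrom S₀)
    have hT := hS.hasTable h countableQ_tripleE ht
    exact ⟨S₀, S, h, ht, hS, hS.isRegular h, hS.isAssociative h, hT,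
      not_isCanonicallyRegular_of_hasTable hT⟩
  · obtain ⟨S₀, h, ht⟩ := exists_isGoodOn_pairZ2.{u}
    obtain ⟨S, hS⟩ : ∃ S, IsSiftedFrom S₀ S := exists_isSiftedSum (schemeFrom S₀)
    have hT := hS.hasTable h countableQ_pairZ2 ht
    refine ⟨S₀, S, h, ht, hS, hS.isAssociative h, hS.isRegular h, fun g g' hg => ?_, fun g g' => ?_⟩
    · exact Multiplicative.toAdd.injective (pairZ2_injective _ _ (type_eq_type_iff.1 hg))
    · exact (type_eq_type_iff.2 (hT g.toAdd g'.toAdd)).symm
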